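/- Let $d\ge 1$, let $f:\mathbb Z^d\to\mathbb R$ be bounded, and let $A=-\Delta+f$ be the discrete Schrödinger operator on $\ell^2(\mathbb Z^d)$, $$[Au]_n=-\sum_{|m-n|=1}u_m+2d\,u_n+f(n)u_n ,$$ where $|\cdot|$ is the Euclidean norm. Assume that the spectrum $\sigma(A)$ has a bounded gap $\Lambda=(\lambda_-,\lambda_+)$, that is, $\lambda_-<\lambda_+$, $\lambda_\pm\in\sigma(A)$ and $\Lambda\cap\sigma(A)=\emptyset$. For a bounded set $\Omega\subset\mathbb R^d$ let $A_\Omega$ be the operator on $\ell^2(\Omega\cap\mathbb Z^d)$ given by $[A_\Omega u]_n=-\sum_{|m-n|=1,\ m\in\Omega\cap\mathbb Z^d}u_m+2d\,u_n+f(n)u_n$, and let $N(A_\Omega,\mu)$ be the number of its eigenvalues, counted with multiplicity, that are strictly smaller than $\mu$. Assume that the density of states exists: there is a function $\rho:\mathbb R\to\mathbb R$ such that for every bounded domain (nonempty connected open set) $\Omega\subset\mathbb R^d$ whose boundary has Lebesgue measure zero and for every $\mu\in\mathbb R$, $$\lim_{\beta\to\infty}\frac{N(A_{\beta\Omega},\mu)}{\beta^d\,\mathrm{vol}\,\Omega}=\rho(\mu).$$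 Let $p>0$, let $\Psi$ be a continuous real function on the unit sphere of $\mathbb R^d$, and let $V:\mathbb Z^d\to[0,\infty)$ satisfy $V(n)\sim\Psi(\theta)|n|^{-p}$ as $|n|\to\infty$, with $\theta=n/|n|$, in the sense that $|n|^pV(n)-\Psi(n/|n|)\to0$. For $\lambda\in\Lambda$ and $\alpha>0$ let $$N(\lambda,\alpha)=\sum_{0<t<\alpha}\dim\ker(A-tV-\lambda)$$ be the number of eigenvalues of $A(t)=A-tV$, counted with multiplicity, that pass through $\lambda$ as $t$ increases from $0$ to $\alpha$. Then for every $\lambda\in\Lambda$ the number $N(\lambda,\alpha)$ is finite for all $\alpha>0$, the function $x\mapsto\rho(\lambda+\Psi(\theta)|x|^{-p})-\rho(\lambda)$, $\theta=x/|x|$, is integrable on $\mathbb R^d$, and $$\lim_{\alpha\to\infty}\alpha^{-d/p}N(\lambda,\alpha)=\int_{\mathbb R^d}\bigl(\rho(\lambda+\Psi(\theta)|x|^{-p})-\rho(\lambda)\bigr)\,dx .$$ In particular, if the integral is nonzero, then $$N(\lambda,\alpha)\sim\alpha^{d/p}\int_{\mathbb R^d}\bigl(\rho(\lambda+\Psi(\theta)|x|^{-p})-\rho(\lambda)\bigr)\,dx\qquad\text{as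 }\alpha\to\infty .$$ -/

import Mathlib

open Filter Topology MeasureTheory
open scoped ENNReal lp

noncomputable section

/-- The lattice `ℤ^d`. -/
abbrev Zd (d : ℕ) : Type := Fin d → ℤ

/-- The Hilbert space `ℓ²(ℤ^d)` of square-summable complex-valued functions. -/
abbrev L2 (d : ℕ) : Type := ℓ²(Zd d, ℂ)

/-- A lattice point regarded as a point of Euclidean space; `‖pt n‖` is the Euclidean length `|n|`. -/
def pt {d : ℕ} (n : Zd d) : EuclideanSpace ℝ (Fin d) :=
  WithLp.toLp 2 fun i => (n i : ℝ)

/-- A bounded region of `ℝ^d` contains finitely many lattice points. -/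
theorem finite_lattice_of_isBounded {d : ℕ} {Ω : Set (EuclideanSpace ℝ (Fin d))}
    (hΩ : Bornology.IsBounded Ω) : {n : Zd d | pt n ∈ Ω}.Finite := by
  obtain ⟨R, hR⟩ := hΩ.exists_norm_le
  refine (Set.finite_Icc (fun _ : Fin d => -⌈R⌉) (fun _ => ⌈R⌉)).subset ?_
  intro n hn
  have h (i : Fin d) : |(n i : ℝ)| ≤ (⌈R⌉ : ℝ) := by
    have h1 := PiLp.norm_apply_le (pt n) i
    have h2 := hR _ hn
    simp only [pt, Real.norm_eq_abs] at h1 h2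
    exact (h1.trans h2).trans (Int.le_ceil R)
  refine ⟨fun i => ?_, fun i => ?_⟩
  · exact_mod_cast (abs_le.1 (h i)).1
  · exact_mod_cast (abs_le.1 (h i)).2

/-- The finite set `Ω ∩ ℤ^d` for a bounded region `Ω`. -/
def latticePoints {d : ℕ} (Ω : Set (EuclideanSpace ℝ (Fin d))) (hΩ : Bornology.IsBounded Ω) :
    Finset (Zd d) :=
  (finite_lattice_of_isBounded hΩ).toFinset

/-- The lattice vectors of Euclidean length one. -/
def unitVectors (d : ℕ) : Finset (Zd d) :=
  latticePoints (Metric.sphere 0 1) Metric.isBounded_sphere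

theorem mem_unitVectors {d : ℕ} (v : Zd d) : v ∈ unitVectors d ↔ ‖pt v‖ = 1 := by
  simp [unitVectors, latticePoints]

/-- Translation on `ℓ²(ℤ^d)`: `(T_v u)(n) = u(n + v)`. -/
def translation {d : ℕ} (v : Zd d) : L2 d →L[ℂ] L2 d :=
  LinearMap.mkContinuous
    { toFun := fun u => ⟨fun n => u (n + v), by
        have h := (lp.memℓp u).summable (by norm_num)
        exact memℓp_gen (h.comp_injective (add_left_injective v))⟩
      map_add' := fun _ _ => rfl
      map_smul' := fun _ _ => rfl }
    1
    (fun u => by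
      rw [one_mul]
      refine lp.norm_le_of_tsum_le (by norm_num) (norm_nonneg u) ?_
      rw [lp.norm_rpow_eq_tsum (by norm_num) u]
      exact ((Equiv.addRight v).tsum_eq fun n => ‖u n‖ ^ (2 : ℝ≥0∞).toReal).le)

@[simp] theorem translation_apply {d : ℕ} (v : Zd d) (u : L2 d) (n : Zd d) :
    translation v u n = u (n + v) := rfl

/-- A bounded real function on the lattice. -/
def IsBoundedFun {d : ℕ} (g : Zd d → ℝ) : Prop := ∃ C : ℝ, ∀ n, |g n| ≤ C

/-- The operator of multiplication by a bounded real function: `(M_g u)(n) = g(n) u(n)`. -/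
def mulOp {d : ℕ} (g : Zd d → ℝ) (hg : IsBoundedFun g) : L2 d →L[ℂ] L2 d :=
  LinearMap.mkContinuousOfExistsBound
    { toFun := fun u => ⟨fun n => (g n : ℂ) * u n, by
        obtain ⟨C, hC⟩ := hg
        refine ((lp.memℓp u).norm.const_mul C).mono fun n => ?_
        rw [norm_mul, Complex.norm_real, Real.norm_eq_abs]
        exact mul_le_mul_of_nonneg_right (hC n) (norm_nonneg _)⟩
      map_add' := fun u v => by ext n; exact mul_add (g n : ℂ) (u n) (v n)
      map_smul' := fun c u => by ext n; exact mul_left_comm (g n : ℂ) c (u n) }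
    (by
      obtain ⟨C, hC⟩ := hg
      have hC0 : 0 ≤ C := (abs_nonneg _).trans (hC 0)
      refine ⟨C, fun u => ?_⟩
      have hn : ‖(C : ℂ) • u‖ = C * ‖u‖ := by
        rw [norm_smul, Complex.norm_real, Real.norm_of_nonneg hC0]
      rw [← hn]
      refine lp.norm_mono (by norm_num) fun n => ?_
      change ‖(g n : ℂ) * u n‖ ≤ ‖(C : ℂ) * u n‖
      rw [norm_mul, norm_mul, Complex.norm_real, Complex.norm_real, Real.norm_eq_abs,
        Real.norm_of_nonneg hC0]
      exact mul_le_mul_of_nonneg_right (hC n) (norm_nonneg _))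

@[simp] theorem mulOp_apply {d : ℕ} (g : Zd d → ℝ) (hg : IsBoundedFun g) (u : L2 d)
    (n : Zd d) : mulOp g hg u n = (g n : ℂ) * u n := rfl

/-- The discrete Schrödinger operator `A = -Δ + f` on `ℓ²(ℤ^d)`. -/
def schrodinger {d : ℕ} (f : Zd d → ℝ) (hf : IsBoundedFun f) : L2 d →L[ℂ] L2 d :=
  -(∑ v ∈ unitVectors d, translation v) + (2 * d : ℂ) • ContinuousLinearMap.id ℂ (L2 d)
    + mulOp f hf

/-- The defining formula
`(A u)(n) = - ∑_{|m - n| = 1} u(m) + 2 d u(n) + f(n) u(n)`, with `m = n + v`, `|v| = 1`. -/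
theorem schrodinger_apply {d : ℕ} (f : Zd d → ℝ) (hf : IsBoundedFun f) (u : L2 d)
    (n : Zd d) :
    schrodinger f hf u n
      = -(∑ v ∈ unitVectors d, u (n + v)) + (2 * d : ℂ) * u n + (f n : ℂ) * u n := by
  have h : ((∑ v ∈ unitVectors d, translation v u : L2 d) : Zd d → ℂ) n
      = ∑ v ∈ unitVectors d, u (n + v) := by
    rw [lp.coeFn_sum, Finset.sum_apply]
    rfl
  rw [← h, ← sum_apply (unitVectors d)]
  rfl

/-- `(a, b)` is a bounded gap in the spectrum of `A`. -/
structure IsSpectralGap {d : ℕ} (A : L2 d →L[ℂ] L2 d) (a b : ℝ) : Prop where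
  lt : a < b
  left_mem : (a : ℂ) ∈ spectrum ℂ A
  right_mem : (b : ℂ) ∈ spectrum ℂ A
  disjoint : ∀ μ : ℝ, a < μ → μ < b → (μ : ℂ) ∉ spectrum ℂ A

open Classical in
/-- The operator `A_Ω` on `ℓ²(Ω ∩ ℤ^d)`, as a matrix, where `S = Ω ∩ ℤ^d` is finite:
`(A_Ω u)(n) = - ∑_{m ∈ S, |m - n| = 1} u(m) + 2 d u(n) + f(n) u(n)` for `n ∈ S`. -/
def restrictedMatrix {d : ℕ} (f : Zd d → ℝ) (S : Finset (Zd d)) : Matrix S S ℂ :=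
  Matrix.of fun n m =>
    (if ‖pt (m.1 - n.1)‖ = 1 then -1 else 0) + (if m = n then 2 * (d : ℂ) + (f n.1 : ℂ) else 0)

theorem restrictedMatrix_isHermitian {d : ℕ} (f : Zd d → ℝ) (S : Finset (Zd d)) :
    (restrictedMatrix f S).IsHermitian := by
  ext n m
  have h : ‖pt (n.1 - m.1)‖ = ‖pt (m.1 - n.1)‖ := by
    rw [← norm_neg]
    congr 1
    ext i
    simp [pt]
  rw [Matrix.conjTranspose_apply]
  simp only [restrictedMatrix, Matrix.of_apply, h]
  by_cases hnm : n = m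
  · subst hnm
    split_ifs <;> simp
  · rw [if_neg hnm, if_neg (Ne.symm hnm)]
    split_ifs <;> simp

open Classical in
/-- `N(A_Ω, E)`: the number of eigenvalues of `A_Ω`, counted with multiplicity, that are strictly
smaller than `E`. -/
def eigenvalueCount {d : ℕ} (f : Zd d → ℝ) (Ω : Set (EuclideanSpace ℝ (Fin d)))
    (hΩ : Bornology.IsBounded Ω) (E : ℝ) : ℕ :=
  (Finset.univ.filter fun i =>
    (restrictedMatrix_isHermitian f (latticePoints Ω hΩ)).eigenvalues i < E).card

open scoped Pointwise in
/-- `ρ` is the density of states of `-Δ + f`: for every bounded domain `Ω` (nonempty, open,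
connected) whose boundary is Lebesgue null and every real `E`,
`N(A_{βΩ}, E) / (β^d vol Ω) → ρ(E)` as `β → ∞`. -/
def HasDensityOfStates {d : ℕ} (f : Zd d → ℝ) (ρ : ℝ → ℝ) : Prop :=
  ∀ (Ω : Set (EuclideanSpace ℝ (Fin d))) (hΩ : Bornology.IsBounded Ω),
    IsOpen Ω → IsConnected Ω → volume (frontier Ω) = 0 → ∀ E : ℝ,
      Tendsto (fun β : ℝ => (eigenvalueCount f (β • Ω) (hΩ.smul₀ β) E : ℝ)
        / (β ^ d * (volume Ω).toReal)) atTop (𝓝 (ρ E))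

/-- `V(n) ~ Ψ(θ) |n|^{-p}` as `|n| → ∞`, where `θ = n / |n|`; that is, `|n|^p V(n) - Ψ(θ) → 0`.
(Infinity in the lattice is the cofinite filter, as balls contain finitely many points.) -/
def HasDecay {d : ℕ} (V : Zd d → ℝ) (Ψ : EuclideanSpace ℝ (Fin d) → ℝ) (p : ℝ) : Prop :=
  Tendsto (fun n : Zd d => ‖pt n‖ ^ p * V n - Ψ (‖pt n‖⁻¹ • pt n)) cofinite (𝓝 0)

theorem one_le_norm_pt {d : ℕ} {n : Zd d} (hn : n ≠ 0) : 1 ≤ ‖pt n‖ := by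
  obtain ⟨i, hi⟩ := Function.ne_iff.1 hn
  have h1 := PiLp.norm_apply_le (pt n) i
  simp only [pt, Real.norm_eq_abs] at h1
  refine le_trans ?_ h1
  exact_mod_cast Int.one_le_abs hi

/-- A decaying potential is bounded. -/
theorem HasDecay.isBoundedFun {d : ℕ} {V : Zd d → ℝ} {Ψ : EuclideanSpace ℝ (Fin d) → ℝ}
    {p : ℝ} (hV : HasDecay V Ψ p) (hp : 0 < p) (hΨ : ContinuousOn Ψ (Metric.sphere 0 1)) :
    IsBoundedFun V := by
  obtain ⟨C, hC⟩ := (isCompact_sphere (0 : EuclideanSpace ℝ (Fin d)) 1).exists_bound_of_continuousOn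
    hΨ
  have h1 : ∀ᶠ n in cofinite, |V n| ≤ |C| + 1 := by
    filter_upwards [hV (Metric.ball_mem_nhds 0 one_pos),
      (Set.finite_singleton (0 : Zd d)).compl_mem_cofinite] with n hn hn0
    have hr := one_le_norm_pt (n := n) hn0
    have hθ : ‖pt n‖⁻¹ • pt n ∈ Metric.sphere (0 : EuclideanSpace ℝ (Fin d)) 1 := by
      rw [mem_sphere_zero_iff_norm, norm_smul, norm_inv, norm_norm]
      exact inv_mul_cancel₀ (by positivity)
    have h2 := hC _ hθ
    rw [Set.mem_preimage, mem_ball_zero_iff] at hn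
    rw [Real.norm_eq_abs] at h2 hn
    have h3 : |‖pt n‖ ^ p * V n| ≤ |C| + 1 := by
      have h4 := abs_add_le (‖pt n‖ ^ p * V n - Ψ (‖pt n‖⁻¹ • pt n)) (Ψ (‖pt n‖⁻¹ • pt n))
      rw [sub_add_cancel] at h4
      linarith [le_abs_self C]
    rw [abs_mul, abs_of_nonneg (by positivity : (0 : ℝ) ≤ ‖pt n‖ ^ p)] at h3
    exact le_trans (le_mul_of_one_le_left (abs_nonneg _) (Real.one_le_rpow hr hp.le)) h3
  have hfin : {n | ¬ |V n| ≤ |C| + 1}.Finite := h1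
  have hsum : 0 ≤ ∑ n ∈ hfin.toFinset, |V n| := Finset.sum_nonneg fun _ _ => abs_nonneg _
  refine ⟨|C| + 1 + ∑ n ∈ hfin.toFinset, |V n|, fun n => ?_⟩
  by_cases hn : |V n| ≤ |C| + 1
  · linarith
  · have hmem : n ∈ hfin.toFinset := by simpa using hn
    have h5 := Finset.single_le_sum (f := fun n => |V n|) (fun _ _ => abs_nonneg _) hmem
    linarith [abs_nonneg C]

/-- The number of eigenvalues of `A(t) = A - t V`, counted with multiplicity, that pass through
the point `E` as `t` increases from `0` to `α`. An eigenvalue passes through `E` at the coupling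
constant `t` when `E` is an eigenvalue of `A(t)`, and the number of those that do so at `t` is the
multiplicity of `E` as an eigenvalue of `A(t)`; the count is the sum of these multiplicities over
`0 < t < α`. (For `V ≥ 0` and `E` outside the spectrum of `A`, the eigenvalues near `E` only move
to the left, and none of them stays at `E`, so each contributes exactly one passage.) -/
def crossingNumber {d : ℕ} (A V : L2 d →L[ℂ] L2 d) (E α : ℝ) : ℝ≥0∞ :=
  ∑' t : Set.Ioo (0 : ℝ) α,
    ((Cardinal.toENat (Module.rank ℂ
      (Module.End.eigenspace ((A - ((t : ℝ) : ℂ) • V : L2 d →L[ℂ] L2 d) : Module.End ℂ (L2 d))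
        (E : ℂ))) : ℕ∞) : ℝ≥0∞)

/-- The integrand `ρ(E + Ψ(θ) |x|^{-p}) - ρ(E)`, where `θ = x / |x|`. -/
def dosIncrement {d : ℕ} (ρ : ℝ → ℝ) (Ψ : EuclideanSpace ℝ (Fin d) → ℝ) (p E : ℝ)
    (x : EuclideanSpace ℝ (Fin d)) : ℝ :=
  ρ (E + Ψ (‖x‖⁻¹ • x) * ‖x‖ ^ (-p)) - ρ E

end

/-! Write B = A - E, let R be its bounded inverse (E lies in a gap), r = √V and s = √α r. By the
Birman–Schwinger principle E is an eigenvalue of A - tV exactly when 1/t is an eigenvalue of the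
compact symmetric operator r R r, with the same multiplicity. So the crossing number is the number
of eigenvalues of r R r above 1/α, that is, the negative index of q(w) = ‖w‖² - ⟨R s w, s w⟩
(`bsForm`).

The heart is an inertia argument for the block form ⟨B u, u⟩ + 2 Re⟨s w, u⟩ + ‖w‖² on pairs (u, w).
Completing the square in w leaves the form of B - s², that is of A - αV - E, plus a positive square;
completing it in u leaves the form of B plus q. In finite dimensions this would give: negative index
of q = (eigenvalues of A - αV below E) - (eigenvalues of A below E). On ℓ² these counts may be
infinite, so u is restricted to functions supported on a finite set S. The inverse R does not
preserve them, but B maps functions supported on S₀ into functions supported on S when S contains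
all neighbours of S₀, so the identity survives with error at most 2(|S| - |S₀|). Off S it is enough
that αV ≤ c with c‖R‖ ≤ 1, since then q is nonnegative there. This is
`IsResolventAt.exists_crossingNumber_eq`. Spurious eigenvalues of finite sections inside the gap
need no separate treatment: they are absorbed in the boundary error. The same inequality with s² = τ
a small constant shows that ρ is constant near E (`HasDensityOfStates.eq_of_abs_sub_le`).

For the asymptotics put α = β^p. Then β^p V(n) is close to Ψ(θ)|x|^{-p} at x = n/β, uniformly away
from the origin. The dilated cube β(-N, N)^d is cut into cubes on which this profile is almost
constant; there the count is about β^d times the volume times ρ(E + profile), and the cut costs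
o(β^d) sites. Bounds on the Riemann sums converge to the integral because the monotone ρ has
countably many jumps and the nonzero level sets of the homogeneous profile are null
(`tendsto_sectionCount_perturbed`). A single fixed N suffices: outside the cube the profile is so
small that the integrand vanishes by constancy of ρ near E, and q is nonnegative. -/

noncomputable section

/-! ### Linear algebra: dimension inequalities for subspaces. -/

section DimensionCounts

variable {H H' : Type*} [AddCommGroup H] [Module ℂ H] [AddCommGroup H'] [Module ℂ H']

/-- The codimension of a preimage is at most the codimension of the subspace. -/
theorem finrank_add_finrank_le_comap (φ : H →ₗ[ℂ] H') (Y : Submodule ℂ H) (X Z : Submodule ℂ H')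
    [FiniteDimensional ℂ Y] [FiniteDimensional ℂ X] (hY : ∀ y ∈ Y, φ y ∈ X) (hZ : Z ≤ X) :
    Module.finrank ℂ Y + Module.finrank ℂ Z
      ≤ Module.finrank ℂ (Y ⊓ Z.comap φ : Submodule ℂ H) + Module.finrank ℂ X := by
  let ψ : Y →ₗ[ℂ] X := φ.restrict hY
  let Z' : Submodule ℂ X := Z.comap X.subtype
  let χ : Y →ₗ[ℂ] (X ⧸ Z') := Z'.mkQ ∘ₗ ψ
  have h1 := χ.finrank_range_add_finrank_ker
  have h2 : Module.finrank ℂ (LinearMap.range χ) ≤ Module.finrank ℂ (X ⧸ Z') :=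
    Submodule.finrank_le _
  have h3 := Z'.finrank_quotient_add_finrank
  have h4 : Module.finrank ℂ Z' = Module.finrank ℂ Z :=
    (Submodule.comapSubtypeEquivOfLe hZ).finrank_eq
  have h5 : Module.finrank ℂ (LinearMap.ker χ)
      = Module.finrank ℂ (Y ⊓ Z.comap φ : Submodule ℂ H) := by
    have hk : LinearMap.ker χ = (Y ⊓ Z.comap φ).comap Y.subtype := by
      ext y
      simp [χ, ψ, Z']
    rw [hk]
    exact (Submodule.comapSubtypeEquivOfLe inf_le_left).finrank_eq
  omega

theorem finrank_add_finrank_le_of_inf_le_bot {X L P : Submodule ℂ H} [FiniteDimensional ℂ X]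
    (hL : L ≤ X) (hP : P ≤ X) (h : ∀ u ∈ L, u ∈ P → u = 0) :
    Module.finrank ℂ L + Module.finrank ℂ P ≤ Module.finrank ℂ X := by
  have := Submodule.finiteDimensional_of_le hL
  have := Submodule.finiteDimensional_of_le hP
  have h1 := Submodule.finrank_sup_add_finrank_inf_eq L P
  have h2 : L ⊓ P = ⊥ := by
    rw [eq_bot_iff]
    exact fun u hu => (Submodule.mem_bot ℂ).2 (h u hu.1 hu.2)
  rw [h2, finrank_bot, add_zero] at h1
  rw [← h1]
  exact Submodule.finrank_mono (sup_le hL hP)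

end DimensionCounts

/-! ### The block form and its inertia, with boundary errors. -/

section Hilbert

variable {H : Type*} [NormedAddCommGroup H] [InnerProductSpace ℂ H]

/-- Orthogonality to `L` is the vanishing of the projection onto `L`, hence at most `finrank L`
linear conditions on `Y`. -/
theorem finrank_le_inf_orthogonal (Y L : Submodule ℂ H) [FiniteDimensional ℂ Y]
    [FiniteDimensional ℂ L] :
    Module.finrank ℂ Y ≤ Module.finrank ℂ (Y ⊓ Lᗮ : Submodule ℂ H) + Module.finrank ℂ L := by
  have h := finrank_add_finrank_le_comap (L.starProjection : H →L[ℂ] H).toLinearMap Y L ⊥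
    (fun y _ => L.starProjection_apply_mem y) bot_le
  have hk : (⊥ : Submodule ℂ H).comap (L.starProjection : H →L[ℂ] H).toLinearMap = Lᗮ := by
    ext x
    simp
  rw [hk, finrank_bot, add_zero] at h
  exact h

/-- Completing the square in the form of a symmetric operator. -/
theorem re_inner_sub_add_two_mul (B : H →L[ℂ] H) (hB : B.toLinearMap.IsSymmetric) (y v z : H)
    (hz : B v = z) :
    (inner ℂ (B (y - v)) (y - v)).re + 2 * (inner ℂ z (y - v)).re
      = (inner ℂ (B y) y).re - (inner ℂ v z).re := by
  have h1 : inner ℂ (B y) v = inner ℂ y (B v) := hB y v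
  have h2 : (inner ℂ y z).re = (inner ℂ z y).re := inner_re_symm (𝕜 := ℂ) y z
  have h3 : (inner ℂ v z).re = (inner ℂ z v).re := inner_re_symm (𝕜 := ℂ) v z
  rw [map_sub, inner_sub_left, inner_sub_right, inner_sub_right, inner_sub_right, h1, hz]
  simp only [Complex.sub_re]
  linarith

/-- The form `‖w‖² - ⟨R s w, s w⟩`. -/
def bsForm (R s : H →L[ℂ] H) (w : H) : ℝ := ‖w‖ ^ 2 - (inner ℂ (R (s w)) (s w)).re

/-- The square completed in `w`: the two sides differ by `‖w + s u‖ ^ 2`. The right side is the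
block form at `(u, w)`. -/
theorem re_inner_sub_norm_le (B s : H →L[ℂ] H) (hs : s.toLinearMap.IsSymmetric) (u w : H) :
    (inner ℂ (B u) u).re - ‖s u‖ ^ 2
      ≤ (inner ℂ (B u) u).re + 2 * (inner ℂ (s w) u).re + ‖w‖ ^ 2 := by
  have h1 : inner ℂ (s w) u = inner ℂ w (s u) := hs w u
  have h2 := norm_add_sq (𝕜 := ℂ) w (s u)
  simp only [RCLike.re_to_complex] at h2
  rw [h1]
  nlinarith [sq_nonneg ‖w + s u‖]

variable {B R s : H →L[ℂ] H} {X W : Submodule ℂ H}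

/-- Upper bound for the negative index of `bsForm R s`, by comparison with the finite section on
`X` of a symmetric operator `B` with inverse `R`. -/
theorem finrank_add_finrank_le_of_negative [FiniteDimensional ℂ X]
    (hB : B.toLinearMap.IsSymmetric) (hs : s.toLinearMap.IsSymmetric)
    (hRB : ∀ u, R (B u) = u) (hBR : ∀ u, B (R u) = u)
    (hW : W ≤ X) (hBW : ∀ u ∈ W, B u ∈ X) (hsX : ∀ u ∈ X, s u ∈ X)
    (hq : ∀ w ∈ Xᗮ, 0 ≤ bsForm R s w)
    {L LK : Submodule ℂ H} [FiniteDimensional ℂ LK] (hL : L ≤ X)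
    (hLneg : ∀ u ∈ L, u ≠ 0 → (inner ℂ (B u) u).re < 0)
    (hLK : ∀ w ∈ LK, w ≠ 0 → bsForm R s w < 0) {k : ℕ}
    (hk : ∀ M : Submodule ℂ H, M ≤ X →
      (∀ u ∈ M, u ≠ 0 → (inner ℂ (B u) u).re - ‖s u‖ ^ 2 < 0) → Module.finrank ℂ M ≤ k) :
    Module.finrank ℂ L + Module.finrank ℂ LK + 2 * Module.finrank ℂ W
      ≤ k + 2 * Module.finrank ℂ X := by
  have hfL := Submodule.finiteDimensional_of_le hL
  have hfW := Submodule.finiteDimensional_of_le hW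
  let P : H →L[ℂ] H := X.starProjection
  let BW : Submodule ℂ H := W.map B.toLinearMap
  have hBWX : BW ≤ X := by
    rintro _ ⟨u, hu, rfl⟩
    exact hBW u hu
  have hBinj : Function.Injective B.toLinearMap := fun u v h => by
    rw [← hRB u, ← hRB v]
    exact congrArg R h
  have hfBW : Module.finrank ℂ BW = Module.finrank ℂ W :=
    (Submodule.equivMapOfInjective _ hBinj W).finrank_eq.symm
  have hBWR : ∀ z ∈ BW, R z ∈ W := by
    rintro _ ⟨u, hu, rfl⟩
    exact (hRB u).symm ▸ hu
  let L' : Submodule ℂ H := L ⊓ W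
  have h1 : Module.finrank ℂ L + Module.finrank ℂ W
      ≤ Module.finrank ℂ L' + Module.finrank ℂ X := by
    exact finrank_add_finrank_le_comap LinearMap.id L X W (fun y hy => hL hy) hW
  let Y : Submodule ℂ H := LK ⊓ BW.comap (s ∘L P).toLinearMap
  have h2 : Module.finrank ℂ LK + Module.finrank ℂ W
      ≤ Module.finrank ℂ Y + Module.finrank ℂ X := by
    rw [← hfBW]
    exact finrank_add_finrank_le_comap _ LK X BW
      (fun y _ => hsX _ (X.starProjection_apply_mem y)) hBWX
  -- `R (s w1)` lies in `X` while `s w2` is orthogonal to `X`, so the form splits along `w = w1 +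
  -- w2`, and the `w2` part is nonnegative by `hq`.
  have hYneg : ∀ w ∈ Y, bsForm R s (P w) ≤ bsForm R s w := by
    intro w hw
    have hPX : P w ∈ X := X.starProjection_apply_mem w
    have hz : w - P w ∈ Xᗮ := X.sub_starProjection_mem_orthogonal w
    set w1 := P w with hw1
    set w2 := w - w1 with hw2
    have hww : w = w1 + w2 := by simp [hw2]
    have hu0 : R (s w1) ∈ X := hW (hBWR _ hw.2)
    have hsw2 : ∀ u ∈ X, inner ℂ u (s w2) = 0 := fun u hu => by
      rw [← show inner ℂ (s u) w2 = inner ℂ u (s w2) from hs u w2]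
      exact (Submodule.mem_orthogonal _ _).1 hz _ (hsX u hu)
    have hRs : inner ℂ (R (s w2)) (s w1) = 0 := by
      have : inner ℂ (B (R (s w2))) (R (s w1)) = inner ℂ (R (s w2)) (B (R (s w1))) :=
        hB (R (s w2)) (R (s w1))
      rw [hBR, hBR] at this
      rw [← this, ← inner_conj_symm, hsw2 _ hu0, map_zero]
    have h0 := hq w2 hz
    have hn : ‖w1 + w2‖ ^ 2 = ‖w1‖ ^ 2 + ‖w2‖ ^ 2 := by
      have := norm_add_sq (𝕜 := ℂ) w1 w2
      rw [(Submodule.mem_orthogonal _ _).1 hz _ hPX] at this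
      simpa using this
    rw [hww]
    unfold bsForm at h0 ⊢
    rw [hn, map_add, map_add, inner_add_left, inner_add_right, inner_add_right, hRs,
      hsw2 _ hu0]
    simp only [Complex.add_re, Complex.zero_re]
    linarith
  -- The substitution `u = y - R s P w` from completing the square in `u`. It turns the block form
  -- into the form of `B` at `y` plus `bsForm` at `P w`, both controlled by the negativity of `L`
  -- and `LK`.
  let Φ : (L' × Y) →ₗ[ℂ] H :=
    (L'.subtype).coprod (-((R ∘L s ∘L P).toLinearMap ∘ₗ Y.subtype))
  have hΦ : ∀ x, Φ x = (x.1 : H) - R (s (P x.2)) := fun x => by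
    simp [Φ, sub_eq_add_neg]
  have hneg : ∀ x : L' × Y, x ≠ 0 → (inner ℂ (B (Φ x)) (Φ x)).re - ‖s (Φ x)‖ ^ 2 < 0 := by
    rintro ⟨⟨y, hy⟩, ⟨w, hw⟩⟩ hx
    rw [hΦ]
    simp only
    refine (re_inner_sub_norm_le B s hs _ (P w)).trans_lt ?_
    rw [re_inner_sub_add_two_mul B hB y _ (s (P w)) (hBR _)]
    have h3 := hYneg w hw
    unfold bsForm at h3
    by_cases hy0 : y = 0
    · subst hy0
      have hw0 : w ≠ 0 := by
        rintro rfl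
        exact hx rfl
      have := hLK w hw.1 hw0
      unfold bsForm at this
      simp only [map_zero, inner_zero_left, Complex.zero_re]
      linarith
    · have h4 := hLneg y hy.1 hy0
      have h5 : bsForm R s w ≤ 0 := by
        by_cases hw0 : w = 0
        · simp [bsForm, hw0]
        · exact (hLK w hw.1 hw0).le
      unfold bsForm at h5
      linarith
  have hinj : Function.Injective Φ := by
    rw [injective_iff_map_eq_zero]
    intro x hx
    by_contra hx0
    have := hneg x hx0
    rw [hx] at this
    simp at this
  have hfin := LinearMap.finrank_range_of_inj hinj
  rw [Module.finrank_prod] at hfin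
  have h6 := hk (LinearMap.range Φ) (by
      rintro _ ⟨x, rfl⟩
      rw [hΦ]
      exact X.sub_mem (hL x.1.2.1) (hW (hBWR _ x.2.2.2)))
    (by
      rintro _ ⟨x, rfl⟩ hx
      exact hneg x fun h => hx (by rw [h, map_zero]))
  omega

/-- Lower bound for the negative index of `bsForm R s`, by comparison with the finite section on
`X` of a symmetric operator `B` with inverse `R`. -/
theorem finrank_add_finrank_le_of_nonneg [FiniteDimensional ℂ X]
    (hB : B.toLinearMap.IsSymmetric) (hs : s.toLinearMap.IsSymmetric)
    (hRB : ∀ u, R (B u) = u) (hBR : ∀ u, B (R u) = u)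
    (hW : W ≤ X) (hBW : ∀ u ∈ W, B u ∈ X) (hsX : ∀ u ∈ X, s u ∈ X)
    {L P LK : Submodule ℂ H} [FiniteDimensional ℂ LK] (hL : L ≤ X) (hP : P ≤ X)
    (hLneg : ∀ u ∈ L, u ≠ 0 → (inner ℂ (B u) u).re - ‖s u‖ ^ 2 < 0)
    (hPnonneg : ∀ u ∈ P, 0 ≤ (inner ℂ (B u) u).re)
    (hLK : ∀ w ∈ LKᗮ, 0 ≤ bsForm R s w) :
    Module.finrank ℂ L + Module.finrank ℂ P + 2 * Module.finrank ℂ W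
      ≤ Module.finrank ℂ LK + 3 * Module.finrank ℂ X := by
  have hfL := Submodule.finiteDimensional_of_le hL
  have hfP := Submodule.finiteDimensional_of_le hP
  have hfW := Submodule.finiteDimensional_of_le hW
  let BW : Submodule ℂ H := W.map B.toLinearMap
  have hBWX : BW ≤ X := by
    rintro _ ⟨u, hu, rfl⟩
    exact hBW u hu
  have hBinj : Function.Injective B.toLinearMap := fun u v h => by
    rw [← hRB u, ← hRB v]
    exact congrArg R h
  have hfBW : Module.finrank ℂ BW = Module.finrank ℂ W :=
    (Submodule.equivMapOfInjective _ hBinj W).finrank_eq.symm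
  have hBWR : ∀ z ∈ BW, R z ∈ W := by
    rintro _ ⟨u, hu, rfl⟩
    exact (hRB u).symm ▸ hu
  let P' : Submodule ℂ H := P ⊓ W
  have h1 : Module.finrank ℂ P + Module.finrank ℂ W
      ≤ Module.finrank ℂ P' + Module.finrank ℂ X := by
    exact finrank_add_finrank_le_comap LinearMap.id P X W (fun y hy => hP hy) hW
  have h2 := finrank_le_inf_orthogonal X LK
  let Y : Submodule ℂ H := (X ⊓ LKᗮ) ⊓ BW.comap s.toLinearMap
  have hfX' : FiniteDimensional ℂ (X ⊓ LKᗮ : Submodule ℂ H) :=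
    Submodule.finiteDimensional_of_le inf_le_left
  have h3 : Module.finrank ℂ (X ⊓ LKᗮ : Submodule ℂ H) + Module.finrank ℂ W
      ≤ Module.finrank ℂ Y + Module.finrank ℂ X := by
    rw [← hfBW]
    exact finrank_add_finrank_le_comap _ _ X BW (fun y hy => hsX _ hy.1) hBWX
  have hfY : FiniteDimensional ℂ Y := Submodule.finiteDimensional_of_le inf_le_left
  -- In the space `X × X` of pairs, `L` enters as the graph `(u, -s u)`, where the block form is
  -- negative, and `P' × Y` as `(y - R s w, w)`, where it is nonnegative. Hence the images meet
  -- trivially and their dimensions add up to at most `2 * finrank X`.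
  let Θ : (L × (P' × Y)) →ₗ[ℂ] H × H :=
    ((L.subtype).coprod ((P'.subtype).coprod (-((R ∘L s).toLinearMap ∘ₗ Y.subtype)))).prod
      ((-(s.toLinearMap ∘ₗ L.subtype)).coprod ((0 : P' →ₗ[ℂ] H).coprod Y.subtype))
  have hΘ : ∀ x, Θ x = ((x.1 : H) + ((x.2.1 : H) - R (s x.2.2)), -s x.1 + x.2.2) := fun x => by
    simp [Θ, sub_eq_add_neg]
  have hmem : ∀ x, Θ x ∈ X.prod X := fun x => by
    rw [hΘ]
    exact ⟨X.add_mem (hL x.1.2) (X.sub_mem (hP x.2.1.2.1) (hW (hBWR _ x.2.2.2.2))),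
      X.add_mem (X.neg_mem (hsX _ (hL x.1.2))) x.2.2.2.1.1⟩
  have hinj : Function.Injective Θ := by
    rw [injective_iff_map_eq_zero]
    rintro ⟨⟨u, hu⟩, ⟨y, hy⟩, ⟨w, hw⟩⟩ hx
    rw [hΘ, Prod.mk_eq_zero] at hx
    obtain ⟨hx1, hx2⟩ := hx
    simp only at hx1 hx2
    have hwu : w = s u := by
      rw [neg_add_eq_zero] at hx2
      exact hx2.symm
    have huy : y - R (s w) = -u := (neg_eq_of_add_eq_zero_right hx1).symm
    have h4 := re_inner_sub_add_two_mul B hB y _ (s w) (hBR _)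
    rw [huy] at h4
    have h5 := hPnonneg y hy.1
    have h6 := hLK w hw.1.2
    unfold bsForm at h6
    have h7 : inner ℂ (s w) u = inner ℂ w (s u) := hs w u
    have h8 : (inner ℂ (s u) (s u)).re = ‖s u‖ ^ 2 := inner_self_eq_norm_sq (𝕜 := ℂ) (s u)
    have h9 : (inner ℂ (s w) (-u)).re = -‖s u‖ ^ 2 := by
      rw [inner_neg_right, h7, hwu, Complex.neg_re, h8]
    have h10 : (inner ℂ (B (-u)) (-u)).re = (inner ℂ (B u) u).re := by
      rw [map_neg, inner_neg_neg]
    rw [h9, h10] at h4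
    have h11 : ‖w‖ ^ 2 = ‖s u‖ ^ 2 := by rw [hwu]
    have hu0 : u = 0 := by
      by_contra hu0
      have := hLneg u hu hu0
      linarith
    subst hu0
    have hw0 : w = 0 := by rw [hwu, map_zero]
    subst hw0
    have hy0 : y = 0 := by simpa using huy
    subst hy0
    rfl
  have h12 : Module.finrank ℂ (L × (P' × Y)) ≤ Module.finrank ℂ (X × X) := by
    let Θ' : (L × (P' × Y)) →ₗ[ℂ] X × X :=
      ((LinearMap.fst ℂ H H ∘ₗ Θ).codRestrict X fun x => (hmem x).1).prod
        ((LinearMap.snd ℂ H H ∘ₗ Θ).codRestrict X fun x => (hmem x).2)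
    have hinj' : Function.Injective Θ' := fun a b h => hinj (Prod.ext
      (congrArg (fun z : X × X => (z.1 : H)) h) (congrArg (fun z : X × X => (z.2 : H)) h))
    exact LinearMap.finrank_le_finrank_of_injective hinj'
  simp only [Module.finrank_prod] at h12
  omega

end Hilbert

/-! ### Infinite sums of dimensions of independent subspaces. -/

section IndependentSubspaces

variable {H : Type*} [AddCommGroup H] [Module ℂ H]

theorem finrank_finsetSup_eq_sum {ι : Type*} {p : ι → Submodule ℂ H} (hp : iSupIndep p)
    (hfin : ∀ i, FiniteDimensional ℂ (p i)) (F : Finset ι) :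
    Module.finrank ℂ (F.sup p : Submodule ℂ H) = ∑ i ∈ F, Module.finrank ℂ (p i) := by
  classical
  induction F using Finset.induction_on with
  | empty => simp
  | insert a F ha ih =>
    have hFfin : FiniteDimensional ℂ (F.sup p : Submodule ℂ H) :=
      Submodule.finiteDimensional_finset_sup F p
    have h1 := Submodule.finrank_sup_add_finrank_inf_eq (p a) (F.sup p)
    have h2 : Disjoint (p a) (F.sup p) :=
      (hp.supIndep' (insert a F)) (Finset.subset_insert a F)
        (Finset.mem_insert_self a F) ha
    rw [h2.eq_bot, finrank_bot, add_zero, ih] at h1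
    rw [Finset.sup_insert, Finset.sum_insert ha, h1]

theorem tsum_finrank_eq_finrank_iSup {ι : Type*} {p : ι → Submodule ℂ H} (hp : iSupIndep p)
    [FiniteDimensional ℂ (⨆ i, p i : Submodule ℂ H)] :
    ∑' i, (Module.finrank ℂ (p i) : ℝ≥0∞) = (Module.finrank ℂ (⨆ i, p i : Submodule ℂ H) : ℕ) := by
  have hfin : ∀ i, FiniteDimensional ℂ (p i) := fun i =>
    Submodule.finiteDimensional_of_le (le_iSup p i)
  have hle : ∀ F : Finset ι, F.sup p ≤ ⨆ i, p i := fun F => Finset.sup_le fun i _ => le_iSup p i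
  refine le_antisymm ?_ ?_
  · rw [ENNReal.tsum_eq_iSup_sum]
    refine iSup_le fun F => ?_
    rw [← Nat.cast_sum, ← finrank_finsetSup_eq_sum hp hfin F]
    exact_mod_cast Submodule.finrank_mono (hle F)
  -- A finite-dimensional subspace is a compact element of the lattice, so finitely many summands
  -- already fill the supremum.
  · have hfg : (⨆ i, p i : Submodule ℂ H).FG := (Submodule.fg_iff_finiteDimensional _).2 ‹_›
    obtain ⟨F, hF⟩ := CompleteLattice.IsCompactElement.exists_finset_of_le_iSup _
      ((Submodule.fg_iff_compact _).1 hfg) p le_rfl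
    rw [← Finset.sup_eq_iSup] at hF
    rw [le_antisymm hF (hle F), finrank_finsetSup_eq_sum hp hfin F, Nat.cast_sum]
    exact ENNReal.sum_le_tsum F

end IndependentSubspaces

/-! ### Spectral subspaces of a compact symmetric operator. -/

section SpectralSubspaces

variable {H : Type*} [NormedAddCommGroup H] [InnerProductSpace ℂ H]

/-- The form of a symmetric operator on a sum of eigenspaces is diagonal. -/
theorem exists_sum_of_mem_iSup_eigenspace {T : H →ₗ[ℂ] H} (hT : T.IsSymmetric) {ι : Type*}
    {μ : ι → ℂ} (hμ : Function.Injective μ) {u : H}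
    (hu : u ∈ ⨆ i, Module.End.eigenspace T (μ i)) :
    ∃ (F : Finset ι) (g : ι → ℝ), (∀ i, 0 ≤ g i) ∧ ‖u‖ ^ 2 = ∑ i ∈ F, g i ∧
      (inner ℂ (T u) u).re = ∑ i ∈ F, (μ i).re * g i := by
  rw [Submodule.mem_iSup_iff_exists_finsupp] at hu
  obtain ⟨φ, hφ, rfl⟩ := hu
  have hO := (hT.orthogonalFamily_eigenspaces).comp hμ
  let l : ∀ i, Module.End.eigenspace T (μ i) := fun i => ⟨φ i, hφ i⟩
  refine ⟨φ.support, fun i => ‖φ i‖ ^ 2, fun i => by positivity, ?_, ?_⟩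
  · exact hO.norm_sum l φ.support
  · have h1 : T (φ.sum fun _ x => x) = ∑ i ∈ φ.support, μ i • φ i := by
      rw [Finsupp.sum, map_sum]
      exact Finset.sum_congr rfl fun i _ => Module.End.mem_eigenspace_iff.1 (hφ i)
    have h2 := hO.inner_sum (fun i => μ i • l i) l φ.support
    rw [h1]
    have h3 : inner ℂ (∑ i ∈ φ.support, μ i • φ i) (φ.sum fun _ x => x)
        = ∑ i ∈ φ.support, inner ℂ (μ i • φ i) (φ i) := h2
    rw [h3, Complex.re_sum]
    refine Finset.sum_congr rfl fun i _ => ?_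
    rw [inner_smul_left, inner_self_eq_norm_sq_to_K]
    have h4 : (RCLike.ofReal ‖φ i‖ : ℂ) ^ 2 = ((‖φ i‖ ^ 2 : ℝ) : ℂ) := by
      rw [Complex.ofReal_pow]
      rfl
    rw [h4, Complex.re_mul_ofReal, Complex.conj_re]

/-- The sum of the eigenspaces of `T` for the eigenvalues above `1 / α`. -/
def upperSpectralSubspace (T : H →L[ℂ] H) (α : ℝ) : Submodule ℂ H :=
  ⨆ t : Set.Ioo (0 : ℝ) α, Module.End.eigenspace T.toLinearMap (((t : ℝ)⁻¹ : ℝ) : ℂ)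

theorem inv_ofReal_injective (α : ℝ) :
    Function.Injective fun t : Set.Ioo (0 : ℝ) α => (((t : ℝ)⁻¹ : ℝ) : ℂ) := fun t t' h => by
  simp only [Complex.ofReal_inj, inv_inj] at h
  exact Subtype.ext h

/-- On an eigenvector for `1 / t` with `t < α` the form is `1 - α / t = -(α - t) / t` times the
squared norm, and distinct eigenspaces do not interact. -/
theorem upperSpectralSubspace_form_neg {T : H →L[ℂ] H} (hT : T.toLinearMap.IsSymmetric) {α : ℝ}
    {u : H} (hu : u ∈ upperSpectralSubspace T α) (hu0 : u ≠ 0) :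
    ‖u‖ ^ 2 - α * (inner ℂ (T u) u).re < 0 := by
  obtain ⟨F, g, hg, hn, hin⟩ :=
    exists_sum_of_mem_iSup_eigenspace hT (inv_ofReal_injective α) hu
  have hpos : 0 < ∑ i ∈ F, g i := hn ▸ (by positivity)
  obtain ⟨i, hi, hgi⟩ := Finset.exists_ne_zero_of_sum_ne_zero hpos.ne'
  have hin' : (inner ℂ (T u) u).re = ∑ i ∈ F, (i : ℝ)⁻¹ * g i := hin
  rw [hn, hin', Finset.mul_sum, ← Finset.sum_sub_distrib]
  have key : ∀ j : Set.Ioo (0 : ℝ) α, g j - α * ((j : ℝ)⁻¹ * g j) = -((α - j) / j * g j) := by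
    intro j
    have hj : (j : ℝ) ≠ 0 := j.2.1.ne'
    field_simp
    ring
  refine Finset.sum_neg' (fun j _ => ?_) ⟨i, hi, ?_⟩
  · rw [key, neg_nonpos]
    exact mul_nonneg (div_nonneg (by linarith [j.2.2]) j.2.1.le) (hg j)
  · rw [key, neg_lt_zero]
    exact mul_pos (div_pos (by linarith [i.2.2]) i.2.1) (lt_of_le_of_ne (hg i) (Ne.symm hgi))

/-- By the spectral theorem the eigenvectors span a dense subspace. The projection onto the
complement of `LK` fixes those with eigenvalue at most `1 / α` and kills the others, so the
projected form is nonnegative on a dense set, and continuity extends this to the whole space. -/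
theorem upperSpectralSubspace_orthogonal_form_nonneg [CompleteSpace H] {T : H →L[ℂ] H}
    (hT : T.toLinearMap.IsSymmetric) (hc : IsCompactOperator T) {α : ℝ} (hα : 0 < α)
    [FiniteDimensional ℂ (upperSpectralSubspace T α)]
    {u : H} (hu : u ∈ (upperSpectralSubspace T α)ᗮ) :
    0 ≤ ‖u‖ ^ 2 - α * (inner ℂ (T u) u).re := by
  set LK := upperSpectralSubspace T α with hLK
  let I := {μ : ℂ // μ.re ≤ α⁻¹}
  let Lo : Submodule ℂ H := ⨆ μ : I, Module.End.eigenspace T.toLinearMap μ.1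
  have hLo : ∀ v ∈ Lo, 0 ≤ ‖v‖ ^ 2 - α * (inner ℂ (T v) v).re := by
    intro v hv
    obtain ⟨F, g, hg, hn, hin⟩ :=
      exists_sum_of_mem_iSup_eigenspace hT (μ := fun μ : I => μ.1) Subtype.val_injective hv
    have hin' : (inner ℂ (T v) v).re = ∑ i ∈ F, i.1.re * g i := hin
    rw [hn, hin', Finset.mul_sum, ← Finset.sum_sub_distrib]
    refine Finset.sum_nonneg fun i _ => ?_
    have h1 : α * i.1.re ≤ 1 := by
      have := mul_le_mul_of_nonneg_left i.2 hα.le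
      rwa [mul_inv_cancel₀ hα.ne'] at this
    nlinarith [hg i]
  let P : H →L[ℂ] H := LKᗮ.starProjection
  have hPfix : ∀ v ∈ LKᗮ, P v = v := fun v hv => Submodule.starProjection_eq_self_iff.2 hv
  have hcases : ∀ μ : ℂ, Module.End.eigenspace T.toLinearMap μ ≤ Lo.comap P.toLinearMap := by
    intro μ v hv
    by_cases hv0 : v = 0
    · subst hv0
      exact Submodule.zero_mem _
    have hev : Module.End.HasEigenvalue T.toLinearMap μ :=
      Module.End.hasEigenvalue_of_hasEigenvector ⟨hv, hv0⟩
    have hreal : (μ.re : ℂ) = μ := Complex.conj_eq_iff_re.1 (hT.conj_eigenvalue_eq_self hev)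
    by_cases hμ : μ.re ≤ α⁻¹
    · have hvLo : v ∈ Lo := (le_iSup (fun μ : I => Module.End.eigenspace T.toLinearMap μ.1)
        ⟨μ, hμ⟩) hv
      have horth : v ∈ LKᗮ := by
        have hle : LK ≤ (ℂ ∙ v)ᗮ := by
          refine iSup_le fun t w hw => ?_
          rw [Submodule.mem_orthogonal_singleton_iff_inner_right]
          have hne : μ ≠ (((t : ℝ)⁻¹ : ℝ) : ℂ) := by
            intro h
            rw [h, Complex.ofReal_re] at hμ
            exact absurd (inv_strictAnti₀ t.2.1 t.2.2) (not_lt.2 hμ)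
          have := hT.orthogonalFamily_eigenspaces hne ⟨v, hv⟩ ⟨w, hw⟩
          exact this
        rw [Submodule.mem_orthogonal]
        intro w hw
        have := (Submodule.mem_orthogonal_singleton_iff_inner_left).1 (hle hw)
        exact this
      change P v ∈ Lo
      rwa [hPfix v horth]
    · push Not at hμ
      have hμ0 : 0 < μ.re := (inv_pos.2 hα).trans hμ
      have hvK : v ∈ LK := by
        refine (le_iSup (fun t : Set.Ioo (0 : ℝ) α =>
          Module.End.eigenspace T.toLinearMap (((t : ℝ)⁻¹ : ℝ) : ℂ))
          ⟨μ.re⁻¹, inv_pos.2 hμ0, inv_lt_of_inv_lt₀ hα hμ⟩) ?_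
        simp only [inv_inv]
        rwa [hreal]
      have : P v = 0 := by
        rw [Submodule.starProjection_apply_eq_zero_iff]
        exact Submodule.le_orthogonal_orthogonal _ hvK
      change P v ∈ Lo
      rw [this]
      exact Lo.zero_mem
  have hdense : Dense ((⨆ μ, Module.End.eigenspace T.toLinearMap μ : Submodule ℂ H) : Set H) := by
    rw [Submodule.dense_iff_topologicalClosure_eq_top, Submodule.topologicalClosure_eq_top_iff]
    exact ContinuousLinearMap.orthogonalComplement_iSup_eigenspaces_eq_bot hc hT
  have hclosed : IsClosed {v : H | 0 ≤ ‖P v‖ ^ 2 - α * (inner ℂ (T (P v)) (P v)).re} := by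
    refine isClosed_le continuous_const ?_
    have h1 : Continuous fun v : H => inner ℂ (T (P v)) (P v) :=
      (T.continuous.comp P.continuous).inner P.continuous
    have h2 : Continuous fun v : H => (inner ℂ (T (P v)) (P v)).re := Complex.continuous_re.comp h1
    fun_prop
  have hall : ∀ v : H, 0 ≤ ‖P v‖ ^ 2 - α * (inner ℂ (T (P v)) (P v)).re := fun v =>
    hclosed.closure_subset_iff.2 (fun v hv => hLo _ ((iSup_le hcases) hv)) (hdense v)
  have := hall u
  rwa [hPfix u hu] at this

end SpectralSubspaces

/-! ### The Birman–Schwinger principle and the crossing count. -/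

section BirmanSchwinger

variable {H : Type*} [NormedAddCommGroup H] [InnerProductSpace ℂ H]

/-- The Birman–Schwinger correspondence `u ↦ r u` between the kernel of `A - t r² - E` and the
eigenspace of `r (A - E)⁻¹ r` for the eigenvalue `1 / t`. -/
def birmanSchwingerEquiv {A R r : H →L[ℂ] H} {E t : ℝ} (ht : t ≠ 0)
    (hRB : ∀ u, R (A u - (E : ℂ) • u) = u) (hBR : ∀ u, A (R u) - (E : ℂ) • R u = u) :
    Module.End.eigenspace (A - (t : ℂ) • (r ∘L r) : H →L[ℂ] H).toLinearMap (E : ℂ) ≃ₗ[ℂ]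
      Module.End.eigenspace (r ∘L R ∘L r : H →L[ℂ] H).toLinearMap ((t⁻¹ : ℝ) : ℂ) := by
  have htC : (t : ℂ) ≠ 0 := Complex.ofReal_ne_zero.2 ht
  have key : ∀ u ∈ Module.End.eigenspace (A - (t : ℂ) • (r ∘L r) : H →L[ℂ] H).toLinearMap (E : ℂ),
      u = (t : ℂ) • R (r (r u)) := by
    intro u hu
    have h1 : A u - (t : ℂ) • r (r u) = (E : ℂ) • u := Module.End.mem_eigenspace_iff.1 hu
    have h2 : A u - (E : ℂ) • u = (t : ℂ) • r (r u) := by rw [← h1]; abel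
    rw [← map_smul, ← h2, hRB]
  have key' : ∀ w ∈ Module.End.eigenspace (r ∘L R ∘L r : H →L[ℂ] H).toLinearMap ((t⁻¹ : ℝ) : ℂ),
      (t : ℂ) • r (R (r w)) = w := by
    intro w hw
    have h1 : r (R (r w)) = ((t⁻¹ : ℝ) : ℂ) • w := Module.End.mem_eigenspace_iff.1 hw
    rw [h1, Complex.ofReal_inv, smul_inv_smul₀ htC]
  refine LinearEquiv.ofLinearMap
    (r.toLinearMap.restrict (p := _) (q := _) fun u hu => ?_)
    (((t : ℂ) • (R ∘L r : H →L[ℂ] H)).toLinearMap.restrict (p := _) (q := _) fun w hw => ?_) ?_ ?_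
  · rw [Module.End.mem_eigenspace_iff]
    change r (R (r (r u))) = ((t⁻¹ : ℝ) : ℂ) • r u
    conv_rhs => rw [key u hu]
    rw [map_smul, Complex.ofReal_inv, inv_smul_smul₀ htC]
  · rw [Module.End.mem_eigenspace_iff]
    change A ((t : ℂ) • R (r w)) - (t : ℂ) • r (r ((t : ℂ) • R (r w))) = (E : ℂ) • ((t : ℂ) • R (r w))
    have h1 : r ((t : ℂ) • R (r w)) = w := by rw [map_smul, key' w hw]
    rw [h1, map_smul, smul_comm (E : ℂ), ← smul_sub, sub_eq_iff_eq_add.1 (hBR (r w)),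
      add_sub_cancel_left]
  · ext ⟨w, hw⟩
    change r ((t : ℂ) • R (r w)) = w
    rw [map_smul, key' w hw]
  · ext ⟨u, hu⟩
    exact (key u hu).symm

variable [CompleteSpace H]

/-- The number of crossings is the dimension of a subspace on which `bsForm` is negative and whose
orthogonal complement carries a nonnegative form. -/
theorem exists_submodule_crossings {A R r : H →L[ℂ] H} {E α : ℝ} (hα : 0 < α)
    (hR : R.toLinearMap.IsSymmetric) (hr : r.toLinearMap.IsSymmetric)
    (hRB : ∀ u, R (A u - (E : ℂ) • u) = u) (hBR : ∀ u, A (R u) - (E : ℂ) • R u = u)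
    (hc : IsCompactOperator r) {X : Submodule ℂ H} [FiniteDimensional ℂ X]
    (hX : ∀ w ∈ Xᗮ, 0 ≤ bsForm R ((√α : ℂ) • r) w) :
    ∃ LK : Submodule ℂ H, FiniteDimensional ℂ LK ∧
      (∑' t : Set.Ioo (0 : ℝ) α, ((Cardinal.toENat (Module.rank ℂ (Module.End.eigenspace
        (A - ((t : ℝ) : ℂ) • (r ∘L r) : H →L[ℂ] H).toLinearMap (E : ℂ))) : ℕ∞) : ℝ≥0∞))
          = (Module.finrank ℂ LK : ℕ) ∧
      (∀ w ∈ LK, w ≠ 0 → bsForm R ((√α : ℂ) • r) w < 0) ∧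
      (∀ w ∈ LKᗮ, 0 ≤ bsForm R ((√α : ℂ) • r) w) := by
  let K : H →L[ℂ] H := r ∘L R ∘L r
  have hform : ∀ w, bsForm R ((√α : ℂ) • r) w = ‖w‖ ^ 2 - α * (inner ℂ (K w) w).re := by
    intro w
    have h1 : inner ℂ (r (R (r w))) w = inner ℂ (R (r w)) (r w) := hr _ _
    have h2 : inner ℂ (K w) w = inner ℂ (R (r w)) (r w) := h1
    have h3 : (inner ℂ (R (((√α : ℂ) • r) w)) (((√α : ℂ) • r) w))
        = (α : ℂ) * inner ℂ (R (r w)) (r w) := by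
      rw [smul_apply, map_smul, inner_smul_left, inner_smul_right, Complex.conj_ofReal,
        ← mul_assoc, ← Complex.ofReal_mul, Real.mul_self_sqrt hα.le]
    unfold bsForm
    rw [h2, h3, Complex.re_ofReal_mul]
  have hK : K.toLinearMap.IsSymmetric := fun x y => by
    have h1 : inner ℂ (r (R (r x))) y = inner ℂ (R (r x)) (r y) := hr _ _
    have h2 : inner ℂ (R (r x)) (r y) = inner ℂ (r x) (R (r y)) := hR _ _
    have h3 : inner ℂ (r x) (R (r y)) = inner ℂ x (r (R (r y))) := hr _ _
    exact h1.trans (h2.trans h3)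
  have hKc : IsCompactOperator K := hc.comp_clm (R ∘L r)
  let LK := upperSpectralSubspace K α
  have hneg : ∀ w ∈ LK, w ≠ 0 → bsForm R ((√α : ℂ) • r) w < 0 := fun w hw hw0 => by
    rw [hform]
    exact upperSpectralSubspace_form_neg hK hw hw0
  -- A vector of `LK` orthogonal to `X` has a form value both negative and nonnegative unless it is
  -- zero, so projecting `LK` to `X` is injective.
  have hfin : FiniteDimensional ℂ LK := by
    let φ : LK →ₗ[ℂ] X := X.orthogonalProjectionOnto.toLinearMap ∘ₗ LK.subtype
    refine FiniteDimensional.of_injective φ ?_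
    rw [injective_iff_map_eq_zero]
    rintro ⟨w, hw⟩ h
    have hwX : w ∈ Xᗮ := Submodule.orthogonalProjectionOnto_eq_zero_iff.1 h
    by_contra hw0
    exact absurd (hX w hwX) (not_le.2 (hneg w hw fun h => hw0 (Subtype.ext h)))
  refine ⟨LK, hfin, ?_, hneg, fun w hw => ?_⟩
  · have hind : iSupIndep fun t : Set.Ioo (0 : ℝ) α =>
        Module.End.eigenspace K.toLinearMap (((t : ℝ)⁻¹ : ℝ) : ℂ) :=
      (Module.End.eigenspaces_iSupIndep K.toLinearMap).comp (inv_ofReal_injective α)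
    have hfin' : FiniteDimensional ℂ (⨆ t : Set.Ioo (0 : ℝ) α,
      Module.End.eigenspace K.toLinearMap (((t : ℝ)⁻¹ : ℝ) : ℂ) : Submodule ℂ H) := hfin
    have h1 := tsum_finrank_eq_finrank_iSup hind
    refine Eq.trans (tsum_congr fun t => ?_) h1
    have hft : FiniteDimensional ℂ (Module.End.eigenspace K.toLinearMap (((t : ℝ)⁻¹ : ℝ) : ℂ)) :=
      Submodule.finiteDimensional_of_le (le_iSup (fun t : Set.Ioo (0 : ℝ) α =>
        Module.End.eigenspace K.toLinearMap (((t : ℝ)⁻¹ : ℝ) : ℂ)) t)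
    rw [(birmanSchwingerEquiv (r := r) t.2.1.ne' hRB hBR).rank_eq]
    change ((Cardinal.toENat (Module.rank ℂ
      (Module.End.eigenspace K.toLinearMap (((t : ℝ)⁻¹ : ℝ) : ℂ))) : ℕ∞) : ℝ≥0∞) = _
    rw [← Module.finrank_eq_rank, Cardinal.toENat_nat, ENat.toENNReal_coe]
  · rw [hform]
    exact upperSpectralSubspace_orthogonal_form_nonneg hK hKc hα hw

end BirmanSchwinger

/-! ### Finite sections on the lattice and variational bounds for their eigenvalue counts. -/

section Lattice

variable {d : ℕ}

/-- The functions in `ℓ²(ℤ^d)` that vanish off `S`. -/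
def supportedOn (S : Finset (Zd d)) : Submodule ℂ (L2 d) where
  carrier := {u | ∀ n, n ∉ S → u n = 0}
  add_mem' := fun {u v} hu hv n hn => by
    rw [lp.coeFn_add, Pi.add_apply, hu n hn, hv n hn, add_zero]
  zero_mem' := fun _ _ => rfl
  smul_mem' := fun c u hu n hn => by
    rw [lp.coeFn_smul, Pi.smul_apply, hu n hn, smul_zero]

theorem supportedOn_mono {S S' : Finset (Zd d)} (h : S ⊆ S') : supportedOn S ≤ supportedOn S' :=
  fun _ hu n hn => hu n fun hn' => hn (h hn')

open Classical in
/-- Extension by zero of a function on `S`. -/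
def extendZero (S : Finset (Zd d)) : EuclideanSpace ℂ S →ₗ[ℂ] L2 d where
  toFun v := ⟨fun n => if h : n ∈ S then v ⟨n, h⟩ else 0, by
    refine memℓp_gen (summable_of_hasFiniteSupport (S.finite_toSet.subset fun n hn => ?_))
    by_contra h
    rw [Finset.mem_coe] at h
    simp [h] at hn⟩
  map_add' u v := by
    ext n
    change (if h : n ∈ S then (u + v) ⟨n, h⟩ else 0) = (if h : n ∈ S then u ⟨n, h⟩ else 0)
      + (if h : n ∈ S then v ⟨n, h⟩ else 0)
    split_ifs <;> simp
  map_smul' c u := by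
    ext n
    change (if h : n ∈ S then (c • u) ⟨n, h⟩ else 0) = c * (if h : n ∈ S then u ⟨n, h⟩ else 0)
    split_ifs <;> simp

theorem extendZero_of_mem {S : Finset (Zd d)} (v : EuclideanSpace ℂ S) {n : Zd d} (h : n ∈ S) :
    extendZero S v n = v ⟨n, h⟩ := by
  change (dite (n ∈ S) _ _ : ℂ) = _
  rw [dif_pos h]

theorem extendZero_of_notMem {S : Finset (Zd d)} (v : EuclideanSpace ℂ S) {n : Zd d}
    (h : n ∉ S) : extendZero S v n = 0 := by
  change (dite (n ∈ S) _ _ : ℂ) = _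
  rw [dif_neg h]

theorem extendZero_mem (S : Finset (Zd d)) (v : EuclideanSpace ℂ S) :
    extendZero S v ∈ supportedOn S := fun _ hn => extendZero_of_notMem v hn

theorem extendZero_injective (S : Finset (Zd d)) : Function.Injective (extendZero S) := by
  intro u v h
  ext ⟨n, hn⟩
  rw [← extendZero_of_mem u hn, ← extendZero_of_mem v hn, h]

theorem range_extendZero (S : Finset (Zd d)) : LinearMap.range (extendZero S) = supportedOn S := by
  refine le_antisymm ?_ fun u hu => ⟨WithLp.toLp 2 fun n => u n.1, ?_⟩
  · rintro _ ⟨v, rfl⟩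
    exact extendZero_mem S v
  · ext n
    by_cases hn : n ∈ S
    · rw [extendZero_of_mem _ hn]
    · rw [extendZero_of_notMem _ hn, hu n hn]

instance (S : Finset (Zd d)) : FiniteDimensional ℂ (supportedOn S) := by
  rw [← range_extendZero]
  infer_instance

theorem finrank_supportedOn (S : Finset (Zd d)) :
    Module.finrank ℂ (supportedOn S) = S.card := by
  rw [← range_extendZero, LinearMap.finrank_range_of_inj (extendZero_injective S)]
  simp

theorem inner_eq_sum_of_mem {S : Finset (Zd d)} (u : L2 d) {w : L2 d} (hw : w ∈ supportedOn S) :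
    inner ℂ u w = ∑ n ∈ S, inner ℂ (u n) (w n) := by
  rw [lp.inner_eq_tsum]
  refine tsum_eq_sum fun n hn => ?_
  rw [hw n hn, inner_zero_right]

theorem norm_sq_eq_sum_of_mem {S : Finset (Zd d)} {u : L2 d} (hu : u ∈ supportedOn S) :
    ‖u‖ ^ 2 = ∑ n ∈ S, ‖u n‖ ^ 2 := by
  have h := inner_eq_sum_of_mem u hu
  have h1 : (inner ℂ u u).re = ‖u‖ ^ 2 := inner_self_eq_norm_sq (𝕜 := ℂ) u
  rw [← h1, h, Complex.re_sum]
  exact Finset.sum_congr rfl fun n _ => inner_self_eq_norm_sq (𝕜 := ℂ) (u n)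

theorem apply_eq_zero_of_mem_orthogonal {S : Finset (Zd d)} {w : L2 d}
    (hw : w ∈ (supportedOn S)ᗮ) {n : Zd d} (hn : n ∈ S) : w n = 0 := by
  classical
  have h1 : (lp.single 2 n (1 : ℂ) : L2 d) ∈ supportedOn S := by
    intro m hm
    have : m ≠ n := fun h => hm (h ▸ hn)
    rw [lp.single_apply, Pi.single_eq_of_ne this]
  have h2 := (Submodule.mem_orthogonal _ _).1 hw _ h1
  rw [lp.inner_single_left] at h2
  simpa using h2

theorem neg_mem_unitVectors {v : Zd d} (hv : v ∈ unitVectors d) : -v ∈ unitVectors d := by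
  rw [mem_unitVectors] at hv ⊢
  rw [← hv, ← norm_neg]
  congr 1
  ext i
  simp [pt]

theorem inner_translation (v : Zd d) (u w : L2 d) :
    inner ℂ (translation v u) w = inner ℂ u (translation (-v) w) := by
  rw [lp.inner_eq_tsum, lp.inner_eq_tsum,
    ← (Equiv.addRight v).tsum_eq fun n => inner ℂ (u n) (translation (-v) w n)]
  refine tsum_congr fun n => ?_
  simp

theorem mulOp_isSymmetric (g : Zd d → ℝ) (hg : IsBoundedFun g) :
    (mulOp g hg).toLinearMap.IsSymmetric := by
  intro u w
  change inner ℂ (mulOp g hg u) w = inner ℂ u (mulOp g hg w)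
  rw [lp.inner_eq_tsum, lp.inner_eq_tsum]
  refine tsum_congr fun n => ?_
  simp only [mulOp_apply, RCLike.inner_apply, map_mul, Complex.conj_ofReal]
  ring

theorem schrodinger_isSymmetric (f : Zd d → ℝ) (hf : IsBoundedFun f) :
    (schrodinger f hf).toLinearMap.IsSymmetric := by
  intro u w
  change inner ℂ (schrodinger f hf u) w = inner ℂ u (schrodinger f hf w)
  have h1 : ∀ u, schrodinger f hf u
      = -(∑ v ∈ unitVectors d, translation v u) + (2 * d : ℂ) • u + mulOp f hf u := fun u => by
    rw [← sum_apply (unitVectors d)]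
    rfl
  have h2 : inner ℂ (mulOp f hf u) w = inner ℂ u (mulOp f hf w) := mulOp_isSymmetric f hf u w
  have h3 : ∑ v ∈ unitVectors d, inner ℂ (translation v u) w
      = ∑ v ∈ unitVectors d, inner ℂ u (translation v w) :=
    Finset.sum_nbij' (fun v => -v) (fun v => -v) (fun v hv => neg_mem_unitVectors hv)
      (fun v hv => neg_mem_unitVectors hv) (fun v _ => neg_neg v) (fun v _ => neg_neg v)
      (fun v _ => inner_translation v u w)
  rw [h1, h1, inner_add_left, inner_add_left, inner_add_right, inner_add_right, inner_neg_left,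
    inner_neg_right, sum_inner, inner_sum, h2, h3, inner_smul_left, inner_smul_right, map_mul,
    Complex.conj_natCast, Complex.conj_ofNat]

theorem schrodinger_apply_eq_zero (f : Zd d → ℝ) (hf : IsBoundedFun f) {S : Finset (Zd d)}
    {u : L2 d} (hu : u ∈ supportedOn S) {n : Zd d} (hn : n ∉ S)
    (hnv : ∀ v ∈ unitVectors d, n + v ∉ S) : schrodinger f hf u n = 0 := by
  have h : ∑ v ∈ unitVectors d, u (n + v) = 0 := Finset.sum_eq_zero fun v hv => hu _ (hnv v hv)
  rw [schrodinger_apply, h, hu n hn, neg_zero, mul_zero, mul_zero, add_zero, add_zero]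

theorem schrodinger_eq_add (f : Zd d → ℝ) (hf : IsBoundedFun f) (h0 : IsBoundedFun (0 : Zd d → ℝ))
    (u : L2 d) : schrodinger f hf u = schrodinger 0 h0 u + mulOp f hf u := by
  ext n
  rw [lp.coeFn_add, Pi.add_apply, schrodinger_apply, schrodinger_apply, mulOp_apply]
  simp

/-- The form of `-Δ + f - E`. -/
def schrodingerForm (f : Zd d → ℝ) (hf : IsBoundedFun f) (E : ℝ) (u : L2 d) : ℝ :=
  (inner ℂ (schrodinger f hf u) u).re - E * ‖u‖ ^ 2

theorem re_inner_mulOp_of_mem (g : Zd d → ℝ) (hg : IsBoundedFun g) {S : Finset (Zd d)} {u : L2 d}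
    (hu : u ∈ supportedOn S) : (inner ℂ (mulOp g hg u) u).re = ∑ n ∈ S, g n * ‖u n‖ ^ 2 := by
  rw [inner_eq_sum_of_mem _ hu, Complex.re_sum]
  refine Finset.sum_congr rfl fun n _ => ?_
  have h : (inner ℂ (u n) (u n)).re = ‖u n‖ ^ 2 := inner_self_eq_norm_sq (𝕜 := ℂ) (u n)
  rw [mulOp_apply, ← smul_eq_mul, inner_smul_left, Complex.conj_ofReal, Complex.re_ofReal_mul, h]

theorem schrodingerForm_eq_of_mem (f : Zd d → ℝ) (hf : IsBoundedFun f)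
    (h0 : IsBoundedFun (0 : Zd d → ℝ)) (E : ℝ) {S : Finset (Zd d)} {u : L2 d}
    (hu : u ∈ supportedOn S) :
    schrodingerForm f hf E u = (inner ℂ (schrodinger 0 h0 u) u).re
      + ∑ n ∈ S, (f n - E) * ‖u n‖ ^ 2 := by
  unfold schrodingerForm
  rw [schrodinger_eq_add f hf h0, inner_add_left, Complex.add_re, re_inner_mulOp_of_mem f hf hu,
    norm_sq_eq_sum_of_mem hu, Finset.mul_sum, add_sub_assoc, ← Finset.sum_sub_distrib]
  simp only [sub_mul]

/-- The operator only couples neighbouring sites, so without edges between `S` and `T` all cross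
terms vanish. -/
theorem schrodingerForm_add (f : Zd d → ℝ) (hf : IsBoundedFun f) (E : ℝ) {S T : Finset (Zd d)}
    (hST : Disjoint S T) (hadj : ∀ n ∈ S, ∀ v ∈ unitVectors d, n + v ∉ T) {u w : L2 d}
    (hu : u ∈ supportedOn S) (hw : w ∈ supportedOn T) :
    schrodingerForm f hf E (u + w) = schrodingerForm f hf E u + schrodingerForm f hf E w := by
  have h1 : inner ℂ (schrodinger f hf w) u = 0 := by
    rw [inner_eq_sum_of_mem _ hu]
    refine Finset.sum_eq_zero fun n hn => ?_
    rw [schrodinger_apply_eq_zero f hf hw (Finset.disjoint_left.1 hST hn) (hadj n hn),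
      inner_zero_left]
  have h2 : inner ℂ (schrodinger f hf u) w = 0 := by
    have h3 : inner ℂ (schrodinger f hf u) w = inner ℂ u (schrodinger f hf w) :=
      schrodinger_isSymmetric f hf u w
    rw [h3, ← inner_conj_symm, h1, map_zero]
  have h4 : inner ℂ u w = 0 := by
    rw [inner_eq_sum_of_mem _ hw]
    refine Finset.sum_eq_zero fun n hn => ?_
    rw [hu n (Finset.disjoint_right.1 hST hn), inner_zero_left]
  have h5 : ‖u + w‖ ^ 2 = ‖u‖ ^ 2 + ‖w‖ ^ 2 := by
    have := norm_add_sq (𝕜 := ℂ) u w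
    rw [h4] at this
    simpa using this
  unfold schrodingerForm
  rw [h5, map_add, inner_add_left, inner_add_right, inner_add_right, h1, h2]
  simp only [Complex.add_re, Complex.zero_re]
  ring

open Classical in
/-- The number of eigenvalues below `E` of the finite section on `S` of `-Δ + f`. -/
def sectionCount (f : Zd d → ℝ) (S : Finset (Zd d)) (E : ℝ) : ℕ :=
  (Finset.univ.filter fun i => (restrictedMatrix_isHermitian f S).eigenvalues i < E).card

theorem eigenvalueCount_eq_sectionCount (f : Zd d → ℝ) (Ω : Set (EuclideanSpace ℝ (Fin d)))
    (hΩ : Bornology.IsBounded Ω) (E : ℝ) :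
    eigenvalueCount f Ω hΩ E = sectionCount f (latticePoints Ω hΩ) E := rfl

/-- The matrix is the compression of the full operator: neighbours outside `S` contribute nothing
because the extension vanishes there. -/
theorem restrictedMatrix_mulVec (f : Zd d → ℝ) (hf : IsBoundedFun f) (S : Finset (Zd d))
    (v : EuclideanSpace ℂ S) (n : S) :
    (restrictedMatrix f S).mulVec v.ofLp n = schrodinger f hf (extendZero S v) n := by
  classical
  have h1 : ∑ w ∈ unitVectors d, extendZero S v (n + w)
      = ∑ m : S, if ‖pt (m.1 - n.1)‖ = 1 then v m else 0 := by
    have h2 : ∀ m : S, (if ‖pt (m.1 - n.1)‖ = 1 then v m else 0)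
        = (fun k : Zd d => if ‖pt (k - n.1)‖ = 1 then extendZero S v k else 0) m := fun m => by
      simp only [extendZero_of_mem v m.2]
    rw [Finset.sum_congr rfl fun m _ => h2 m, Finset.sum_coe_sort S
      (fun k : Zd d => if ‖pt (k - n.1)‖ = 1 then extendZero S v k else 0), ← Finset.sum_filter]
    have h3 : ∑ w ∈ unitVectors d, extendZero S v (n + w)
        = ∑ k ∈ (unitVectors d).image (fun w => n.1 + w), extendZero S v k := by
      rw [Finset.sum_image fun a _ b _ h => add_left_cancel h]
    rw [h3]
    symm
    refine Finset.sum_subset (fun k hk => ?_) fun k hk hk' => ?_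
    · rw [Finset.mem_filter] at hk
      rw [Finset.mem_image]
      exact ⟨k - n.1, (mem_unitVectors _).2 hk.2, by abel⟩
    · rw [Finset.mem_image] at hk
      obtain ⟨w, hw, rfl⟩ := hk
      refine extendZero_of_notMem v fun h => hk' ?_
      rw [Finset.mem_filter, add_sub_cancel_left]
      exact ⟨h, (mem_unitVectors _).1 hw⟩
  rw [schrodinger_apply, h1, extendZero_of_mem v n.2, Matrix.mulVec, dotProduct]
  simp only [restrictedMatrix, Matrix.of_apply, add_mul, Finset.sum_add_distrib, ite_mul,
    zero_mul, Finset.sum_ite_eq', Finset.mem_univ, if_true, ← Finset.sum_neg_distrib, neg_ite,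
    neg_zero, neg_mul, one_mul]
  simp [add_assoc]

theorem extendZero_inner (S : Finset (Zd d)) (u v : EuclideanSpace ℂ S) :
    inner ℂ (extendZero S u) (extendZero S v) = inner ℂ u v := by
  rw [inner_eq_sum_of_mem _ (extendZero_mem S v), PiLp.inner_apply, ← Finset.sum_coe_sort S]
  refine Finset.sum_congr rfl fun n _ => ?_
  rw [extendZero_of_mem u n.2, extendZero_of_mem v n.2]

open Classical in
theorem schrodingerForm_extendZero (f : Zd d → ℝ) (hf : IsBoundedFun f) (S : Finset (Zd d))
    (E : ℝ) (v : EuclideanSpace ℂ S) :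
    schrodingerForm f hf E (extendZero S v)
      = ∑ i, ((restrictedMatrix_isHermitian f S).eigenvalues i - E)
        * ‖(restrictedMatrix_isHermitian f S).eigenvectorBasis.repr v i‖ ^ 2 := by
  set hM := restrictedMatrix_isHermitian f S
  set b := hM.eigenvectorBasis with hb
  let T := Matrix.toEuclideanLin (restrictedMatrix f S)
  have hT : T.IsSymmetric := Matrix.isSymmetric_toEuclideanLin_iff.2 hM
  have hTv : ∀ v, (T v).ofLp = (restrictedMatrix f S).mulVec v.ofLp := fun v => rfl
  have hTb : ∀ i, T (b i) = (hM.eigenvalues i : ℂ) • b i := fun i => by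
    apply WithLp.ofLp_injective
    rw [hTv, hM.mulVec_eigenvectorBasis i]
    ext j
    simp [hb]
  have h1 : inner ℂ (schrodinger f hf (extendZero S v)) (extendZero S v) = inner ℂ (T v) v := by
    rw [inner_eq_sum_of_mem _ (extendZero_mem S v), PiLp.inner_apply, ← Finset.sum_coe_sort S]
    refine Finset.sum_congr rfl fun n _ => ?_
    rw [extendZero_of_mem v n.2, hTv, restrictedMatrix_mulVec f hf S v n]
  have h2 : ∀ i, b.repr (T v) i = (hM.eigenvalues i : ℂ) * b.repr v i := fun i => by
    rw [b.repr_apply_apply, b.repr_apply_apply, ← hT, hTb, inner_smul_left, Complex.conj_ofReal]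
  have h3 : (inner ℂ (T v) v).re = ∑ i, hM.eigenvalues i * ‖b.repr v i‖ ^ 2 := by
    rw [← b.repr.inner_map_map, PiLp.inner_apply, Complex.re_sum]
    refine Finset.sum_congr rfl fun i _ => ?_
    have h : (inner ℂ (b.repr v i) (b.repr v i)).re = ‖b.repr v i‖ ^ 2 :=
      inner_self_eq_norm_sq (𝕜 := ℂ) (b.repr v i)
    rw [h2, ← smul_eq_mul, inner_smul_left, Complex.conj_ofReal, Complex.re_ofReal_mul, h]
  have h4 : ‖extendZero S v‖ ^ 2 = ∑ i, ‖b.repr v i‖ ^ 2 := by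
    have h5 : (inner ℂ (extendZero S v) (extendZero S v)).re = ‖extendZero S v‖ ^ 2 :=
      inner_self_eq_norm_sq (𝕜 := ℂ) _
    have h6 : (inner ℂ v v).re = ‖v‖ ^ 2 := inner_self_eq_norm_sq (𝕜 := ℂ) _
    rw [← h5, extendZero_inner, h6, ← b.repr.norm_map, EuclideanSpace.norm_sq_eq]
  unfold schrodingerForm
  rw [h1, h3, h4, Finset.mul_sum, ← Finset.sum_sub_distrib]
  simp only [sub_mul]

open Classical in
/-- The span of the eigenvectors indexed by `I` of a finite section. -/
theorem exists_submodule_eigenvectors (f : Zd d → ℝ) (S : Finset (Zd d)) (I : Finset S) :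
    ∃ L : Submodule ℂ (L2 d), L ≤ supportedOn S ∧ Module.finrank ℂ L = I.card ∧
      ∀ u ∈ L, ∃ v, extendZero S v = u ∧ ∀ i, i ∉ I →
        (restrictedMatrix_isHermitian f S).eigenvectorBasis.repr v i = 0 := by
  set b := (restrictedMatrix_isHermitian f S).eigenvectorBasis
  let L0 : Submodule ℂ (EuclideanSpace ℂ S) := Submodule.span ℂ (Set.range fun i : I => b i)
  have hL0 : Module.finrank ℂ L0 = I.card := by
    have h := finrank_span_eq_card (b.orthonormal.linearIndependent.comp (fun i : I => (i : S))
      Subtype.val_injective)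
    rw [Fintype.card_coe] at h
    exact h
  refine ⟨L0.map (extendZero S), ?_, ?_, ?_⟩
  · rintro _ ⟨v, _, rfl⟩
    exact extendZero_mem S v
  · rw [← hL0]
    exact (Submodule.equivMapOfInjective _ (extendZero_injective S) L0).finrank_eq.symm
  · rintro _ ⟨v, hv, rfl⟩
    refine ⟨v, rfl, fun i hi => ?_⟩
    have hle : L0 ≤ LinearMap.ker (b.toBasis.coord i) := by
      refine Submodule.span_le.2 ?_
      rintro _ ⟨j, rfl⟩
      have hji : (j : S) ≠ i := fun h => hi (h ▸ j.2)
      rw [SetLike.mem_coe, LinearMap.mem_ker, Module.Basis.coord_apply,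
        OrthonormalBasis.coe_toBasis_repr_apply, b.repr_self]
      simp [hji.symm]
    have := hle hv
    rwa [LinearMap.mem_ker, Module.Basis.coord_apply,
      OrthonormalBasis.coe_toBasis_repr_apply] at this

/-- This lemma and the next three form the variational principle: eigenvectors below and above `E`
give extremal subspaces for each sign of the form, and subspaces of opposite sign meet trivially.
All later comparisons of counts exhibit such subspaces. -/
theorem exists_neg_submodule (f : Zd d → ℝ) (hf : IsBoundedFun f) (S : Finset (Zd d)) (E : ℝ) :
    ∃ L ≤ supportedOn S, Module.finrank ℂ L = sectionCount f S E ∧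
      ∀ u ∈ L, u ≠ 0 → schrodingerForm f hf E u < 0 := by
  classical
  obtain ⟨L, hL, hfin, h⟩ := exists_submodule_eigenvectors f S
    (Finset.univ.filter fun i => (restrictedMatrix_isHermitian f S).eigenvalues i < E)
  refine ⟨L, hL, ?_, fun u hu hu0 => ?_⟩
  · rw [hfin, sectionCount]
  · obtain ⟨v, rfl, hv⟩ := h u hu
    rw [schrodingerForm_extendZero]
    set b := (restrictedMatrix_isHermitian f S).eigenvectorBasis
    have hv0 : b.repr v ≠ 0 := fun h => hu0 (by
      rw [(LinearIsometryEquiv.map_eq_zero_iff _).1 h, map_zero])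
    obtain ⟨i, hi⟩ : ∃ i, b.repr v i ≠ 0 := by
      by_contra! hcon
      exact hv0 (by ext i; exact hcon i)
    have hev : ∀ j, b.repr v j ≠ 0 → (restrictedMatrix_isHermitian f S).eigenvalues j < E := by
      intro j hj
      by_contra hcon
      exact hj (hv j (by simpa using hcon))
    refine Finset.sum_neg' (fun j _ => ?_) ⟨i, Finset.mem_univ i, ?_⟩
    · by_cases hj : b.repr v j = 0
      · simp [hj]
      · exact mul_nonpos_of_nonpos_of_nonneg (by linarith [hev j hj]) (by positivity)
    · exact mul_neg_of_neg_of_pos (by linarith [hev i hi]) (by positivity)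

theorem exists_nonneg_submodule (f : Zd d → ℝ) (hf : IsBoundedFun f) (S : Finset (Zd d)) (E : ℝ) :
    ∃ P ≤ supportedOn S, Module.finrank ℂ P + sectionCount f S E = S.card ∧
      ∀ u ∈ P, 0 ≤ schrodingerForm f hf E u := by
  classical
  obtain ⟨P, hP, hfin, h⟩ := exists_submodule_eigenvectors f S
    (Finset.univ.filter fun i => ¬ (restrictedMatrix_isHermitian f S).eigenvalues i < E)
  refine ⟨P, hP, ?_, fun u hu => ?_⟩
  · rw [hfin, sectionCount, add_comm, Finset.card_filter_add_card_filter_not]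
    simp
  · obtain ⟨v, rfl, hv⟩ := h u hu
    rw [schrodingerForm_extendZero]
    refine Finset.sum_nonneg fun j _ => ?_
    by_cases hj : (restrictedMatrix_isHermitian f S).eigenvalues j < E
    · rw [hv j (by simpa using hj)]
      simp
    · exact mul_nonneg (by linarith) (by positivity)

theorem finrank_le_sectionCount (f : Zd d → ℝ) (hf : IsBoundedFun f) {S : Finset (Zd d)} {E : ℝ}
    {L : Submodule ℂ (L2 d)} (hL : L ≤ supportedOn S)
    (h : ∀ u ∈ L, u ≠ 0 → schrodingerForm f hf E u < 0) :
    Module.finrank ℂ L ≤ sectionCount f S E := by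
  obtain ⟨P, hP, hfin, hPn⟩ := exists_nonneg_submodule f hf S E
  have h1 := finrank_add_finrank_le_of_inf_le_bot hL hP fun u hu hu' => by
    by_contra hu0
    exact absurd (h u hu hu0) (not_lt.2 (hPn u hu'))
  rw [finrank_supportedOn] at h1
  omega

theorem finrank_add_sectionCount_le (f : Zd d → ℝ) (hf : IsBoundedFun f) {S : Finset (Zd d)}
    {E : ℝ} {P : Submodule ℂ (L2 d)} (hP : P ≤ supportedOn S)
    (h : ∀ u ∈ P, 0 ≤ schrodingerForm f hf E u) :
    Module.finrank ℂ P + sectionCount f S E ≤ S.card := by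
  obtain ⟨L, hL, hfin, hLn⟩ := exists_neg_submodule f hf S E
  have h1 := finrank_add_finrank_le_of_inf_le_bot hL hP fun u hu hu' => by
    by_contra hu0
    exact absurd (hLn u hu hu0) (not_lt.2 (h u hu'))
  rw [finrank_supportedOn] at h1
  omega

theorem sectionCount_le_card (f : Zd d → ℝ) (S : Finset (Zd d)) (E : ℝ) :
    sectionCount f S E ≤ S.card := by
  classical
  refine (Finset.card_le_univ _).trans ?_
  simp

theorem sectionCount_mono_set (f : Zd d → ℝ) (hf : IsBoundedFun f) {S T : Finset (Zd d)}
    (h : S ⊆ T) (E : ℝ) : sectionCount f S E ≤ sectionCount f T E := by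
  obtain ⟨L, hL, hfin, hLn⟩ := exists_neg_submodule f hf S E
  rw [← hfin]
  exact finrank_le_sectionCount f hf (hL.trans (supportedOn_mono h)) hLn

/-- Interlacing: a nonnegative subspace for `S` stays nonnegative for `T`, so enlarging the set by m
sites adds at most m eigenvalues below `E`. -/
theorem sectionCount_add_card_le (f : Zd d → ℝ) (hf : IsBoundedFun f) {S T : Finset (Zd d)}
    (h : S ⊆ T) (E : ℝ) : sectionCount f T E + S.card ≤ sectionCount f S E + T.card := by
  obtain ⟨P, hP, hfin, hPn⟩ := exists_nonneg_submodule f hf S E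
  have := finrank_add_sectionCount_le f hf (hP.trans (supportedOn_mono h)) hPn
  omega

/-- Allowing two energies makes it possible to trade a nearly constant potential for a shift of the
energy. -/
theorem sectionCount_mono (f g : Zd d → ℝ) (hf : IsBoundedFun f) (hg : IsBoundedFun g)
    {S : Finset (Zd d)} {E E' : ℝ} (h : ∀ n ∈ S, f n - E ≤ g n - E') :
    sectionCount g S E' ≤ sectionCount f S E := by
  obtain ⟨L, hL, hfin, hLn⟩ := exists_neg_submodule g hg S E'
  rw [← hfin]
  refine finrank_le_sectionCount f hf hL fun u hu hu0 => (hLn u hu hu0).trans_le' ?_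
  have h0 : IsBoundedFun (0 : Zd d → ℝ) := ⟨0, by simp⟩
  rw [schrodingerForm_eq_of_mem f hf h0 E (hL hu), schrodingerForm_eq_of_mem g hg h0 E' (hL hu)]
  refine add_le_add_right (Finset.sum_le_sum fun n hn => ?_) _
  exact mul_le_mul_of_nonneg_right (h n hn) (by positivity)

-- Sums of negative subspaces give one inequality, sums of nonnegative subspaces the other.
open Classical in
theorem sectionCount_union (f : Zd d → ℝ) (hf : IsBoundedFun f) {S T : Finset (Zd d)}
    (hST : Disjoint S T) (hadj : ∀ n ∈ S, ∀ v ∈ unitVectors d, n + v ∉ T) (E : ℝ) :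
    sectionCount f (S ∪ T) E = sectionCount f S E + sectionCount f T E := by
  have hdim : ∀ M ≤ supportedOn S, ∀ M' ≤ supportedOn T,
      Module.finrank ℂ (M ⊔ M' : Submodule ℂ (L2 d))
        = Module.finrank ℂ M + Module.finrank ℂ M' := by
    intro M h1 M' h2
    have := Submodule.finiteDimensional_of_le h1
    have := Submodule.finiteDimensional_of_le h2
    have h3 := Submodule.finrank_sup_add_finrank_inf_eq M M'
    have h4 : M ⊓ M' = ⊥ := by
      rw [eq_bot_iff]
      rintro u ⟨hu1, hu2⟩
      rw [Submodule.mem_bot]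
      ext n
      by_cases hn : n ∈ S
      · exact h2 hu2 n (Finset.disjoint_left.1 hST hn)
      · exact h1 hu1 n hn
    rwa [h4, finrank_bot, add_zero] at h3
  have hsup : ∀ M ≤ supportedOn S, ∀ M' ≤ supportedOn T, M ⊔ M' ≤ supportedOn (S ∪ T) :=
    fun M h1 M' h2 => sup_le (h1.trans (supportedOn_mono Finset.subset_union_left))
      (h2.trans (supportedOn_mono Finset.subset_union_right))
  obtain ⟨M, hM, hf1, hn1⟩ := exists_neg_submodule f hf S E
  obtain ⟨M', hM', hf2, hn2⟩ := exists_neg_submodule f hf T E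
  obtain ⟨P1, hP1, hg1, hp1⟩ := exists_nonneg_submodule f hf S E
  obtain ⟨P2, hP2, hg2, hp2⟩ := exists_nonneg_submodule f hf T E
  have h1 := finrank_le_sectionCount f hf (E := E) (hsup M hM M' hM') (by
    intro u hu hu0
    obtain ⟨u1, hu1, u2, hu2, rfl⟩ := Submodule.mem_sup.1 hu
    rw [schrodingerForm_add f hf E hST hadj (hM hu1) (hM' hu2)]
    have hz : schrodingerForm f hf E (0 : L2 d) = 0 := by simp [schrodingerForm]
    by_cases h10 : u1 = 0
    · have h20 : u2 ≠ 0 := by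
        rintro rfl
        exact hu0 (by rw [h10, add_zero])
      rw [h10, hz, zero_add]
      exact hn2 u2 hu2 h20
    · by_cases h20 : u2 = 0
      · rw [h20, hz, add_zero]
        exact hn1 u1 hu1 h10
      · exact add_neg (hn1 u1 hu1 h10) (hn2 u2 hu2 h20))
  have h2 := finrank_add_sectionCount_le f hf (E := E) (hsup P1 hP1 P2 hP2) (by
    intro u hu
    obtain ⟨u1, hu1, u2, hu2, rfl⟩ := Submodule.mem_sup.1 hu
    rw [schrodingerForm_add f hf E hST hadj (hP1 hu1) (hP2 hu2)]
    exact add_nonneg (hp1 u1 hu1) (hp2 u2 hu2))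
  rw [hdim M hM M' hM'] at h1
  rw [hdim P1 hP1 P2 hP2, Finset.card_union_of_disjoint hST] at h2
  omega

theorem sectionCount_biUnion (f : Zd d → ℝ) (hf : IsBoundedFun f) {ι : Type*} [DecidableEq ι]
    (J : Finset ι) (S : ι → Finset (Zd d))
    (hS : ∀ i ∈ J, ∀ j ∈ J, i ≠ j → Disjoint (S i) (S j))
    (hadj : ∀ i ∈ J, ∀ j ∈ J, i ≠ j → ∀ n ∈ S i, ∀ v ∈ unitVectors d, n + v ∉ S j) (E : ℝ) :
    sectionCount f (J.biUnion S) E = ∑ j ∈ J, sectionCount f (S j) E := by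
  induction J using Finset.induction_on with
  | empty =>
    rw [Finset.biUnion_empty, Finset.sum_empty]
    exact Nat.le_zero.1 (sectionCount_le_card f ∅ E)
  | insert a J ha ih =>
    have hne : ∀ j ∈ J, a ≠ j := fun j hj h => ha (h ▸ hj)
    have h1 := sectionCount_union f hf (S := S a) (T := J.biUnion S)
      ((Finset.disjoint_biUnion_right _ _ _).2 fun j hj =>
        hS a (Finset.mem_insert_self a J) j (Finset.mem_insert_of_mem hj) (hne j hj))
      (fun n hn v hv hmem => by
        obtain ⟨j, hj, hnj⟩ := Finset.mem_biUnion.1 hmem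
        exact hadj a (Finset.mem_insert_self a J) j (Finset.mem_insert_of_mem hj) (hne j hj)
          n hn v hv hnj) E
    rw [Finset.biUnion_insert, Finset.sum_insert ha, ← ih
      (fun i hi j hj => hS i (Finset.mem_insert_of_mem hi) j (Finset.mem_insert_of_mem hj))
      (fun i hi j hj => hadj i (Finset.mem_insert_of_mem hi) j (Finset.mem_insert_of_mem hj)),
      ← h1]

end Lattice

/-! ### Resolvents, and comparison of crossings with finite sections. -/

section Comparison

variable {d : ℕ}

/-- The bound on `g` is required only on the support of `u`, so that it applies to functions
vanishing on a finite set. -/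
theorem norm_mulOp_sq_le (g : Zd d → ℝ) (hg : IsBoundedFun g) {c : ℝ} (hc : 0 ≤ c) (u : L2 d)
    (h : ∀ n, u n ≠ 0 → g n ^ 2 ≤ c) : ‖mulOp g hg u‖ ^ 2 ≤ c * ‖u‖ ^ 2 := by
  have h1 : ‖mulOp g hg u‖ ≤ ‖((√c : ℝ) : ℂ) • u‖ := by
    refine lp.norm_mono (by norm_num) fun n => ?_
    change ‖(g n : ℂ) * u n‖ ≤ ‖((√c : ℝ) : ℂ) * u n‖
    rw [norm_mul, norm_mul, Complex.norm_real, Complex.norm_real, Real.norm_eq_abs,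
      Real.norm_of_nonneg (Real.sqrt_nonneg c)]
    by_cases hn : u n = 0
    · simp [hn]
    · exact mul_le_mul_of_nonneg_right (Real.abs_le_sqrt (h n hn)) (norm_nonneg _)
  have h2 := pow_le_pow_left₀ (norm_nonneg _) h1 2
  rwa [norm_smul, mul_pow, Complex.norm_real, Real.norm_of_nonneg (Real.sqrt_nonneg c),
    Real.sq_sqrt hc] at h2

theorem isCompactOperator_of_mapsTo_finiteDimensional {H : Type*} [NormedAddCommGroup H]
    [NormedSpace ℂ H] (T : H →L[ℂ] H) (X : Submodule ℂ H) [FiniteDimensional ℂ X]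
    (h : ∀ u, T u ∈ X) : IsCompactOperator T := by
  have h1 : IsCompactOperator (T.codRestrict X h) := by
    have : ProperSpace X := FiniteDimensional.proper ℂ X
    refine ⟨Metric.closedBall 0 1, isCompact_closedBall 0 1, ?_⟩
    refine (T.codRestrict X h).continuous.continuousAt.preimage_mem_nhds ?_
    rw [map_zero]
    exact Metric.closedBall_mem_nhds 0 one_pos
  exact h1.clm_comp X.subtypeL

/-- Multiplication by a function that tends to zero at infinity is a compact operator. -/
theorem isCompactOperator_mulOp (g : Zd d → ℝ) (hg : IsBoundedFun g)
    (h0 : Tendsto g cofinite (𝓝 0)) : IsCompactOperator (mulOp g hg) := by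
  classical
  have hb : ∀ F : Finset (Zd d), IsBoundedFun fun n => if n ∈ F then g n else 0 := fun F => by
    obtain ⟨C, hC⟩ := hg
    refine ⟨C, fun n => ?_⟩
    change |if n ∈ F then g n else 0| ≤ C
    split_ifs
    · exact hC n
    · rw [abs_zero]
      exact (abs_nonneg _).trans (hC n)
  -- Truncations to finite sets have finite rank and converge in norm, because `g` is uniformly
  -- small off a large finite set.
  refine isCompactOperator_of_tendsto (l := atTop) (F := fun F => mulOp _ (hb F)) ?_
    (Eventually.of_forall fun F => isCompactOperator_of_mapsTo_finiteDimensional _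
      (supportedOn F) fun u n hn => by rw [mulOp_apply, if_neg hn, Complex.ofReal_zero, zero_mul])
  rw [Metric.tendsto_atTop]
  intro ε hε
  have hfin : {n | ¬ |g n| < ε / 2}.Finite := by
    have h1 : ∀ᶠ n in cofinite, |g n| < ε / 2 := by
      filter_upwards [h0 (Metric.ball_mem_nhds 0 (half_pos hε))] with n hn
      rwa [Set.mem_preimage, mem_ball_zero_iff, Real.norm_eq_abs] at hn
    exact h1
  refine ⟨hfin.toFinset, fun F hF => ?_⟩
  rw [dist_eq_norm]
  refine (ContinuousLinearMap.opNorm_le_bound _ (half_pos hε).le fun u => ?_).trans_lt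
    (half_lt_self hε)
  have hd : (mulOp (fun n => if n ∈ F then g n else 0) (hb F) - mulOp g hg) u
      = mulOp (fun n => (if n ∈ F then g n else 0) - g n) (by
        obtain ⟨C, hC⟩ := hb F
        obtain ⟨C', hC'⟩ := hg
        exact ⟨C + C', fun n => (abs_sub _ _).trans (add_le_add (hC n) (hC' n))⟩) u := by
    ext n
    change ((ite (n ∈ F) (g n) 0 : ℝ) : ℂ) * u n - (g n : ℂ) * u n = _
    rw [mulOp_apply, Complex.ofReal_sub, sub_mul]
  rw [hd]
  refine abs_le_of_sq_le_sq' ?_ (by positivity) |>.2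
  rw [mul_pow]
  refine norm_mulOp_sq_le _ _ (by positivity) u fun n _ => ?_
  split_ifs with hn
  · rw [sub_self, zero_pow two_ne_zero]
    positivity
  · have h1 : |g n| < ε / 2 := by
      by_contra hcon
      exact hn (hF (hfin.mem_toFinset.2 hcon))
    rw [zero_sub, neg_sq, ← sq_abs]
    exact pow_le_pow_left₀ (abs_nonneg _) h1.le 2

/-- `R` is the inverse of `-Δ + f - E`. -/
structure IsResolventAt (f : Zd d → ℝ) (hf : IsBoundedFun f) (E : ℝ) (R : L2 d →L[ℂ] L2 d) :
    Prop where
  left_inv : ∀ u, R (schrodinger f hf u - (E : ℂ) • u) = u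
  right_inv : ∀ u, schrodinger f hf (R u) - (E : ℂ) • R u = u

theorem exists_isResolventAt (f : Zd d → ℝ) (hf : IsBoundedFun f) {E : ℝ}
    (hE : (E : ℂ) ∉ spectrum ℂ (schrodinger f hf)) : ∃ R, IsResolventAt f hf E R := by
  rw [spectrum.notMem_iff] at hE
  obtain ⟨U, hU⟩ := hE
  have hUv : ∀ u, (U : L2 d →L[ℂ] L2 d) u = (E : ℂ) • u - schrodinger f hf u := fun u => by
    rw [hU, sub_apply, Algebra.algebraMap_eq_smul_one]
    rfl
  -- The spectrum is defined through `E - A`, whence the sign.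
  refine ⟨-((U⁻¹ : (L2 d →L[ℂ] L2 d)ˣ) : L2 d →L[ℂ] L2 d), fun u => ?_, fun u => ?_⟩
  · have h := congrArg (fun T : L2 d →L[ℂ] L2 d => T u) U.inv_mul
    change (U⁻¹ : (L2 d →L[ℂ] L2 d)ˣ).val ((U : L2 d →L[ℂ] L2 d) u) = u at h
    rw [neg_apply, ← map_neg, neg_sub, ← hUv, h]
  · have h := congrArg (fun T : L2 d →L[ℂ] L2 d => T u) U.mul_inv
    change (U : L2 d →L[ℂ] L2 d) ((U⁻¹ : (L2 d →L[ℂ] L2 d)ˣ).val u) = u at h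
    rw [hUv] at h
    rw [neg_apply, map_neg, smul_neg, sub_neg_eq_add, neg_add_eq_sub, h]

theorem schrodinger_sub_isSymmetric (f : Zd d → ℝ) (hf : IsBoundedFun f) (E : ℝ) :
    (schrodinger f hf - (E : ℂ) • ContinuousLinearMap.id ℂ (L2 d)).toLinearMap.IsSymmetric := by
  intro u w
  have h1 : inner ℂ (schrodinger f hf u) w = inner ℂ u (schrodinger f hf w) :=
    schrodinger_isSymmetric f hf u w
  change inner ℂ (schrodinger f hf u - (E : ℂ) • u) w = inner ℂ u (schrodinger f hf w - (E : ℂ) • w)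
  rw [inner_sub_left, inner_sub_right, h1, inner_smul_left, inner_smul_right, Complex.conj_ofReal]

theorem re_inner_schrodinger_sub (f : Zd d → ℝ) (hf : IsBoundedFun f) (E : ℝ) (u : L2 d) :
    (inner ℂ ((schrodinger f hf - (E : ℂ) • ContinuousLinearMap.id ℂ (L2 d)) u) u).re
      = schrodingerForm f hf E u := by
  have h : (inner ℂ u u).re = ‖u‖ ^ 2 := inner_self_eq_norm_sq (𝕜 := ℂ) u
  change (inner ℂ (schrodinger f hf u - (E : ℂ) • u) u).re = _
  rw [inner_sub_left, inner_smul_left, Complex.conj_ofReal, Complex.sub_re, Complex.re_ofReal_mul,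
    h]
  rfl

namespace IsResolventAt

variable {f : Zd d → ℝ} {hf : IsBoundedFun f} {E : ℝ} {R : L2 d →L[ℂ] L2 d}

theorem isSymmetric (hR : IsResolventAt f hf E R) : R.toLinearMap.IsSymmetric := by
  intro u w
  have h := schrodinger_sub_isSymmetric f hf E (R u) (R w)
  change inner ℂ (schrodinger f hf (R u) - (E : ℂ) • R u) (R w)
    = inner ℂ (R u) (schrodinger f hf (R w) - (E : ℂ) • R w) at h
  rw [hR.right_inv, hR.right_inv] at h
  exact h.symm

/-- By Cauchy–Schwarz the subtracted term is at most `‖R‖ * ‖s w‖ ^ 2`. This is why no eigenvalue is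
counted where the perturbation is small compared with the distance to the spectrum. -/
theorem bsForm_nonneg {s : L2 d →L[ℂ] L2 d} {w : L2 d} {c : ℝ} (hc : c * ‖R‖ ≤ 1)
    (h : ‖s w‖ ^ 2 ≤ c * ‖w‖ ^ 2) : 0 ≤ bsForm R s w := by
  have h1 : (inner ℂ (R (s w)) (s w)).re ≤ ‖R (s w)‖ * ‖s w‖ := re_inner_le_norm (𝕜 := ℂ) _ _
  have h2 : ‖R (s w)‖ * ‖s w‖ ≤ ‖R‖ * ‖s w‖ * ‖s w‖ := by
    gcongr
    exact R.le_opNorm _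
  have h3 : ‖R‖ * ‖s w‖ ^ 2 ≤ ‖R‖ * (c * ‖w‖ ^ 2) := by gcongr
  have h4 : c * ‖R‖ * ‖w‖ ^ 2 ≤ 1 * ‖w‖ ^ 2 := by gcongr
  unfold bsForm
  nlinarith

/-- Few eigenvalues of a finite section lie in a gap. -/
theorem sectionCount_add_le (hR : IsResolventAt f hf E R) {S S₀ : Finset (Zd d)} (hS : S₀ ⊆ S)
    (hadj : ∀ n ∈ S₀, ∀ v ∈ unitVectors d, n + v ∈ S) {τ : ℝ} (hτ : 0 ≤ τ) (hτR : τ * ‖R‖ ≤ 1) :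
    sectionCount f S (E + τ) + 2 * S₀.card ≤ sectionCount f S E + 2 * S.card := by
  obtain ⟨L, hL, hLfin, hLneg⟩ := exists_neg_submodule f hf S (E + τ)
  obtain ⟨P, hP, hPfin, hPn⟩ := exists_nonneg_submodule f hf S E
  set B := schrodinger f hf - (E : ℂ) • ContinuousLinearMap.id ℂ (L2 d)
  let s : L2 d →L[ℂ] L2 d := ((√τ : ℝ) : ℂ) • ContinuousLinearMap.id ℂ (L2 d)
  have hs : s.toLinearMap.IsSymmetric := fun u w => by
    change inner ℂ (((√τ : ℝ) : ℂ) • u) w = inner ℂ u (((√τ : ℝ) : ℂ) • w)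
    rw [inner_smul_left, inner_smul_right, Complex.conj_ofReal]
  have hsn : ∀ w, ‖s w‖ ^ 2 = τ * ‖w‖ ^ 2 := fun w => by
    change ‖((√τ : ℝ) : ℂ) • w‖ ^ 2 = _
    rw [norm_smul, mul_pow, Complex.norm_real, Real.norm_of_nonneg (Real.sqrt_nonneg τ),
      Real.sq_sqrt hτ]
  -- With `s = √τ` a scalar, `B - s²` is the operator at energy `E + τ`, and `bsForm` is nonnegative
  -- everywhere, so `LK` can be zero.
  have h := finrank_add_finrank_le_of_nonneg (B := B) (R := R) (s := s) (X := supportedOn S)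
    (W := supportedOn S₀) (L := L) (P := P) (LK := ⊥) (schrodinger_sub_isSymmetric f hf E) hs
    hR.left_inv hR.right_inv (supportedOn_mono hS)
    (fun u hu n hn => by
      change schrodinger f hf u n - (E : ℂ) * u n = 0
      rw [schrodinger_apply_eq_zero f hf hu (fun h => hn (hS h)) fun v hv h => hn ?_,
        hu n fun h => hn (hS h), mul_zero, sub_zero]
      have := hadj _ h _ (neg_mem_unitVectors hv)
      rwa [add_neg_cancel_right] at this)
    (fun u hu => Submodule.smul_mem _ _ hu) hL hP
    (fun u hu hu0 => by
      have := hLneg u hu hu0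
      rw [re_inner_schrodinger_sub, hsn]
      unfold schrodingerForm at this ⊢
      linarith)
    (fun u hu => by
      rw [re_inner_schrodinger_sub]
      exact hPn u hu)
    (fun w _ => bsForm_nonneg hτR (hsn w).le)
  rw [finrank_bot, finrank_supportedOn, finrank_supportedOn] at h
  omega

/-- The number of crossings is the change of the eigenvalue count of a large finite section, up to
twice the number of points near its boundary. -/
theorem exists_crossingNumber_eq (hR : IsResolventAt f hf E R) {V : Zd d → ℝ} (hV : ∀ n, 0 ≤ V n)
    (hVb : IsBoundedFun V) (hV0 : Tendsto V cofinite (𝓝 0)) {α : ℝ} (hα : 0 < α)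
    (hfV : IsBoundedFun fun n => f n - α * V n) {S S₀ : Finset (Zd d)} (hS : S₀ ⊆ S)
    (hadj : ∀ n ∈ S₀, ∀ v ∈ unitVectors d, n + v ∈ S) {c : ℝ} (hcR : c * ‖R‖ ≤ 1)
    (hc0 : 0 ≤ c) (hc : ∀ n, n ∉ S → α * V n ≤ c) :
    ∃ N : ℕ, crossingNumber (schrodinger f hf) (mulOp V hVb) E α = N ∧
      N + sectionCount f S E + 2 * S₀.card
        ≤ sectionCount (fun n => f n - α * V n) S E + 2 * S.card ∧
      sectionCount (fun n => f n - α * V n) S E + 2 * S₀.card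
        ≤ N + sectionCount f S E + 2 * S.card := by
  obtain ⟨L, hL, hLfin, hLneg⟩ := exists_neg_submodule (fun n => f n - α * V n) hfV S E
  obtain ⟨L1, hL1, hL1fin, hL1neg⟩ := exists_neg_submodule f hf S E
  obtain ⟨P, hP, hPfin, hPn⟩ := exists_nonneg_submodule f hf S E
  set B := schrodinger f hf - (E : ℂ) • ContinuousLinearMap.id ℂ (L2 d)
  have hrb : IsBoundedFun fun n => √(V n) := by
    obtain ⟨C, hC⟩ := hVb
    exact ⟨√C, fun n => by
      rw [abs_of_nonneg (Real.sqrt_nonneg _)]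
      exact Real.sqrt_le_sqrt ((le_abs_self _).trans (hC n))⟩
  let r : L2 d →L[ℂ] L2 d := mulOp (fun n => √(V n)) hrb
  have hr : r.toLinearMap.IsSymmetric := mulOp_isSymmetric _ _
  have hrr : r ∘L r = mulOp V hVb := by
    ext u n
    change ((√(V n) : ℝ) : ℂ) * (((√(V n) : ℝ) : ℂ) * u n) = (V n : ℂ) * u n
    rw [← mul_assoc, ← Complex.ofReal_mul, Real.mul_self_sqrt (hV n)]
  have hrc : IsCompactOperator r := isCompactOperator_mulOp _ _ (by
    have := (Real.continuous_sqrt.tendsto 0).comp hV0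
    rwa [Real.sqrt_zero] at this)
  let s : L2 d →L[ℂ] L2 d := ((√α : ℝ) : ℂ) • r
  have hs : s.toLinearMap.IsSymmetric := fun u w => by
    have h1 : inner ℂ (r u) w = inner ℂ u (r w) := hr u w
    change inner ℂ (((√α : ℝ) : ℂ) • r u) w = inner ℂ u (((√α : ℝ) : ℂ) • r w)
    rw [inner_smul_left, inner_smul_right, Complex.conj_ofReal, h1]
  have hsn : ∀ w, ‖s w‖ ^ 2 = α * ‖r w‖ ^ 2 := fun w => by
    change ‖((√α : ℝ) : ℂ) • r w‖ ^ 2 = _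
    rw [norm_smul, mul_pow, Complex.norm_real, Real.norm_of_nonneg (Real.sqrt_nonneg α),
      Real.sq_sqrt hα.le]
  have hsX : ∀ u ∈ supportedOn S, s u ∈ supportedOn S := fun u hu n hn => by
    change ((√α : ℝ) : ℂ) * (((√(V n) : ℝ) : ℂ) * u n) = 0
    rw [hu n hn, mul_zero, mul_zero]
  have hform : ∀ u ∈ supportedOn S, (inner ℂ (B u) u).re - ‖s u‖ ^ 2
      = schrodingerForm (fun n => f n - α * V n) hfV E u := fun u hu => by
    have h0 : IsBoundedFun (0 : Zd d → ℝ) := ⟨0, by simp⟩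
    have h1 : ‖r u‖ ^ 2 = ∑ n ∈ S, V n * ‖u n‖ ^ 2 := by
      have h2 : (inner ℂ (r u) (r u)).re = ‖r u‖ ^ 2 := inner_self_eq_norm_sq (𝕜 := ℂ) (r u)
      have h3 : inner ℂ (r (r u)) u = inner ℂ (r u) (r u) := hr (r u) u
      rw [← h2, ← h3, ← re_inner_mulOp_of_mem V hVb hu, ← hrr]
      rfl
    rw [re_inner_schrodinger_sub, hsn, h1, schrodingerForm_eq_of_mem f hf h0 E hu,
      schrodingerForm_eq_of_mem _ hfV h0 E hu, Finset.mul_sum, add_sub_assoc,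
      ← Finset.sum_sub_distrib]
    congr 1
    exact Finset.sum_congr rfl fun n _ => by ring
  have hBW : ∀ u ∈ supportedOn S₀, B u ∈ supportedOn S := fun u hu n hn => by
    change schrodinger f hf u n - (E : ℂ) * u n = 0
    rw [schrodinger_apply_eq_zero f hf hu (fun h => hn (hS h)) fun v hv h => hn ?_,
      hu n fun h => hn (hS h), mul_zero, sub_zero]
    have := hadj _ h _ (neg_mem_unitVectors hv)
    rwa [add_neg_cancel_right] at this
  -- A vector orthogonal to `supportedOn S` lives off `S`, where `α * V n ≤ c`.
  have hX : ∀ w ∈ (supportedOn S)ᗮ, 0 ≤ bsForm R s w := fun w hw => by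
    refine bsForm_nonneg hcR ?_
    rw [hsn]
    have h1 := norm_mulOp_sq_le (fun n => √(V n)) hrb (c := c / α) (by positivity) w
      fun n hn => by
        rw [Real.sq_sqrt (hV n), le_div_iff₀ hα, mul_comm]
        exact hc n fun hnS => hn (apply_eq_zero_of_mem_orthogonal hw hnS)
    calc α * ‖r w‖ ^ 2 ≤ α * (c / α * ‖w‖ ^ 2) := by gcongr
      _ = c * ‖w‖ ^ 2 := by field_simp
  obtain ⟨LK, hLKfin, hcount, hLKneg, hLKn⟩ := exists_submodule_crossings (A := schrodinger f hf)
    (E := E) hα hR.isSymmetric hr hR.left_inv hR.right_inv hrc hX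
  refine ⟨Module.finrank ℂ LK, ?_, ?_, ?_⟩
  · rw [← hcount, hrr]
    rfl
  · have h := finrank_add_finrank_le_of_negative (B := B) (R := R) (s := s) (X := supportedOn S)
      (W := supportedOn S₀) (L := L1) (LK := LK) (schrodinger_sub_isSymmetric f hf E) hs
      hR.left_inv hR.right_inv (supportedOn_mono hS) hBW hsX hX hL1
      (fun u hu hu0 => by
        rw [re_inner_schrodinger_sub]
        exact hL1neg u hu hu0) hLKneg
      (k := sectionCount (fun n => f n - α * V n) S E)
      (fun M hM hMn => finrank_le_sectionCount _ hfV hM fun u hu hu0 => by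
        rw [← hform u (hM hu)]
        exact hMn u hu hu0)
    rw [finrank_supportedOn, finrank_supportedOn] at h
    omega
  · have h := finrank_add_finrank_le_of_nonneg (B := B) (R := R) (s := s) (X := supportedOn S)
      (W := supportedOn S₀) (L := L) (P := P) (LK := LK) (schrodinger_sub_isSymmetric f hf E) hs
      hR.left_inv hR.right_inv (supportedOn_mono hS) hBW hsX hL hP
      (fun u hu hu0 => by
        rw [hform u (hL hu)]
        exact hLneg u hu hu0)
      (fun u hu => by
        rw [re_inner_schrodinger_sub]
        exact hPn u hu) hLKn
    rw [finrank_supportedOn, finrank_supportedOn] at h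
    omega

/-- Resolvents at nearby real points of the resolvent set are bounded. -/
theorem norm_le_of_abs_sub_le (hR : IsResolventAt f hf E R) {E' κ : ℝ} {R' : L2 d →L[ℂ] L2 d}
    (hR' : IsResolventAt f hf E' R') (hκ : 0 ≤ κ) (hκR : κ * ‖R‖ ≤ 1 / 2) (h : |E - E'| ≤ κ) :
    κ * ‖R'‖ ≤ 1 := by
  have h1 : ∀ w, ‖R' w‖ ≤ (2 * ‖R‖) * ‖w‖ := fun w => by
    -- The first resolvent identity. Since `κ * ‖R‖ ≤ 1 / 2`, the term with `R' w` on the right can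
    -- be absorbed, which gives `‖R'‖ ≤ 2 * ‖R‖`.
    have h2 : R' w = R (w - ((E - E' : ℝ) : ℂ) • R' w) := by
      have h3 := hR.left_inv (R' w)
      have h4 := hR'.right_inv w
      rw [sub_eq_iff_eq_add] at h4
      rw [h4] at h3
      rw [Complex.ofReal_sub, sub_smul, sub_sub_eq_add_sub, h3]
    have h5 : ‖R' w‖ ≤ ‖R‖ * (‖w‖ + κ * ‖R' w‖) := by
      conv_lhs => rw [h2]
      refine (R.le_opNorm _).trans (mul_le_mul_of_nonneg_left ?_ (norm_nonneg _))
      refine (norm_sub_le _ _).trans (add_le_add_right ?_ _)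
      rw [norm_smul, Complex.norm_real, Real.norm_eq_abs]
      exact mul_le_mul_of_nonneg_right h (norm_nonneg _)
    have h6 := mul_le_mul_of_nonneg_right hκR (norm_nonneg (R' w))
    nlinarith
  have h7 := R'.opNorm_le_bound (by positivity) h1
  nlinarith

end IsResolventAt

end Comparison

/-! ### Boxes and their lattice points. -/

section Boxes

variable {d : ℕ}

/-- An open box in Euclidean space. -/
def openBox (l u : Fin d → ℝ) : Set (EuclideanSpace ℝ (Fin d)) :=
  {x | ∀ i, l i < x i ∧ x i < u i}

theorem openBox_eq_preimage (l u : Fin d → ℝ) :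
    openBox l u = (MeasurableEquiv.toLp 2 (Fin d → ℝ)).symm ⁻¹'
      (Set.univ.pi fun i => Set.Ioo (l i) (u i)) := by
  ext x
  simp [openBox]

theorem isOpen_openBox (l u : Fin d → ℝ) : IsOpen (openBox l u) := by
  have : openBox l u = ⋂ i, {x | l i < x i ∧ x i < u i} := by
    ext x
    simp [openBox]
  rw [this]
  refine isOpen_iInter_of_finite fun i => ?_
  have h : Continuous fun x : EuclideanSpace ℝ (Fin d) => x i := by fun_prop
  exact (isOpen_lt continuous_const h).inter (isOpen_lt h continuous_const)

theorem convex_openBox (l u : Fin d → ℝ) : Convex ℝ (openBox l u) := by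
  have : openBox l u = (WithLp.linearEquiv 2 ℝ (Fin d → ℝ)).toLinearMap ⁻¹'
      (Set.univ.pi fun i => Set.Ioo (l i) (u i)) := by
    ext x
    simp [openBox]
  rw [this]
  exact (convex_pi fun i _ => convex_Ioo (l i) (u i)).linear_preimage _

theorem volume_openBox {l u : Fin d → ℝ} (h : ∀ i, l i ≤ u i) :
    volume (openBox l u) = ENNReal.ofReal (∏ i, (u i - l i)) := by
  rw [openBox_eq_preimage,
    (EuclideanSpace.volume_preserving_symm_measurableEquiv_toLp (Fin d)).measure_preimage_equiv,
    Real.volume_pi_Ioo, ENNReal.ofReal_prod_of_nonneg fun i _ => sub_nonneg.2 (h i)]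

theorem norm_le_of_forall_abs_le {x : EuclideanSpace ℝ (Fin d)} {c : ℝ} (hc : 0 ≤ c)
    (h : ∀ i, |x i| ≤ c) : ‖x‖ ≤ d * c := by
  rw [EuclideanSpace.norm_eq]
  refine Real.sqrt_le_iff.2 ⟨by positivity, ?_⟩
  have h1 : ∀ i ∈ Finset.univ, ‖x i‖ ^ 2 ≤ c ^ 2 := fun i _ => by
    rw [Real.norm_eq_abs]
    exact pow_le_pow_left₀ (abs_nonneg _) (h i) 2
  refine (Finset.sum_le_card_nsmul _ _ _ h1).trans ?_
  rw [Finset.card_univ, Fintype.card_fin, nsmul_eq_mul, mul_pow]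
  refine mul_le_mul_of_nonneg_right ?_ (by positivity)
  have : (d : ℝ) ≤ (d : ℝ) * d := by exact_mod_cast Nat.le_mul_self d
  nlinarith

theorem isBounded_openBox (l u : Fin d → ℝ) : Bornology.IsBounded (openBox l u) := by
  refine (isBounded_iff_forall_norm_le).2 ⟨d * ∑ i, (|l i| + |u i|), fun x hx => ?_⟩
  refine norm_le_of_forall_abs_le (by positivity) fun i => ?_
  refine le_trans ?_ (Finset.single_le_sum (f := fun i => |l i| + |u i|)
    (fun i _ => by positivity) (Finset.mem_univ i))
  have := hx i
  rw [abs_le]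
  exact ⟨by linarith [neg_abs_le (l i), abs_nonneg (u i)],
    by linarith [le_abs_self (u i), abs_nonneg (l i)]⟩

/-- The lattice points in an open box. -/
def latBox (l u : Fin d → ℝ) : Finset (Zd d) :=
  Fintype.piFinset fun i => Finset.Ioo ⌊l i⌋ ⌈u i⌉

theorem mem_latBox {l u : Fin d → ℝ} {n : Zd d} :
    n ∈ latBox l u ↔ ∀ i, l i < n i ∧ (n i : ℝ) < u i := by
  simp [latBox, Int.floor_lt, Int.lt_ceil]

theorem latBox_mono {l u l' u' : Fin d → ℝ} (hl : ∀ i, l' i ≤ l i) (hu : ∀ i, u i ≤ u' i) :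
    latBox l u ⊆ latBox l' u' := fun n hn => by
  rw [mem_latBox] at hn ⊢
  exact fun i => ⟨(hl i).trans_lt (hn i).1, (hn i).2.trans_le (hu i)⟩

open scoped Pointwise in
theorem latticePoints_smul_openBox {l u : Fin d → ℝ} {β : ℝ} (hβ : 0 < β)
    (h : Bornology.IsBounded (β • openBox l u)) :
    latticePoints (β • openBox l u) h = latBox (fun i => β * l i) (fun i => β * u i) := by
  ext n
  rw [latticePoints, Set.Finite.mem_toFinset, Set.mem_ofPred_eq,
    Set.mem_smul_set_iff_inv_smul_mem₀ hβ.ne', mem_latBox]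
  refine forall_congr' fun i => ?_
  change l i < β⁻¹ * (n i : ℝ) ∧ β⁻¹ * (n i : ℝ) < u i ↔ _
  rw [lt_inv_mul_iff₀ hβ, inv_mul_lt_iff₀ hβ]

/-- A margin of fixed width `c` does not affect the leading order; with `c = 1` this shows that
boundary layers are negligible. -/
theorem tendsto_card_Ioo_div {a b : ℝ} (hab : a < b) (c : ℝ) :
    Tendsto (fun β : ℝ => ((Finset.Ioo ⌊β * a + c⌋ ⌈β * b - c⌉).card : ℝ) / β) atTop
      (𝓝 (b - a)) := by
  have hlim : ∀ K : ℝ, Tendsto (fun β : ℝ => (b - a) + K / β) atTop (𝓝 (b - a)) := fun K => by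
    simpa using tendsto_const_nhds.add (tendsto_const_nhds.div_atTop (a := K) tendsto_id)
  refine tendsto_of_tendsto_of_tendsto_of_le_of_le' (hlim (-(2 * c) - 1)) (hlim (-(2 * c) + 1))
    ?_ ?_
  -- For `β * (b - a) ≥ 2 * c + 1` the natural-number cardinality of the interval involves no
  -- truncation.
  all_goals
    filter_upwards [eventually_gt_atTop 0, (tendsto_id.atTop_mul_const
      (sub_pos.2 hab)).eventually_ge_atTop (2 * c + 1)] with β hβ hβ2
    have h1 := Int.floor_le (β * a + c)
    have h2 := Int.lt_floor_add_one (β * a + c)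
    have h3 := Int.le_ceil (β * b - c)
    have h4 := Int.ceil_lt_add_one (β * b - c)
    simp only [id] at hβ2
    have h5 : (0 : ℤ) ≤ ⌈β * b - c⌉ - ⌊β * a + c⌋ - 1 := by
      have : (0 : ℝ) ≤ ⌈β * b - c⌉ - ⌊β * a + c⌋ - 1 := by nlinarith
      exact_mod_cast this
    have h6 : ((Finset.Ioo ⌊β * a + c⌋ ⌈β * b - c⌉).card : ℝ)
        = ⌈β * b - c⌉ - ⌊β * a + c⌋ - 1 := by
      rw [Int.card_Ioo]
      have := Int.toNat_of_nonneg h5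
      exact_mod_cast this
    rw [h6]
    first
      | rw [le_div_iff₀ hβ, add_mul, div_mul_cancel₀ _ hβ.ne']
        linarith
      | rw [div_le_iff₀ hβ, add_mul, div_mul_cancel₀ _ hβ.ne']
        linarith

theorem tendsto_card_latBox_div {l u : Fin d → ℝ} (h : ∀ i, l i < u i) (c : ℝ) :
    Tendsto (fun β : ℝ => ((latBox (fun i => β * l i + c) (fun i => β * u i - c)).card : ℝ)
      / β ^ d) atTop (𝓝 (∏ i, (u i - l i))) := by
  have h1 := tendsto_finsetProd (Finset.univ : Finset (Fin d)) fun i _ =>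
    tendsto_card_Ioo_div (h i) c
  refine h1.congr fun β => ?_
  rw [Finset.prod_div_distrib, Finset.prod_const, Finset.card_univ, Fintype.card_fin, latBox,
    Fintype.card_piFinset, Nat.cast_prod]

theorem tendsto_card_latBox_div_zero {l u : Fin d → ℝ} (h : ∀ i, l i < u i) :
    Tendsto (fun β : ℝ => ((latBox (fun i => β * l i) (fun i => β * u i)).card : ℝ)
      / β ^ d) atTop (𝓝 (∏ i, (u i - l i))) := by
  simpa using tendsto_card_latBox_div h 0

theorem abs_apply_le_one_of_mem_unitVectors {v : Zd d} (hv : v ∈ unitVectors d) (i : Fin d) :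
    |(v i : ℝ)| ≤ 1 := by
  rw [mem_unitVectors] at hv
  have := PiLp.norm_apply_le (pt v) i
  rwa [hv, Real.norm_eq_abs] at this

/-- Neighbours of points at distance more than one from the boundary stay in the box. -/
theorem add_mem_latBox {l u : Fin d → ℝ} {n v : Zd d}
    (hn : n ∈ latBox (fun i => l i + 1) (fun i => u i - 1)) (hv : v ∈ unitVectors d) :
    n + v ∈ latBox l u := by
  rw [mem_latBox] at hn ⊢
  intro i
  have h1 := hn i
  have h2 := abs_le.1 (abs_apply_le_one_of_mem_unitVectors hv i)
  simp only [Pi.add_apply, Int.cast_add]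
  exact ⟨by linarith, by linarith⟩

end Boxes

/-! ### Bounds, monotonicity and local constancy of the density of states. -/

section DensityOfStates

variable {d : ℕ} {f : Zd d → ℝ} {ρ : ℝ → ℝ}

namespace HasDensityOfStates

theorem tendsto_sectionCount (hρ : HasDensityOfStates f ρ) {l u : Fin d → ℝ}
    (h : ∀ i, l i < u i) (E : ℝ) :
    Tendsto (fun β : ℝ => (sectionCount f (latBox (fun i => β * l i) (fun i => β * u i)) E : ℝ)
      / β ^ d) atTop (𝓝 ((∏ i, (u i - l i)) * ρ E)) := by
  have hpos : 0 < ∏ i, (u i - l i) := Finset.prod_pos fun i _ => sub_pos.2 (h i)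
  have hne : (openBox l u).Nonempty :=
    ⟨WithLp.toLp 2 fun i => (l i + u i) / 2, fun i => by
      have := h i
      exact ⟨by simp only; linarith, by simp only; linarith⟩⟩
  have h1 := hρ (openBox l u) (isBounded_openBox l u) (isOpen_openBox l u)
    ((convex_openBox l u).isConnected hne) ((convex_openBox l u).addHaar_frontier volume) E
  have h2 := h1.const_mul (∏ i, (u i - l i))
  refine h2.congr' ?_
  filter_upwards [eventually_gt_atTop 0] with β hβ
  rw [eigenvalueCount_eq_sectionCount, latticePoints_smul_openBox hβ,
    volume_openBox fun i => (h i).le, ENNReal.toReal_ofReal hpos.le]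
  field_simp

theorem tendsto_sectionCount_unit (hρ : HasDensityOfStates f ρ) (E : ℝ) :
    Tendsto (fun β : ℝ => (sectionCount f (latBox (fun _ => β * 0) (fun _ => β * 1)) E : ℝ)
      / β ^ d) atTop (𝓝 (ρ E)) := by
  simpa using hρ.tendsto_sectionCount (l := fun _ => 0) (u := fun _ => 1) (fun _ => one_pos) E

theorem nonneg (hρ : HasDensityOfStates f ρ) (E : ℝ) : 0 ≤ ρ E := by
  refine ge_of_tendsto (hρ.tendsto_sectionCount_unit E) ?_
  filter_upwards [eventually_gt_atTop 0] with β hβ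
  positivity

theorem le_one (hρ : HasDensityOfStates f ρ) (E : ℝ) : ρ E ≤ 1 := by
  have h := tendsto_card_latBox_div_zero (d := d) (l := fun _ => 0) (u := fun _ => 1)
    fun _ => one_pos
  simp only [sub_zero, Finset.prod_const_one] at h
  refine le_of_tendsto_of_tendsto (hρ.tendsto_sectionCount_unit E) h ?_
  filter_upwards [eventually_gt_atTop 0] with β hβ
  gcongr
  exact sectionCount_le_card _ _ _

theorem monotone (hρ : HasDensityOfStates f ρ) (hf : IsBoundedFun f) : Monotone ρ := by
  intro E E' hE
  refine le_of_tendsto_of_tendsto (hρ.tendsto_sectionCount_unit E)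
    (hρ.tendsto_sectionCount_unit E') ?_
  filter_upwards [eventually_gt_atTop 0] with β hβ
  gcongr
  exact sectionCount_mono f f hf hf fun n _ => by linarith

/-- Finite sections can have eigenvalues in a gap, but no more than twice the number of boundary
sites, which is o(β^d). -/
theorem le_of_isResolventAt (hρ : HasDensityOfStates f ρ) {hf : IsBoundedFun f} {E τ : ℝ}
    {R : L2 d →L[ℂ] L2 d} (hR : IsResolventAt f hf E R) (hτ : 0 ≤ τ) (hτR : τ * ‖R‖ ≤ 1) :
    ρ (E + τ) ≤ ρ E := by
  have hz : ∀ _ : Fin d, (0 : ℝ) < 1 := fun _ => one_pos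
  have h1 := tendsto_card_latBox_div (d := d) (l := fun _ => 0) (u := fun _ => 1) hz 1
  have h2 := tendsto_card_latBox_div_zero (d := d) (l := fun _ => 0) (u := fun _ => 1) hz
  have h3 := (hρ.tendsto_sectionCount_unit (E + τ)).add (h1.const_mul 2)
  have h4 := (hρ.tendsto_sectionCount_unit E).add (h2.const_mul 2)
  have h5 := le_of_tendsto_of_tendsto h3 h4 (by
    filter_upwards [eventually_gt_atTop 0] with β hβ
    rw [← mul_div_assoc, ← mul_div_assoc, ← add_div, ← add_div]
    refine div_le_div_of_nonneg_right ?_ (by positivity)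
    exact_mod_cast hR.sectionCount_add_le (latBox_mono (fun i => by linarith) fun i => by linarith)
      (fun n hn v hv => add_mem_latBox hn hv) hτ hτR)
  linarith

/-- The density of states is constant near a point of the resolvent set. -/
theorem eq_of_abs_sub_le (hρ : HasDensityOfStates f ρ) {hf : IsBoundedFun f} {E κ : ℝ}
    {R : L2 d →L[ℂ] L2 d} (hR : IsResolventAt f hf E R) (hκR : κ * ‖R‖ ≤ 1 / 2)
    (hκ : ∀ E', |E - E'| ≤ κ → (E' : ℂ) ∉ spectrum ℂ (schrodinger f hf)) {E' : ℝ}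
    (hE' : |E - E'| ≤ κ) : ρ E' = ρ E := by
  have hκ0 : 0 ≤ κ := (abs_nonneg _).trans hE'
  rcases le_total E E' with h | h
  · refine le_antisymm ?_ (hρ.monotone hf h)
    have h1 : E' - E ≤ κ := by
      rw [abs_sub_comm] at hE'
      exact (le_abs_self _).trans hE'
    have h2 := hρ.le_of_isResolventAt hR (sub_nonneg.2 h) (by
      have := mul_le_mul_of_nonneg_right h1 (norm_nonneg R)
      linarith)
    rwa [add_sub_cancel] at h2
  · refine le_antisymm (hρ.monotone hf h) ?_
    -- The gap estimate only looks upwards in energy, so below `E` it is started from `E'`; the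
    -- constant `1 / 2` ensures `κ * ‖R'‖ ≤ 1`.
    obtain ⟨R', hR'⟩ := exists_isResolventAt f hf (hκ E' hE')
    have h1 := hR.norm_le_of_abs_sub_le hR' hκ0 hκR hE'
    have h2 := hρ.le_of_isResolventAt hR' (sub_nonneg.2 h)
      ((mul_le_mul_of_nonneg_right ((le_abs_self _).trans hE') (norm_nonneg R')).trans h1)
    rwa [add_sub_cancel] at h2

end HasDensityOfStates

end DensityOfStates

/-! ### The homogeneous profile, its level sets, and the rescaled potential. -/

section Profile

variable {d : ℕ} {Ψ : EuclideanSpace ℝ (Fin d) → ℝ} {p : ℝ}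

/-- The homogeneous function `Ψ(θ) |x|^{-p}`. -/
def profile (Ψ : EuclideanSpace ℝ (Fin d) → ℝ) (p : ℝ) (x : EuclideanSpace ℝ (Fin d)) : ℝ :=
  Ψ (‖x‖⁻¹ • x) * ‖x‖ ^ (-p)

theorem inv_norm_smul_mem_sphere {x : EuclideanSpace ℝ (Fin d)} (hx : x ≠ 0) :
    ‖x‖⁻¹ • x ∈ Metric.sphere (0 : EuclideanSpace ℝ (Fin d)) 1 := by
  rw [mem_sphere_zero_iff_norm, norm_smul, norm_inv, norm_norm]
  exact inv_mul_cancel₀ (norm_ne_zero_iff.2 hx)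

theorem continuousOn_profile (hΨ : ContinuousOn Ψ (Metric.sphere 0 1)) :
    ContinuousOn (profile Ψ p) {0}ᶜ := by
  have hn : ∀ x ∈ ({0}ᶜ : Set (EuclideanSpace ℝ (Fin d))), ‖x‖ ≠ 0 := fun x hx =>
    norm_ne_zero_iff.2 hx
  refine ContinuousOn.mul (hΨ.comp ?_ fun x hx => inv_norm_smul_mem_sphere hx) ?_
  · exact (continuousOn_id.norm.inv₀ hn).smul continuousOn_id
  · exact continuousOn_id.norm.rpow_const fun x hx => Or.inl (hn x hx)

theorem measurable_profile (hΨ : ContinuousOn Ψ (Metric.sphere 0 1)) :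
    Measurable (profile Ψ p) :=
  measurable_of_continuousOn_compl_singleton 0 (continuousOn_profile hΨ)

theorem profile_smul {r : ℝ} (hr : 0 < r) (x : EuclideanSpace ℝ (Fin d)) :
    profile Ψ p (r • x) = r ^ (-p) * profile Ψ p x := by
  unfold profile
  rw [norm_smul, Real.norm_of_nonneg hr.le, smul_smul, mul_inv_rev, mul_assoc,
    inv_mul_cancel₀ hr.ne', mul_one, Real.mul_rpow hr.le (norm_nonneg _)]
  ring

theorem exists_abs_profile_le (hΨ : ContinuousOn Ψ (Metric.sphere 0 1)) (hp : 0 < p) :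
    ∃ C, 0 ≤ C ∧ ∀ x, |profile Ψ p x| ≤ C * ‖x‖ ^ (-p) := by
  obtain ⟨C, hC⟩ := (isCompact_sphere (0 : EuclideanSpace ℝ (Fin d)) 1).exists_bound_of_continuousOn
    hΨ
  refine ⟨|C|, abs_nonneg C, fun x => ?_⟩
  unfold profile
  by_cases hx : x = 0
  -- At the origin `0 ^ (-p)` is `0`, so the bound is trivial there.
  · rw [hx, norm_zero, Real.zero_rpow (neg_ne_zero.2 hp.ne'), mul_zero, abs_zero, mul_zero]
  · rw [abs_mul, abs_of_nonneg (Real.rpow_nonneg (norm_nonneg x) _)]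
    refine mul_le_mul_of_nonneg_right ?_ (Real.rpow_nonneg (norm_nonneg x) _)
    exact (hC _ (inv_norm_smul_mem_sphere hx)).trans (le_abs_self C)

open scoped Pointwise in
/-- Level sets of the profile are null, except possibly the one at level zero. -/
theorem volume_profile_eq (hΨ : ContinuousOn Ψ (Metric.sphere 0 1)) (hp : 0 < p) {c : ℝ}
    (hc : c ≠ 0) : volume {x | profile Ψ p x = c} = 0 := by
  by_contra hne
  have hcount : {t : ℝ | 0 < volume {x | profile Ψ p x = t}}.Countable :=
    Measure.countable_meas_level_set_pos (measurable_profile hΨ)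
  -- Dilating one level set of positive measure gives level sets of positive measure at uncountably
  -- many levels, which is impossible as the level sets are disjoint and the measure is σ-finite.
  have hsub : (fun r : ℝ => c * r ^ (-p)) '' Set.Ioi 0
      ⊆ {t : ℝ | 0 < volume {x | profile Ψ p x = t}} := by
    rintro _ ⟨r, hr, rfl⟩
    have hr0 : 0 < r := hr
    have hset : {x | profile Ψ p x = c * r ^ (-p)} = r • {x | profile Ψ p x = c} := by
      ext x
      rw [Set.mem_smul_set_iff_inv_smul_mem₀ hr0.ne', Set.mem_ofPred_eq, Set.mem_ofPred_eq,
        profile_smul (inv_pos.2 hr0), Real.inv_rpow hr0.le]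
      have : r ^ (-p) ≠ 0 := (Real.rpow_pos_of_pos hr0 _).ne'
      rw [inv_mul_eq_iff_eq_mul₀ this, mul_comm c]
    change 0 < volume {x | profile Ψ p x = c * r ^ (-p)}
    rw [hset, Measure.addHaar_smul]
    refine ENNReal.mul_pos ?_ hne
    rw [Ne, ENNReal.ofReal_eq_zero, not_le, abs_pos]
    exact pow_ne_zero _ hr0.ne'
  have hinj : Set.InjOn (fun r : ℝ => c * r ^ (-p)) (Set.Ioi 0) := by
    intro r hr r' hr' h
    have h1 : r ∈ {y : ℝ | 0 ≤ y} := (Set.mem_Ioi.1 hr).le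
    have h2 : r' ∈ {y : ℝ | 0 ≤ y} := (Set.mem_Ioi.1 hr').le
    exact Real.rpow_left_injOn (neg_ne_zero.2 hp.ne') h1 h2 (mul_left_cancel₀ hc h)
  have h1 : (Set.Ioi (0 : ℝ)).Countable := Set.countable_of_injective_of_countable_image hinj
    (hcount.mono hsub)
  exact absurd (h1.measure_zero volume) (by simp)

/-- A monotone function that is continuous at `E` is continuous at `E + Ψ(θ)|x|^{-p}` for almost
every `x`. -/
theorem ae_continuousAt_add_profile (hΨ : ContinuousOn Ψ (Metric.sphere 0 1)) (hp : 0 < p)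
    {ρ : ℝ → ℝ} (hρ : Monotone ρ) {E : ℝ} (hE : ContinuousAt ρ E) :
    ∀ᵐ x ∂(volume : Measure (EuclideanSpace ℝ (Fin d))),
      ContinuousAt ρ (E + profile Ψ p x) := by
  have hD := hρ.countable_not_continuousAt
  have h1 : ∀ᵐ x ∂(volume : Measure (EuclideanSpace ℝ (Fin d))),
      ∀ e ∈ {e | ¬ ContinuousAt ρ e}, E + profile Ψ p x ≠ e := by
    rw [ae_ball_iff hD]
    intro e he
    -- The zero level, where `Ψ` may vanish on a set of positive measure, corresponds to `e = E`,
    -- and there `ρ` is continuous.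
    have hne : e - E ≠ 0 := fun h => he (by rwa [sub_eq_zero.1 h])
    have h2 := volume_profile_eq hΨ hp hne
    rw [← compl_mem_ae_iff] at h2
    filter_upwards [h2] with x hx h
    exact hx (by rw [Set.mem_ofPred_eq, ← h]; ring)
  filter_upwards [h1] with x hx
  by_contra h
  exact hx _ h rfl

theorem tendsto_norm_pt : Tendsto (fun n : Zd d => ‖pt n‖) cofinite atTop := by
  rw [tendsto_atTop]
  intro b
  have h : {n : Zd d | pt n ∈ Metric.ball 0 b}.Finite :=
    finite_lattice_of_isBounded Metric.isBounded_ball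
  refine h.subset fun n hn => ?_
  have hn' : ¬ b ≤ ‖pt n‖ := hn
  exact mem_ball_zero_iff.2 (not_le.1 hn')

namespace HasDecay

variable {V : Zd d → ℝ}

/-- After rescaling, the potential is uniformly close to its profile away from the origin. -/
theorem eventually_abs_sub_profile_le (hV : HasDecay V Ψ p) (hp : 0 < p) {η ε : ℝ} (hη : 0 < η)
    (hε : 0 < ε) : ∀ᶠ β : ℝ in atTop, ∀ n : Zd d, β * η ≤ ‖pt n‖ →
      |β ^ p * V n - profile Ψ p (β⁻¹ • pt n)| ≤ ε := by
  have hηp : 0 < η ^ p := Real.rpow_pos_of_pos hη p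
  have hfin : {n : Zd d | ¬ |‖pt n‖ ^ p * V n - Ψ (‖pt n‖⁻¹ • pt n)| < η ^ p * ε}.Finite := by
    have h1 : ∀ᶠ n in cofinite,
        |‖pt n‖ ^ p * V n - Ψ (‖pt n‖⁻¹ • pt n)| < η ^ p * ε := by
      filter_upwards [hV (Metric.ball_mem_nhds 0 (mul_pos hηp hε))] with n hn
      rwa [Set.mem_preimage, mem_ball_zero_iff, Real.norm_eq_abs] at hn
    exact h1
  -- The finitely many exceptional sites have norm at most `M`, and `β * η > M` excludes them. The
  -- tolerance `η ^ p * ε` compensates the factor `β ^ p / ‖pt n‖ ^ p ≤ η ^ (-p)`.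
  obtain ⟨M, hM⟩ := (hfin.image fun n => ‖pt n‖).bddAbove
  filter_upwards [eventually_gt_atTop 0, eventually_gt_atTop (M / η)] with β hβ hβM n hn
  have hpos : 0 < ‖pt n‖ := (mul_pos hβ hη).trans_le hn
  have hgood : |‖pt n‖ ^ p * V n - Ψ (‖pt n‖⁻¹ • pt n)| < η ^ p * ε := by
    by_contra hcon
    have := hM ⟨n, hcon, rfl⟩
    rw [div_lt_iff₀ hη] at hβM
    simp only at this
    linarith
  have hβp : 0 < β ^ p := Real.rpow_pos_of_pos hβ p
  have hnp : 0 < ‖pt n‖ ^ p := Real.rpow_pos_of_pos hpos p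
  have h1 : β ^ p * V n - profile Ψ p (β⁻¹ • pt n)
      = β ^ p / ‖pt n‖ ^ p * (‖pt n‖ ^ p * V n - Ψ (‖pt n‖⁻¹ • pt n)) := by
    rw [profile_smul (inv_pos.2 hβ), profile, Real.rpow_neg (inv_pos.2 hβ).le,
      Real.inv_rpow hβ.le, inv_inv, Real.rpow_neg hpos.le]
    field_simp
  have h2 : β ^ p * η ^ p ≤ ‖pt n‖ ^ p := by
    rw [← Real.mul_rpow hβ.le hη.le]
    exact Real.rpow_le_rpow (by positivity) hn hp.le
  rw [h1, abs_mul, abs_of_pos (by positivity)]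
  calc β ^ p / ‖pt n‖ ^ p * |‖pt n‖ ^ p * V n - Ψ (‖pt n‖⁻¹ • pt n)|
      ≤ β ^ p / ‖pt n‖ ^ p * (η ^ p * ε) := by gcongr
    _ = (β ^ p * η ^ p) / ‖pt n‖ ^ p * ε := by ring
    _ ≤ 1 * ε := by
        gcongr
        exact div_le_one_of_le₀ h2 hnp.le
    _ = ε := one_mul ε

theorem tendsto_zero (hV : HasDecay V Ψ p) (hΨ : ContinuousOn Ψ (Metric.sphere 0 1))
    (hp : 0 < p) : Tendsto V cofinite (𝓝 0) := by
  obtain ⟨C, hC⟩ := (isCompact_sphere (0 : EuclideanSpace ℝ (Fin d)) 1).exists_bound_of_continuousOn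
    hΨ
  have h1 : Tendsto (fun n : Zd d => (C + 1) * ‖pt n‖ ^ (-p)) cofinite (𝓝 0) := by
    have := ((tendsto_rpow_neg_atTop hp).comp (tendsto_norm_pt (d := d))).const_mul (C + 1)
    rwa [mul_zero] at this
  refine squeeze_zero_norm' ?_ h1
  filter_upwards [hV (Metric.ball_mem_nhds 0 one_pos), tendsto_norm_pt.eventually_gt_atTop 0]
    with n hn hpos
  rw [Set.mem_preimage, mem_ball_zero_iff, Real.norm_eq_abs] at hn
  have h2 := hC _ (inv_norm_smul_mem_sphere (norm_pos_iff.1 hpos))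
  have hnp : 0 < ‖pt n‖ ^ p := Real.rpow_pos_of_pos hpos p
  have h3 : |‖pt n‖ ^ p * V n| ≤ C + 1 := by
    have := abs_add_le (‖pt n‖ ^ p * V n - Ψ (‖pt n‖⁻¹ • pt n)) (Ψ (‖pt n‖⁻¹ • pt n))
    rw [sub_add_cancel] at this
    rw [Real.norm_eq_abs] at h2
    linarith
  rw [abs_mul, abs_of_pos hnp] at h3
  rw [Real.rpow_neg hpos.le, ← div_eq_mul_inv, le_div_iff₀ hnp, Real.norm_eq_abs, mul_comm]
  exact h3

end HasDecay

end Profile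

/-! ### Cutting a large cube into small cubes. -/

section Cubes

variable {d : ℕ}

/-- The large cube `(-N, N)^d`. -/
def largeCube (d N : ℕ) : Set (EuclideanSpace ℝ (Fin d)) :=
  openBox (fun _ => -(N : ℝ)) (fun _ => N)

/-- The lattice points in `β • (-N, N)^d`. -/
def latLargeCube (d N : ℕ) (β : ℝ) : Finset (Zd d) :=
  latBox (fun _ => β * -(N : ℝ)) (fun _ => β * N)

/-- Lower left corners, in units of `1 / k`, of the cubes of side `1 / k` in `(-N, N)^d`. -/
def cubeIndex (d N k : ℕ) : Finset (Fin d → ℤ) :=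
  Fintype.piFinset fun _ => Finset.Ico (-(N * k : ℤ)) (N * k)

/-- The cube of side `1 / k` with lower left corner `j / k`. -/
def smallCube (k : ℕ) (j : Fin d → ℤ) : Set (EuclideanSpace ℝ (Fin d)) :=
  openBox (fun i => (j i : ℝ) / k) (fun i => ((j i : ℝ) + 1) / k)

/-- The lattice points in a dilated small cube at distance more than `c` from the boundary. -/
def latSmallCube (k : ℕ) (j : Fin d → ℤ) (c β : ℝ) : Finset (Zd d) :=
  latBox (fun i => β * ((j i : ℝ) / k) + c) (fun i => β * (((j i : ℝ) + 1) / k) - c)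

theorem mem_cubeIndex {N k : ℕ} {j : Fin d → ℤ} :
    j ∈ cubeIndex d N k ↔ ∀ i, -(N * k : ℤ) ≤ j i ∧ j i < N * k := by
  simp [cubeIndex]

theorem cube_bounds {N k : ℕ} (hk : 0 < k) {j : Fin d → ℤ} (hj : j ∈ cubeIndex d N k)
    (i : Fin d) : -(N : ℝ) ≤ (j i : ℝ) / k ∧ ((j i : ℝ) + 1) / k ≤ N := by
  have hk' : (0 : ℝ) < k := by exact_mod_cast hk
  have h := mem_cubeIndex.1 hj i
  have h1 : (-(N * k : ℤ) : ℝ) ≤ j i := by exact_mod_cast h.1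
  have h2 : (j i : ℝ) + 1 ≤ N * k := by exact_mod_cast Int.add_one_le_of_lt h.2
  push_cast at h1
  rw [le_div_iff₀ hk', div_le_iff₀ hk']
  exact ⟨by linarith, h2⟩

theorem smallCube_lt {k : ℕ} (hk : 0 < k) (j : Fin d → ℤ) (i : Fin d) :
    (j i : ℝ) / k < ((j i : ℝ) + 1) / k := by
  have hk' : (0 : ℝ) < k := by exact_mod_cast hk
  gcongr
  linarith

theorem smallCube_subset {N k : ℕ} (hk : 0 < k) {j : Fin d → ℤ} (hj : j ∈ cubeIndex d N k) :
    smallCube k j ⊆ largeCube d N := fun _ hx i =>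
  ⟨(cube_bounds hk hj i).1.trans_lt (hx i).1, (hx i).2.trans_le (cube_bounds hk hj i).2⟩

theorem prod_smallCube {k : ℕ} (j : Fin d → ℤ) :
    ∏ i, (((j i : ℝ) + 1) / k - (j i : ℝ) / k) = (1 / k : ℝ) ^ d := by
  have : ∀ i, ((j i : ℝ) + 1) / k - (j i : ℝ) / k = 1 / k := fun i => by
    rw [← sub_div, add_sub_cancel_left]
  simp [this]

theorem volume_smallCube {k : ℕ} (hk : 0 < k) (j : Fin d → ℤ) :
    volume (smallCube k j) = ENNReal.ofReal ((1 / k : ℝ) ^ d) := by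
  rw [smallCube, volume_openBox fun i => (smallCube_lt hk j i).le, prod_smallCube]

theorem prod_largeCube (N : ℕ) : ∏ _i : Fin d, ((N : ℝ) - -N) = (2 * N : ℝ) ^ d := by
  rw [Finset.prod_const, Finset.card_univ, Fintype.card_fin]
  ring

theorem volume_largeCube (N : ℕ) : volume (largeCube d N) = ENNReal.ofReal ((2 * N : ℝ) ^ d) := by
  rw [largeCube, volume_openBox fun _ => by linarith [(Nat.cast_nonneg N : (0 : ℝ) ≤ N)],
    prod_largeCube]

theorem card_cubeIndex_mul {N k : ℕ} (hk : 0 < k) :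
    ((cubeIndex d N k).card : ℝ) * (1 / k : ℝ) ^ d = (2 * N : ℝ) ^ d := by
  have hk' : (k : ℝ) ≠ 0 := by exact_mod_cast hk.ne'
  have h1 : ((N : ℤ) * k - -(N * k : ℤ)).toNat = 2 * N * k := by
    have : (N : ℤ) * k - -(N * k : ℤ) = (2 * N * k : ℕ) := by push_cast; ring
    rw [this, Int.toNat_natCast]
  rw [cubeIndex, Fintype.card_piFinset, Finset.prod_const, Finset.card_univ, Fintype.card_fin,
    Int.card_Ico, h1]
  push_cast
  rw [← mul_pow]
  congr 1
  field_simp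

theorem smallCube_disjoint {k : ℕ} (hk : 0 < k) {j j' : Fin d → ℤ} (h : j ≠ j') :
    Disjoint (smallCube k j) (smallCube k j') := by
  have hk' : (0 : ℝ) < k := by exact_mod_cast hk
  obtain ⟨i, hi⟩ := Function.ne_iff.1 h
  rw [Set.disjoint_left]
  intro x hx hx'
  obtain ⟨h1, h2⟩ := hx i
  obtain ⟨h3, h4⟩ := hx' i
  have h5 : (j i : ℝ) < j' i + 1 := by
    have := h1.trans h4
    rwa [div_lt_div_iff_of_pos_right hk'] at this
  have h6 : (j' i : ℝ) < j i + 1 := by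
    have := h3.trans h2
    rwa [div_lt_div_iff_of_pos_right hk'] at this
  have h7 : j i < j' i + 1 := by exact_mod_cast h5
  have h8 : j' i < j i + 1 := by exact_mod_cast h6
  omega

theorem setIntegral_largeCube_eq_sum {N k : ℕ} (hk : 0 < k) {G : EuclideanSpace ℝ (Fin d) → ℝ}
    (hG : IntegrableOn G (largeCube d N)) :
    ∫ x in largeCube d N, G x = ∑ j ∈ cubeIndex d N k, ∫ x in smallCube k j, G x := by
  have hmeas : ∀ j ∈ cubeIndex d N k, MeasurableSet (smallCube k j) := fun j _ =>
    (isOpen_openBox _ _).measurableSet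
  have hdisj : (cubeIndex d N k : Set (Fin d → ℤ)).PairwiseDisjoint (smallCube k) :=
    fun j _ j' _ h => smallCube_disjoint hk h
  have hsub : (⋃ j ∈ cubeIndex d N k, smallCube k j) ⊆ largeCube d N :=
    Set.iUnion₂_subset fun j hj => smallCube_subset hk hj
  rw [← integral_biUnion_finset _ hmeas hdisj fun j hj => hG.mono_set (smallCube_subset hk hj)]
  -- The open small cubes miss only the faces between them: their total volume equals that of the
  -- large cube.
  refine setIntegral_congr_set (ae_eq_of_subset_of_measure_ge hsub ?_ ?_ ?_).symm
  · rw [measure_biUnion_finset hdisj hmeas, volume_largeCube, ← card_cubeIndex_mul hk,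
      Finset.sum_congr rfl fun j _ => volume_smallCube hk j, Finset.sum_const, nsmul_eq_mul,
      ENNReal.ofReal_mul (Nat.cast_nonneg _), ENNReal.ofReal_natCast]
  · exact (Finset.measurableSet_biUnion _ hmeas).nullMeasurableSet
  · rw [volume_largeCube]
    exact ENNReal.ofReal_ne_top

theorem latSmallCube_subset {k : ℕ} (j : Fin d → ℤ) {c c' : ℝ} (h : c' ≤ c) (β : ℝ) :
    latSmallCube k j c β ⊆ latSmallCube k j c' β :=
  latBox_mono (fun _ => by linarith) fun _ => by linarith

theorem latSmallCube_subset_large {N k : ℕ} (hk : 0 < k) {j : Fin d → ℤ}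
    (hj : j ∈ cubeIndex d N k) {c β : ℝ} (hc : 0 ≤ c) (hβ : 0 ≤ β) :
    latSmallCube k j c β ⊆ latLargeCube d N β :=
  latBox_mono (fun i => by nlinarith [mul_le_mul_of_nonneg_left (cube_bounds hk hj i).1 hβ])
    fun i => by nlinarith [mul_le_mul_of_nonneg_left (cube_bounds hk hj i).2 hβ]

/-- With margin 1 the lattice sets of different cubes are neither overlapping nor adjacent, so their
sections decouple. -/
theorem exists_one_lt_abs_sub {k : ℕ} {j j' : Fin d → ℤ} (h : j ≠ j') {β : ℝ}
    (hβ : 0 ≤ β) {n m : Zd d} (hn : n ∈ latSmallCube k j 1 β) (hm : m ∈ latSmallCube k j' 1 β) :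
    ∃ i, 1 < |(m i : ℝ) - n i| := by
  obtain ⟨i, hi⟩ := Function.ne_iff.1 h
  refine ⟨i, ?_⟩
  have hn := mem_latBox.1 hn i
  have hm := mem_latBox.1 hm i
  have key : ∀ a b : ℤ, a < b → β * (((a : ℝ) + 1) / k) ≤ β * ((b : ℝ) / k) := fun a b hab => by
    have : (a : ℝ) + 1 ≤ b := by exact_mod_cast hab
    gcongr
  rw [lt_abs]
  rcases lt_or_gt_of_ne hi with h1 | h1
  · left
    linarith [key _ _ h1]
  · right
    linarith [key _ _ h1]

open Classical in
theorem sectionCount_biUnion_latSmallCube {k : ℕ} {β : ℝ} (hβ : 0 ≤ β) (f : Zd d → ℝ)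
    (hf : IsBoundedFun f) (J : Finset (Fin d → ℤ)) (E : ℝ) :
    sectionCount f (J.biUnion fun j => latSmallCube k j 1 β) E
      = ∑ j ∈ J, sectionCount f (latSmallCube k j 1 β) E := by
  refine sectionCount_biUnion f hf J _ (fun i _ j _ hij => ?_) (fun i _ j _ hij n hn v hv hm => ?_) E
  · rw [Finset.disjoint_left]
    intro n hn hm
    obtain ⟨t, ht⟩ := exists_one_lt_abs_sub hij hβ hn hm
    rw [sub_self, abs_zero] at ht
    linarith
  · obtain ⟨t, ht⟩ := exists_one_lt_abs_sub hij hβ hn hm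
    rw [Pi.add_apply, Int.cast_add, add_sub_cancel_left] at ht
    linarith [abs_apply_le_one_of_mem_unitVectors hv t]

open Classical in
theorem card_biUnion_latSmallCube {k : ℕ} {β : ℝ} (hβ : 0 ≤ β) (J : Finset (Fin d → ℤ)) :
    (J.biUnion fun j => latSmallCube k j 1 β).card
      = ∑ j ∈ J, (latSmallCube k j 1 β).card := by
  refine Finset.card_biUnion fun i _ j _ hij => ?_
  change Disjoint _ _
  rw [Finset.disjoint_left]
  intro n hn hm
  obtain ⟨t, ht⟩ := exists_one_lt_abs_sub hij hβ hn hm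
  rw [sub_self, abs_zero] at ht
  linarith

/-- Removing the sites near the cube faces decouples the cubes and costs at most one eigenvalue per
removed site; restoring the margin within each cube only increases its count. The reverse bound
below uses the same cut. -/
theorem sectionCount_large_le {N k : ℕ} (hk : 0 < k) {β : ℝ} (hβ : 0 ≤ β) (f : Zd d → ℝ)
    (hf : IsBoundedFun f) (E : ℝ) :
    sectionCount f (latLargeCube d N β) E + ∑ j ∈ cubeIndex d N k, (latSmallCube k j 1 β).card
      ≤ ∑ j ∈ cubeIndex d N k, sectionCount f (latSmallCube k j 0 β) E
        + (latLargeCube d N β).card := by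
  classical
  have hsub : (cubeIndex d N k).biUnion (fun j => latSmallCube k j 1 β) ⊆ latLargeCube d N β :=
    Finset.biUnion_subset.2 fun j hj => latSmallCube_subset_large hk hj zero_le_one hβ
  have h1 := sectionCount_add_card_le f hf hsub E
  rw [sectionCount_biUnion_latSmallCube hβ f hf, card_biUnion_latSmallCube hβ] at h1
  refine h1.trans (Nat.add_le_add_right (Finset.sum_le_sum fun j _ => ?_) _)
  exact sectionCount_mono_set f hf (latSmallCube_subset j zero_le_one β) E

theorem sum_sectionCount_le {N k : ℕ} (hk : 0 < k) {β : ℝ} (hβ : 0 ≤ β) (f : Zd d → ℝ)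
    (hf : IsBoundedFun f) (E : ℝ) :
    ∑ j ∈ cubeIndex d N k, sectionCount f (latSmallCube k j 0 β) E
        + ∑ j ∈ cubeIndex d N k, (latSmallCube k j 1 β).card
      ≤ sectionCount f (latLargeCube d N β) E
        + ∑ j ∈ cubeIndex d N k, (latSmallCube k j 0 β).card := by
  classical
  have hsub : (cubeIndex d N k).biUnion (fun j => latSmallCube k j 1 β) ⊆ latLargeCube d N β :=
    Finset.biUnion_subset.2 fun j hj => latSmallCube_subset_large hk hj zero_le_one hβ
  have h1 := sectionCount_mono_set f hf hsub E
  rw [sectionCount_biUnion_latSmallCube hβ f hf] at h1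
  refine le_trans ?_ (Nat.add_le_add_right h1 _)
  rw [← Finset.sum_add_distrib, ← Finset.sum_add_distrib]
  exact Finset.sum_le_sum fun j _ =>
    sectionCount_add_card_le f hf (latSmallCube_subset j zero_le_one β) E

theorem tendsto_card_latSmallCube {k : ℕ} (hk : 0 < k) (j : Fin d → ℤ) (c : ℝ) :
    Tendsto (fun β : ℝ => ((latSmallCube k j c β).card : ℝ) / β ^ d) atTop
      (𝓝 ((1 / k : ℝ) ^ d)) := by
  rw [← prod_smallCube j]
  exact tendsto_card_latBox_div (smallCube_lt hk j) c

theorem tendsto_sum_card_latSmallCube {N k : ℕ} (hk : 0 < k) (c : ℝ) :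
    Tendsto (fun β : ℝ => ((∑ j ∈ cubeIndex d N k, (latSmallCube k j c β).card : ℕ) : ℝ) / β ^ d)
      atTop (𝓝 ((2 * N : ℝ) ^ d)) := by
  rw [← card_cubeIndex_mul hk, ← nsmul_eq_mul, ← Finset.sum_const]
  refine (tendsto_finsetSum _ fun j _ => tendsto_card_latSmallCube hk j c).congr fun β => ?_
  rw [Nat.cast_sum, Finset.sum_div]

theorem tendsto_card_latLargeCube {N : ℕ} (hN : 0 < N) :
    Tendsto (fun β : ℝ => ((latLargeCube d N β).card : ℝ) / β ^ d) atTop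
      (𝓝 ((2 * N : ℝ) ^ d)) := by
  have hN' : (0 : ℝ) < N := by exact_mod_cast hN
  rw [← prod_largeCube]
  exact tendsto_card_latBox_div_zero fun _ => by linarith

theorem setIntegral_smallCube_const {k : ℕ} (hk : 0 < k) (j : Fin d → ℤ) (m : ℝ) :
    ∫ _x in smallCube k j, m = (1 / k : ℝ) ^ d * m := by
  rw [setIntegral_const, Measure.real, volume_smallCube hk, ENNReal.toReal_ofReal (by positivity),
    smul_eq_mul]

/-- Upper bound for the normalized eigenvalue count of a family of operators by the integral of a
function that dominates the local densities of states. -/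
theorem eventually_sectionCount_div_le {N k : ℕ} (hN : 0 < N) (hk : 0 < k) {F : ℝ → Zd d → ℝ}
    (hF : ∀ β, IsBoundedFun (F β)) {E : ℝ} {G : EuclideanSpace ℝ (Fin d) → ℝ}
    (hG : IntegrableOn G (largeCube d N))
    (h : ∀ j ∈ cubeIndex d N k, ∃ m : ℝ, (∀ x ∈ smallCube k j, m ≤ G x) ∧ ∃ b : ℝ → ℝ,
      Tendsto (fun β => b β / β ^ d) atTop (𝓝 ((1 / k : ℝ) ^ d * m)) ∧
      ∀ᶠ β in atTop, (sectionCount (F β) (latSmallCube k j 0 β) E : ℝ) ≤ b β)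
    {ε : ℝ} (hε : 0 < ε) :
    ∀ᶠ β in atTop, (sectionCount (F β) (latLargeCube d N β) E : ℝ) / β ^ d
      ≤ (∫ x in largeCube d N, G x) + ε := by
  choose! m hm b hb hbe using h
  have hint : ∑ j ∈ cubeIndex d N k, (1 / k : ℝ) ^ d * m j ≤ ∫ x in largeCube d N, G x := by
    rw [setIntegral_largeCube_eq_sum hk hG]
    refine Finset.sum_le_sum fun j hj => ?_
    rw [← setIntegral_smallCube_const hk j]
    refine setIntegral_mono_on ?_ (hG.mono_set (smallCube_subset hk hj))
      (isOpen_openBox _ _).measurableSet (hm j hj)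
    refine integrableOn_const (by rw [volume_smallCube hk]; exact ENNReal.ofReal_ne_top)
  -- The two cardinalities have the same limit after division by `β ^ d`, so the sites removed by
  -- the cut disappear from the bound.
  have hlim := ((tendsto_finsetSum (cubeIndex d N k) fun j hj => hb j hj).add
    (tendsto_card_latLargeCube (d := d) hN)).sub (tendsto_sum_card_latSmallCube (d := d) (N := N) hk 1)
  rw [add_sub_cancel_right] at hlim
  have hev := hlim.eventually_lt_const (lt_add_of_le_of_pos hint hε)
  filter_upwards [hev, (eventually_all_finset (cubeIndex d N k)).2 hbe, eventually_gt_atTop 0]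
    with β h1 h2 hβ
  refine le_trans ?_ h1.le
  have h3 := sectionCount_large_le (N := N) hk hβ.le (F β) (hF β) E
  have h4 : (sectionCount (F β) (latLargeCube d N β) E : ℝ)
      + (∑ j ∈ cubeIndex d N k, (latSmallCube k j 1 β).card : ℕ)
      ≤ (∑ j ∈ cubeIndex d N k, sectionCount (F β) (latSmallCube k j 0 β) E : ℕ)
        + (latLargeCube d N β).card := by exact_mod_cast h3
  have h5 : ((∑ j ∈ cubeIndex d N k, sectionCount (F β) (latSmallCube k j 0 β) E : ℕ) : ℝ)
      ≤ ∑ j ∈ cubeIndex d N k, b j β := by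
    rw [Nat.cast_sum]
    exact Finset.sum_le_sum h2
  rw [← Finset.sum_div, ← add_div, ← sub_div]
  gcongr
  linarith

/-- Lower bound for the normalized eigenvalue count of a family of operators by the integral of a
function that is dominated by the local densities of states. -/
theorem eventually_le_sectionCount_div {N k : ℕ} (hk : 0 < k) {F : ℝ → Zd d → ℝ}
    (hF : ∀ β, IsBoundedFun (F β)) {E : ℝ} {G : EuclideanSpace ℝ (Fin d) → ℝ}
    (hG : IntegrableOn G (largeCube d N))
    (h : ∀ j ∈ cubeIndex d N k, ∃ m : ℝ, (∀ x ∈ smallCube k j, G x ≤ m) ∧ ∃ b : ℝ → ℝ,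
      Tendsto (fun β => b β / β ^ d) atTop (𝓝 ((1 / k : ℝ) ^ d * m)) ∧
      ∀ᶠ β in atTop, b β ≤ (sectionCount (F β) (latSmallCube k j 0 β) E : ℝ))
    {ε : ℝ} (hε : 0 < ε) :
    ∀ᶠ β in atTop, (∫ x in largeCube d N, G x) - ε
      ≤ (sectionCount (F β) (latLargeCube d N β) E : ℝ) / β ^ d := by
  choose! m hm b hb hbe using h
  have hint : ∫ x in largeCube d N, G x ≤ ∑ j ∈ cubeIndex d N k, (1 / k : ℝ) ^ d * m j := by
    rw [setIntegral_largeCube_eq_sum hk hG]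
    refine Finset.sum_le_sum fun j hj => ?_
    rw [← setIntegral_smallCube_const hk j]
    refine setIntegral_mono_on (hG.mono_set (smallCube_subset hk hj)) ?_
      (isOpen_openBox _ _).measurableSet (hm j hj)
    refine integrableOn_const (by rw [volume_smallCube hk]; exact ENNReal.ofReal_ne_top)
  have hlim := ((tendsto_finsetSum (cubeIndex d N k) fun j hj => hb j hj).add
    (tendsto_sum_card_latSmallCube (d := d) (N := N) hk 1)).sub
      (tendsto_sum_card_latSmallCube (d := d) (N := N) hk 0)
  rw [add_sub_cancel_right] at hlim
  have hev := hlim.eventually_const_lt (sub_lt_iff_lt_add.2 (lt_add_of_le_of_pos hint hε))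
  filter_upwards [hev, (eventually_all_finset (cubeIndex d N k)).2 hbe, eventually_gt_atTop 0]
    with β h1 h2 hβ
  refine h1.le.trans ?_
  have h3 := sum_sectionCount_le (N := N) hk hβ.le (F β) (hF β) E
  have h4 : ((∑ j ∈ cubeIndex d N k, sectionCount (F β) (latSmallCube k j 0 β) E : ℕ) : ℝ)
      + (∑ j ∈ cubeIndex d N k, (latSmallCube k j 1 β).card : ℕ)
      ≤ (sectionCount (F β) (latLargeCube d N β) E : ℝ)
        + (∑ j ∈ cubeIndex d N k, (latSmallCube k j 0 β).card : ℕ) := by exact_mod_cast h3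
  have h5 : ∑ j ∈ cubeIndex d N k, b j β
      ≤ ((∑ j ∈ cubeIndex d N k, sectionCount (F β) (latSmallCube k j 0 β) E : ℕ) : ℝ) := by
    rw [Nat.cast_sum]
    exact Finset.sum_le_sum h2
  rw [← Finset.sum_div, ← add_div, ← sub_div]
  gcongr
  linarith

end Cubes

/-! ### Asymptotics of perturbed finite sections and of the crossing number. -/

section Asymptotics

variable {d : ℕ} {Ψ : EuclideanSpace ℝ (Fin d) → ℝ} {p : ℝ}

theorem smallCube_nonempty {k : ℕ} (hk : 0 < k) (j : Fin d → ℤ) : (smallCube k j).Nonempty :=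
  ⟨WithLp.toLp 2 fun i => ((j i : ℝ) / k + ((j i : ℝ) + 1) / k) / 2, fun i => by
    have := smallCube_lt hk j i
    exact ⟨by simp only; linarith, by simp only; linarith⟩⟩

theorem norm_sub_le_of_mem_smallCube {k : ℕ} {j : Fin d → ℤ}
    {x y : EuclideanSpace ℝ (Fin d)} (hx : x ∈ smallCube k j) (hy : y ∈ smallCube k j) :
    ‖x - y‖ ≤ d * (1 / k) := by
  refine norm_le_of_forall_abs_le (by positivity) fun i => ?_
  obtain ⟨h1, h1'⟩ := hx i
  obtain ⟨h2, h2'⟩ := hy i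
  simp only [add_div] at h1 h1' h2 h2'
  rw [PiLp.sub_apply, abs_le]
  exact ⟨by linarith, by linarith⟩

theorem norm_le_of_mem_largeCube {N : ℕ} {x : EuclideanSpace ℝ (Fin d)}
    (hx : x ∈ largeCube d N) : ‖x‖ ≤ d * N :=
  norm_le_of_forall_abs_le (Nat.cast_nonneg N) fun i => abs_le.2 ⟨(hx i).1.le, (hx i).2.le⟩

theorem inv_smul_pt_mem_smallCube {k : ℕ} {j : Fin d → ℤ} {β : ℝ} (hβ : 0 < β) {n : Zd d}
    (hn : n ∈ latSmallCube k j 0 β) : β⁻¹ • pt n ∈ smallCube k j := fun i => by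
  have h := mem_latBox.1 hn i
  rw [add_zero, sub_zero] at h
  change _ < β⁻¹ * (n i : ℝ) ∧ β⁻¹ * (n i : ℝ) < _
  rwa [lt_inv_mul_iff₀ hβ, inv_mul_lt_iff₀ hβ]

/-- A mesh so fine that each cube is near the origin or the profile hardly varies on it. -/
theorem exists_mesh (hΨ : ContinuousOn Ψ (Metric.sphere 0 1)) (N : ℕ) {η : ℝ} (hη : 0 < η) :
    ∃ k : ℕ, 0 < k ∧ ∀ j ∈ cubeIndex d N k, (∀ x ∈ smallCube k j, ‖x‖ < 2 * η) ∨
      ((∀ x ∈ smallCube k j, η ≤ ‖x‖) ∧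
        ∀ x ∈ smallCube k j, ∀ y ∈ smallCube k j, |profile Ψ p x - profile Ψ p y| ≤ η / 4) := by
  let K : Set (EuclideanSpace ℝ (Fin d)) := Metric.closedBall 0 (d * N) \ Metric.ball 0 η
  have hK : IsCompact K := (isCompact_closedBall _ _).diff Metric.isOpen_ball
  have hc : ContinuousOn (profile Ψ p) K := (continuousOn_profile hΨ).mono fun x hx h0 => by
    rw [Set.mem_singleton_iff] at h0
    exact hx.2 (h0 ▸ Metric.mem_ball_self hη)
  obtain ⟨δ, hδ, hδK⟩ := Metric.uniformContinuousOn_iff.1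
    (hK.uniformContinuousOn_of_continuous hc) (η / 4) (by positivity)
  have hm : 0 < min δ η := lt_min hδ hη
  obtain ⟨k, hk⟩ := exists_nat_gt (d / min δ η)
  have hk0 : (0 : ℝ) < k := lt_of_le_of_lt (by positivity) hk
  have hdk : d * (1 / k : ℝ) < min δ η := by
    rw [div_lt_iff₀ hm] at hk
    rw [mul_one_div, div_lt_iff₀ hk0, mul_comm]
    exact hk
  refine ⟨k, by exact_mod_cast hk0, fun j hj => ?_⟩
  -- The mesh makes every diameter less than `min δ η`. A cube meeting the ball of radius `η` lies
  -- in that of radius `2 * η`; any other lies in the compact set `K` of uniform continuity.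
  by_cases h : ∃ x ∈ smallCube k j, ‖x‖ < η
  · left
    obtain ⟨x, hx, hxη⟩ := h
    intro y hy
    have h1 := (norm_sub_le_of_mem_smallCube hy hx).trans_lt (hdk.trans_le (min_le_right _ _))
    have h2 := norm_sub_norm_le y x
    linarith
  · right
    push Not at h
    have hmem : ∀ x ∈ smallCube k j, x ∈ K := fun x hx =>
      ⟨mem_closedBall_zero_iff.2 (norm_le_of_mem_largeCube
        (smallCube_subset (by exact_mod_cast hk0) hj hx)), fun hb =>
        absurd (mem_ball_zero_iff.1 hb) (not_lt.2 (h x hx))⟩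
    refine ⟨h, fun x hx y hy => ?_⟩
    have h1 := (norm_sub_le_of_mem_smallCube hx hy).trans_lt (hdk.trans_le (min_le_left _ _))
    rw [← dist_eq_norm] at h1
    exact (hδK x (hmem x hx) y (hmem y hy) h1).le

theorem integrableOn_largeCube_of_bounded {N : ℕ} {G : EuclideanSpace ℝ (Fin d) → ℝ}
    (hG : Measurable G) (h0 : ∀ x, 0 ≤ G x) (h1 : ∀ x, G x ≤ 1) :
    IntegrableOn G (largeCube d N) := by
  refine Measure.integrableOn_of_bounded (M := 1) ?_ hG.aestronglyMeasurable
    (Eventually.of_forall fun x => ?_)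
  · rw [volume_largeCube]
    exact ENNReal.ofReal_ne_top
  · rw [Real.norm_of_nonneg (h0 x)]
    exact h1 x

/-- `ρ(E + Ψ(θ)|x|^{-p} + t)` off a ball of radius `r`, and the constant `c` on that ball. -/
def shiftedDensity (ρ : ℝ → ℝ) (Ψ : EuclideanSpace ℝ (Fin d) → ℝ) (p E c r t : ℝ)
    (x : EuclideanSpace ℝ (Fin d)) : ℝ :=
  open Classical in if ‖x‖ < r then c else ρ (E + profile Ψ p x + t)

variable {f V : Zd d → ℝ} {ρ : ℝ → ℝ} {E : ℝ}

theorem measurable_shiftedDensity (hΨ : ContinuousOn Ψ (Metric.sphere 0 1)) (hρ : Monotone ρ)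
    (c r t : ℝ) : Measurable (shiftedDensity ρ Ψ p E c r t) := by
  unfold shiftedDensity
  refine Measurable.ite (measurableSet_lt measurable_norm measurable_const) measurable_const ?_
  exact hρ.measurable.comp ((measurable_const.add (measurable_profile hΨ)).add measurable_const)

theorem integrableOn_shiftedDensity (hΨ : ContinuousOn Ψ (Metric.sphere 0 1))
    (hρ : HasDensityOfStates f ρ) (hf : IsBoundedFun f) (N : ℕ) {c : ℝ} (hc0 : 0 ≤ c)
    (hc1 : c ≤ 1) (r t : ℝ) :
    IntegrableOn (shiftedDensity ρ Ψ p E c r t) (largeCube d N) := by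
  refine integrableOn_largeCube_of_bounded
    (measurable_shiftedDensity hΨ (hρ.monotone hf) c r t) (fun x => ?_) fun x => ?_
  · unfold shiftedDensity
    split_ifs
    exacts [hc0, hρ.nonneg _]
  · unfold shiftedDensity
    split_ifs
    exacts [hc1, hρ.le_one _]

/-- Dominated convergence: at almost every `x` the ball eventually excludes `x`, and `ρ` is
continuous at `E + profile Ψ p x`, so the shift disappears in the limit. -/
theorem tendsto_setIntegral_shiftedDensity (hd : 1 ≤ d)
    (hΨ : ContinuousOn Ψ (Metric.sphere 0 1)) (hp : 0 < p)
    (hρ : HasDensityOfStates f ρ) (hf : IsBoundedFun f) (hE : ContinuousAt ρ E) (N : ℕ) {c : ℝ}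
    (hc0 : 0 ≤ c) (hc1 : c ≤ 1) {r t : ℕ → ℝ} (hr : Tendsto r atTop (𝓝 0))
    (ht : Tendsto t atTop (𝓝 0)) :
    Tendsto (fun m => ∫ x in largeCube d N, shiftedDensity ρ Ψ p E c (r m) (t m) x) atTop
      (𝓝 (∫ x in largeCube d N, ρ (E + profile Ψ p x))) := by
  -- Positive dimension is what makes the origin a null set.
  have : Nonempty (Fin d) := ⟨⟨0, hd⟩⟩
  have hfin : IsFiniteMeasure (volume.restrict (largeCube d N)) :=
    isFiniteMeasure_restrict.2 (by rw [volume_largeCube]; exact ENNReal.ofReal_ne_top)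
  refine tendsto_integral_of_dominated_convergence (fun _ => 1)
    (fun m => (measurable_shiftedDensity hΨ (hρ.monotone hf) c (r m) (t m)).aestronglyMeasurable)
    (integrable_const 1) (fun m => Eventually.of_forall fun x => ?_) (ae_restrict_of_ae ?_)
  · unfold shiftedDensity
    rw [Real.norm_eq_abs, abs_le]
    split_ifs
    · exact ⟨by linarith, hc1⟩
    · exact ⟨by linarith [hρ.nonneg (E + profile Ψ p x + t m)], hρ.le_one _⟩
  · have h0 : ∀ᵐ x ∂(volume : Measure (EuclideanSpace ℝ (Fin d))), x ≠ 0 := by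
      rw [ae_iff]
      simp
    filter_upwards [ae_continuousAt_add_profile hΨ hp (hρ.monotone hf) hE, h0] with x hx hx0
    have h1 : Tendsto (fun m => E + profile Ψ p x + t m) atTop (𝓝 (E + profile Ψ p x)) := by
      simpa using ht.const_add (E + profile Ψ p x)
    refine (hx.tendsto.comp h1).congr' ?_
    filter_upwards [hr.eventually_lt_const (norm_pos_iff.2 hx0)] with m hm
    unfold shiftedDensity
    rw [if_neg (not_lt.2 hm.le), Function.comp_apply]

theorem isBoundedFun_sub_mul (hf : IsBoundedFun f) (hV : IsBoundedFun V) (t : ℝ) :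
    IsBoundedFun fun n => f n - t * V n := by
  obtain ⟨C, hC⟩ := hf
  obtain ⟨C', hC'⟩ := hV
  refine ⟨C + |t| * C', fun n => (abs_sub _ _).trans (add_le_add (hC n) ?_)⟩
  rw [abs_mul]
  exact mul_le_mul_of_nonneg_left (hC' n) (abs_nonneg t)

theorem HasDensityOfStates.tendsto_latSmallCube (hρ : HasDensityOfStates f ρ) {k : ℕ} (hk : 0 < k)
    (j : Fin d → ℤ) (E : ℝ) :
    Tendsto (fun β : ℝ => (sectionCount f (latSmallCube k j 0 β) E : ℝ) / β ^ d) atTop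
      (𝓝 ((1 / k : ℝ) ^ d * ρ E)) := by
  have h := hρ.tendsto_sectionCount (smallCube_lt hk j) E
  rw [prod_smallCube] at h
  simpa only [latSmallCube, add_zero, sub_zero] using h

/-- The rescaled potential is close to the profile at a point of the cube. -/
theorem eventually_abs_sub_profile_le_of_cube (hV : HasDecay V Ψ p) (hp : 0 < p) {η : ℝ}
    (hη : 0 < η) {k : ℕ} {j : Fin d → ℤ} (hfar : ∀ x ∈ smallCube k j, η ≤ ‖x‖)
    (hosc : ∀ x ∈ smallCube k j, ∀ y ∈ smallCube k j, |profile Ψ p x - profile Ψ p y| ≤ η / 4)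
    {x₀ : EuclideanSpace ℝ (Fin d)} (hx₀ : x₀ ∈ smallCube k j) :
    ∀ᶠ β : ℝ in atTop, ∀ n ∈ latSmallCube k j 0 β, |β ^ p * V n - profile Ψ p x₀| ≤ η / 2 := by
  filter_upwards [hV.eventually_abs_sub_profile_le hp hη (show 0 < η / 4 by positivity),
    eventually_gt_atTop 0] with β h hβ n hn
  have hx := inv_smul_pt_mem_smallCube hβ hn
  have h1 := hfar _ hx
  rw [norm_smul, norm_inv, Real.norm_of_nonneg hβ.le, le_inv_mul_iff₀ hβ] at h1
  have h2 := h n h1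
  have h3 := hosc _ hx _ hx₀
  have h4 := abs_sub_le (β ^ p * V n) (profile Ψ p (β⁻¹ • pt n)) (profile Ψ p x₀)
  linarith

/-- Near the origin the profile may be unbounded and only the trivial density bound 1 is used. On
other cubes the potential is replaced by a constant: the error `η / 2` of this replacement and the
oscillation `η / 4` fit into the shift `η`. The lower bound is symmetric, with 0 near the origin and
shift `-η`. -/
theorem eventually_sectionCount_le_integral (hf : IsBoundedFun f)
    (hΨ : ContinuousOn Ψ (Metric.sphere 0 1)) (hp : 0 < p) (hVb : IsBoundedFun V)
    (hV : HasDecay V Ψ p) (hρ : HasDensityOfStates f ρ) {N : ℕ} (hN : 0 < N) {η ε : ℝ}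
    (hη : 0 < η) (hε : 0 < ε) :
    ∀ᶠ β : ℝ in atTop,
      (sectionCount (fun n => f n - β ^ p * V n) (latLargeCube d N β) E : ℝ) / β ^ d
        ≤ (∫ x in largeCube d N, shiftedDensity ρ Ψ p E 1 (2 * η) η x) + ε := by
  obtain ⟨k, hk, hmesh⟩ := exists_mesh (p := p) hΨ N hη
  have hF : ∀ β : ℝ, IsBoundedFun fun n => f n - β ^ p * V n := fun β =>
    isBoundedFun_sub_mul hf hVb _
  refine eventually_sectionCount_div_le (F := fun β n => f n - β ^ p * V n) hN hk hF
    (integrableOn_shiftedDensity hΨ hρ hf N zero_le_one le_rfl _ _) (fun j hj => ?_) hε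
  rcases hmesh j hj with hnear | ⟨hfar, hosc⟩
  · refine ⟨1, fun x hx => ?_, fun β => (latSmallCube k j 0 β).card, ?_,
      Eventually.of_forall fun β => Nat.cast_le.2 (sectionCount_le_card _ _ _)⟩
    · rw [shiftedDensity, if_pos (hnear x hx)]
    · rw [mul_one]
      exact tendsto_card_latSmallCube hk j 0
  · obtain ⟨x₀, hx₀⟩ := smallCube_nonempty hk j
    refine ⟨ρ (E + profile Ψ p x₀ + η / 2), fun x hx => ?_, _,
      hρ.tendsto_latSmallCube hk j (E + profile Ψ p x₀ + η / 2), ?_⟩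
    · unfold shiftedDensity
      split_ifs
      · exact hρ.le_one _
      · refine hρ.monotone hf ?_
        have := (abs_le.1 (hosc _ hx₀ _ hx)).2
        linarith
    · filter_upwards [eventually_abs_sub_profile_le_of_cube hV hp hη hfar hosc hx₀] with β hβ
      exact_mod_cast sectionCount_mono f _ hf (hF β) fun n hn => by
        have := (abs_le.1 (hβ n hn)).2
        linarith

theorem eventually_integral_le_sectionCount (hf : IsBoundedFun f)
    (hΨ : ContinuousOn Ψ (Metric.sphere 0 1)) (hp : 0 < p) (hVb : IsBoundedFun V)
    (hV : HasDecay V Ψ p) (hρ : HasDensityOfStates f ρ) (N : ℕ) {η ε : ℝ}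
    (hη : 0 < η) (hε : 0 < ε) :
    ∀ᶠ β : ℝ in atTop,
      (∫ x in largeCube d N, shiftedDensity ρ Ψ p E 0 (2 * η) (-η) x) - ε
        ≤ (sectionCount (fun n => f n - β ^ p * V n) (latLargeCube d N β) E : ℝ) / β ^ d := by
  obtain ⟨k, hk, hmesh⟩ := exists_mesh (p := p) hΨ N hη
  have hF : ∀ β : ℝ, IsBoundedFun fun n => f n - β ^ p * V n := fun β =>
    isBoundedFun_sub_mul hf hVb _
  refine eventually_le_sectionCount_div (F := fun β n => f n - β ^ p * V n) hk hF
    (integrableOn_shiftedDensity hΨ hρ hf N le_rfl zero_le_one _ _) (fun j hj => ?_) hε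
  rcases hmesh j hj with hnear | ⟨hfar, hosc⟩
  · refine ⟨0, fun x hx => ?_, fun β => 0, ?_,
      Eventually.of_forall fun β => Nat.cast_nonneg _⟩
    · rw [shiftedDensity, if_pos (hnear x hx)]
    · simp
  · obtain ⟨x₀, hx₀⟩ := smallCube_nonempty hk j
    refine ⟨ρ (E + profile Ψ p x₀ - η / 2), fun x hx => ?_, _,
      hρ.tendsto_latSmallCube hk j (E + profile Ψ p x₀ - η / 2), ?_⟩
    · unfold shiftedDensity
      split_ifs
      · exact hρ.nonneg _
      · refine hρ.monotone hf ?_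
        have := (abs_le.1 (hosc _ hx₀ _ hx)).1
        linarith
    · filter_upwards [eventually_abs_sub_profile_le_of_cube hV hp hη hfar hosc hx₀] with β hβ
      exact_mod_cast sectionCount_mono _ f (hF β) hf fun n hn => by
        have := (abs_le.1 (hβ n hn)).1
        linarith

/-- Asymptotics of the eigenvalue count of finite sections of `-Δ + f - β^p V`. -/
theorem tendsto_sectionCount_perturbed (hd : 1 ≤ d) (hf : IsBoundedFun f)
    (hΨ : ContinuousOn Ψ (Metric.sphere 0 1)) (hp : 0 < p) (hVb : IsBoundedFun V)
    (hV : HasDecay V Ψ p) (hρ : HasDensityOfStates f ρ) (hE : ContinuousAt ρ E) {N : ℕ}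
    (hN : 0 < N) :
    Tendsto (fun β : ℝ =>
        (sectionCount (fun n => f n - β ^ p * V n) (latLargeCube d N β) E : ℝ) / β ^ d) atTop
      (𝓝 (∫ x in largeCube d N, ρ (E + profile Ψ p x))) := by
  have h0 : Tendsto (fun m : ℕ => 1 / ((m : ℝ) + 1)) atTop (𝓝 0) :=
    tendsto_one_div_add_atTop_nhds_zero_nat
  have h2 : Tendsto (fun m : ℕ => 2 * (1 / ((m : ℝ) + 1))) atTop (𝓝 0) := by
    simpa using h0.const_mul 2
  have hneg : Tendsto (fun m : ℕ => -(1 / ((m : ℝ) + 1))) atTop (𝓝 0) := by simpa using h0.neg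
  have hU := tendsto_setIntegral_shiftedDensity hd hΨ hp hρ hf hE N zero_le_one le_rfl h2 h0
  have hL := tendsto_setIntegral_shiftedDensity hd hΨ hp hρ hf hE N le_rfl zero_le_one h2 hneg
  rw [tendsto_order]
  constructor
  · intro a ha
    have hgap : 0 < (∫ x in largeCube d N, ρ (E + profile Ψ p x)) - a := sub_pos.2 ha
    obtain ⟨m, hm⟩ := (hL.eventually_const_lt (show
      a + ((∫ x in largeCube d N, ρ (E + profile Ψ p x)) - a) / 2
        < ∫ x in largeCube d N, ρ (E + profile Ψ p x) by linarith)).exists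
    filter_upwards [eventually_integral_le_sectionCount (E := E) hf hΨ hp hVb hV hρ N
      (show 0 < 1 / ((m : ℝ) + 1) by positivity) (show
      0 < ((∫ x in largeCube d N, ρ (E + profile Ψ p x)) - a) / 2 by linarith)] with β hβ
    linarith
  · intro a ha
    obtain ⟨m, hm⟩ := (hU.eventually_lt_const (show
      ∫ x in largeCube d N, ρ (E + profile Ψ p x)
        < a - (a - ∫ x in largeCube d N, ρ (E + profile Ψ p x)) / 2 by linarith)).exists
    filter_upwards [eventually_sectionCount_le_integral (E := E) hf hΨ hp hVb hV hρ hN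
      (show 0 < 1 / ((m : ℝ) + 1) by positivity) (show
      0 < (a - ∫ x in largeCube d N, ρ (E + profile Ψ p x)) / 2 by linarith)] with β hβ
    linarith

theorem mul_le_norm_pt_of_notMem {N : ℕ} {β : ℝ} {n : Zd d} (hn : n ∉ latLargeCube d N β) :
    β * N ≤ ‖pt n‖ := by
  rw [latLargeCube, mem_latBox] at hn
  push Not at hn
  obtain ⟨i, hi⟩ := hn
  have h1 := PiLp.norm_apply_le (pt n) i
  rw [Real.norm_eq_abs] at h1
  have h2 : (pt n) i = (n i : ℝ) := rfl
  rw [h2] at h1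
  refine le_trans ?_ h1
  by_cases h : β * -(N : ℝ) < n i
  · exact (hi h).trans (le_abs_self _)
  · rw [le_abs]
    right
    linarith

theorem le_norm_of_notMem_largeCube {N : ℕ} {x : EuclideanSpace ℝ (Fin d)}
    (hx : x ∉ largeCube d N) : (N : ℝ) ≤ ‖x‖ := by
  have h : ¬ ∀ i, -(N : ℝ) < x i ∧ x i < N := hx
  push Not at h
  obtain ⟨i, hi⟩ := h
  have h1 := PiLp.norm_apply_le x i
  rw [Real.norm_eq_abs] at h1
  refine le_trans ?_ h1
  by_cases h : -(N : ℝ) < x i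
  · exact (hi h).trans (le_abs_self _)
  · rw [le_abs]
    right
    linarith

/-- The profile is small far from the origin. -/
theorem exists_forall_abs_profile_le (hΨ : ContinuousOn Ψ (Metric.sphere 0 1)) (hp : 0 < p)
    {κ : ℝ} (hκ : 0 < κ) :
    ∃ N : ℕ, 0 < N ∧ ∀ x : EuclideanSpace ℝ (Fin d), (N : ℝ) ≤ ‖x‖ → |profile Ψ p x| ≤ κ := by
  obtain ⟨C, hC0, hC⟩ := exists_abs_profile_le (p := p) hΨ hp
  have h1 : Tendsto (fun m : ℕ => C * (m : ℝ) ^ (-p)) atTop (𝓝 0) := by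
    have := ((tendsto_rpow_neg_atTop hp).comp tendsto_natCast_atTop_atTop).const_mul C
    rwa [mul_zero] at this
  obtain ⟨N, hN, hN0⟩ := ((h1.eventually_lt_const hκ).and (eventually_gt_atTop 0)).exists
  refine ⟨N, hN0, fun x hx => (hC x).trans (le_trans ?_ hN.le)⟩
  have hN' : (0 : ℝ) < N := by exact_mod_cast hN0
  exact mul_le_mul_of_nonneg_left
    (Real.rpow_le_rpow_of_nonpos hN' hx (neg_nonpos.2 hp.le)) hC0

theorem crossingNumber_ne_top (hf : IsBoundedFun f) (hΨ : ContinuousOn Ψ (Metric.sphere 0 1))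
    (hp : 0 < p) (hV0 : ∀ n, 0 ≤ V n) (hVb : IsBoundedFun V) (hV : HasDecay V Ψ p)
    {R : L2 d →L[ℂ] L2 d} (hR : IsResolventAt f hf E R) (α : ℝ) :
    crossingNumber (schrodinger f hf) (mulOp V hVb) E α ≠ ∞ := by
  rcases le_or_gt α 0 with hα | hα
  · have : IsEmpty (Set.Ioo (0 : ℝ) α) := Set.isEmpty_coe_sort.2 (Set.Ioo_eq_empty (not_lt.2 hα))
    rw [crossingNumber, tsum_empty]
    exact ENNReal.zero_ne_top
  · have hc : 0 < 1 / (‖R‖ + 1) := by positivity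
    have hcR : 1 / (‖R‖ + 1) * ‖R‖ ≤ 1 := by
      rw [one_div_mul_eq_div]
      exact div_le_one_of_le₀ (by linarith) (by positivity)
    have hev := (hV.tendsto_zero hΨ hp).eventually_le_const (show 0 < 1 / (‖R‖ + 1) / α by positivity)
    have hfin : {n | ¬ V n ≤ 1 / (‖R‖ + 1) / α}.Finite := hev
    -- For finiteness alone no boundary control is needed, so the interior set is taken empty.
    obtain ⟨N, hN, _⟩ := hR.exists_crossingNumber_eq hV0 hVb (hV.tendsto_zero hΨ hp) hα
      (isBoundedFun_sub_mul hf hVb α) (Finset.empty_subset hfin.toFinset) (by simp) hcR hc.le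
      fun n hn => by
        have : V n ≤ 1 / (‖R‖ + 1) / α := by
          by_contra h
          exact hn (hfin.mem_toFinset.2 h)
        rwa [le_div_iff₀ hα, mul_comm] at this
    rw [hN]
    exact ENNReal.natCast_ne_top N

/-- Asymptotics of the crossing number in terms of `β = α^{1/p}`. -/
theorem tendsto_crossingNumber_rpow (hd : 1 ≤ d) (hf : IsBoundedFun f)
    (hΨ : ContinuousOn Ψ (Metric.sphere 0 1)) (hp : 0 < p) (hV0 : ∀ n, 0 ≤ V n)
    (hVb : IsBoundedFun V) (hV : HasDecay V Ψ p) (hρ : HasDensityOfStates f ρ)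
    (hE : ContinuousAt ρ E) {R : L2 d →L[ℂ] L2 d} (hR : IsResolventAt f hf E R) {κ : ℝ}
    (hκ : 0 < κ) (hκR : κ * ‖R‖ ≤ 1) {N : ℕ} (hN : 0 < N)
    (hfar : ∀ x : EuclideanSpace ℝ (Fin d), (N : ℝ) ≤ ‖x‖ → |profile Ψ p x| ≤ κ / 2) :
    Tendsto (fun β : ℝ =>
        (crossingNumber (schrodinger f hf) (mulOp V hVb) E (β ^ p)).toReal / β ^ d) atTop
      (𝓝 ((∫ x in largeCube d N, ρ (E + profile Ψ p x)) - (2 * N : ℝ) ^ d * ρ E)) := by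
  have hN' : (0 : ℝ) < N := by exact_mod_cast hN
  have hlt : ∀ _ : Fin d, -(N : ℝ) < N := fun _ => by linarith
  have h1 := tendsto_sectionCount_perturbed hd hf hΨ hp hVb hV hρ hE hN
  have h2 := hρ.tendsto_sectionCount hlt E
  rw [prod_largeCube] at h2
  have h3 := tendsto_card_latLargeCube (d := d) hN
  have h4 := tendsto_card_latBox_div hlt 1
  rw [prod_largeCube] at h4
  have herr := (h3.sub h4).const_mul 2
  -- The boundary layer of width 1 contributes nothing at order `β ^ d`.
  rw [sub_self, mul_zero] at herr
  have hlow := (h1.sub h2).sub herr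
  have hup := (h1.sub h2).add herr
  rw [sub_zero] at hlow
  rw [add_zero] at hup
  have key : ∀ᶠ β : ℝ in atTop, 0 < β ∧ ∃ M : ℕ,
      crossingNumber (schrodinger f hf) (mulOp V hVb) E (β ^ p) = M ∧
      M + sectionCount f (latLargeCube d N β) E
          + 2 * (latBox (fun _ : Fin d => β * -(N : ℝ) + 1) (fun _ => β * N - 1)).card
        ≤ sectionCount (fun n => f n - β ^ p * V n) (latLargeCube d N β) E
          + 2 * (latLargeCube d N β).card ∧
      sectionCount (fun n => f n - β ^ p * V n) (latLargeCube d N β) E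
          + 2 * (latBox (fun _ : Fin d => β * -(N : ℝ) + 1) (fun _ => β * N - 1)).card
        ≤ M + sectionCount f (latLargeCube d N β) E + 2 * (latLargeCube d N β).card := by
    filter_upwards [eventually_gt_atTop 0, hV.eventually_abs_sub_profile_le hp hN'
      (show 0 < κ / 2 by positivity)] with β hβ hVβ
    refine ⟨hβ, hR.exists_crossingNumber_eq hV0 hVb (hV.tendsto_zero hΨ hp)
      (Real.rpow_pos_of_pos hβ p) (isBoundedFun_sub_mul hf hVb _)
      (latBox_mono (fun _ => by linarith) fun _ => by linarith)
      (fun n hn v hv => add_mem_latBox hn hv) hκR hκ.le fun n hn => ?_⟩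
    -- Off the cube, one half of `κ` bounds the profile and the other half its distance to the
    -- rescaled potential.
    have h5 := mul_le_norm_pt_of_notMem hn
    have h6 := (abs_le.1 (hVβ n h5)).2
    have h7 := (abs_le.1 (hfar (β⁻¹ • pt n) (by
      rwa [norm_smul, norm_inv, Real.norm_of_nonneg hβ.le, le_inv_mul_iff₀ hβ]))).2
    linarith
  refine tendsto_of_tendsto_of_tendsto_of_le_of_le' hlow hup ?_ ?_
  · filter_upwards [key] with β ⟨hβ, M, hM, _, hM2⟩
    have h8 : (sectionCount (fun n => f n - β ^ p * V n) (latLargeCube d N β) E : ℝ)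
          + 2 * (latBox (fun _ : Fin d => β * -(N : ℝ) + 1) (fun _ => β * N - 1)).card
        ≤ M + sectionCount f (latLargeCube d N β) E + 2 * (latLargeCube d N β).card := by
      exact_mod_cast hM2
    rw [hM, ENNReal.toReal_natCast, ← sub_div, ← sub_div, ← mul_div_assoc, ← sub_div]
    refine div_le_div_of_nonneg_right ?_ (by positivity)
    change _ - (sectionCount f (latLargeCube d N β) E : ℝ) - _ ≤ _
    linarith
  · filter_upwards [key] with β ⟨hβ, M, hM, hM1, _⟩
    have h8 : (M : ℝ) + sectionCount f (latLargeCube d N β) E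
          + 2 * (latBox (fun _ : Fin d => β * -(N : ℝ) + 1) (fun _ => β * N - 1)).card
        ≤ sectionCount (fun n => f n - β ^ p * V n) (latLargeCube d N β) E
          + 2 * (latLargeCube d N β).card := by exact_mod_cast hM1
    rw [hM, ENNReal.toReal_natCast, ← sub_div, ← sub_div, ← mul_div_assoc, ← add_div]
    refine div_le_div_of_nonneg_right ?_ (by positivity)
    change _ ≤ _ - (sectionCount f (latLargeCube d N β) E : ℝ) + _
    linarith

end Asymptotics

end

/-! ### The main theorem. -/

theorem theorem1p1 {d : ℕ} (hd : 1 ≤ d)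
    (f : Zd d → ℝ) (hf : IsBoundedFun f)
    (a b : ℝ) (hgap : IsSpectralGap (schrodinger f hf) a b)
    (p : ℝ) (hp : 0 < p)
    (Ψ : EuclideanSpace ℝ (Fin d) → ℝ) (hΨ : ContinuousOn Ψ (Metric.sphere 0 1))
    (V : Zd d → ℝ) (hV0 : ∀ n, 0 ≤ V n) (hV : HasDecay V Ψ p)
    (ρ : ℝ → ℝ) (hρ : HasDensityOfStates f ρ)
    (E : ℝ) (hE : E ∈ Set.Ioo a b) :
    (∀ α : ℝ, crossingNumber (schrodinger f hf) (mulOp V (hV.isBoundedFun hp hΨ)) E α ≠ ∞) ∧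
    Integrable (dosIncrement ρ Ψ p E) ∧
    Tendsto (fun α : ℝ =>
        (crossingNumber (schrodinger f hf) (mulOp V (hV.isBoundedFun hp hΨ)) E α).toReal
          / α ^ ((d : ℝ) / p))
      atTop (𝓝 (∫ x, dosIncrement ρ Ψ p E x)) ∧
    ((∫ x, dosIncrement ρ Ψ p E x) ≠ 0 →
      Asymptotics.IsEquivalent atTop
        (fun α : ℝ =>
          (crossingNumber (schrodinger f hf) (mulOp V (hV.isBoundedFun hp hΨ)) E α).toReal)
        (fun α : ℝ => α ^ ((d : ℝ) / p) * ∫ x, dosIncrement ρ Ψ p E x)) := by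
  have hVb := hV.isBoundedFun hp hΨ
  obtain ⟨R, hR⟩ := exists_isResolventAt f hf (hgap.disjoint E hE.1 hE.2)
  obtain ⟨κ, hκ, hκR, hκgap⟩ : ∃ κ : ℝ, 0 < κ ∧ κ * ‖R‖ ≤ 1 / 2 ∧
      ∀ E' : ℝ, |E - E'| ≤ κ → (E' : ℂ) ∉ spectrum ℂ (schrodinger f hf) := by
    have h1 := sub_pos.2 hE.1
    have h2 := sub_pos.2 hE.2
    -- The first term gives `κ * ‖R‖ ≤ 1 / 2`; the other two keep `[E - κ, E + κ]` inside the gap.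
    refine ⟨min (1 / (2 * (‖R‖ + 1))) (min ((E - a) / 2) ((b - E) / 2)), by positivity, ?_,
      fun E' hE' => ?_⟩
    · refine (mul_le_mul_of_nonneg_right (min_le_left _ _) (norm_nonneg R)).trans ?_
      rw [one_div_mul_eq_div, div_le_div_iff₀ (by positivity) (by positivity)]
      linarith
    · have h3 := hE'.trans ((min_le_right _ _).trans (min_le_left _ _))
      have h4 := hE'.trans ((min_le_right _ _).trans (min_le_right _ _))
      exact hgap.disjoint E' (by linarith [(abs_le.1 h3).2]) (by linarith [(abs_le.1 h4).1])
  have hconst : ∀ E', |E - E'| ≤ κ → ρ E' = ρ E := fun E' hE' =>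
    hρ.eq_of_abs_sub_le hR hκR hκgap hE'
  have hcont : ContinuousAt ρ E := by
    refine continuousAt_const.congr (f := fun _ => ρ E) ?_
    filter_upwards [Metric.ball_mem_nhds E hκ] with E' hE'
    refine (hconst E' ?_).symm
    rw [abs_sub_comm]
    exact (Metric.mem_ball.1 hE').le
  obtain ⟨N, hN, hfar⟩ := exists_forall_abs_profile_le (p := p) hΨ hp (half_pos hκ)
  -- Local constancy of `ρ` makes the integrand vanish off a bounded cube, so its integrability
  -- reduces to boundedness.
  have hzero : ∀ x, x ∉ largeCube d N → dosIncrement ρ Ψ p E x = 0 := fun x hx => by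
    have h1 := hfar x (le_norm_of_notMem_largeCube hx)
    change ρ (E + profile Ψ p x) - ρ E = 0
    rw [hconst, sub_self]
    rw [sub_add_cancel_left, abs_neg]
    linarith
  have hint : IntegrableOn (fun x => ρ (E + profile Ψ p x)) (largeCube d N) :=
    integrableOn_largeCube_of_bounded
      ((hρ.monotone hf).measurable.comp (measurable_const.add (measurable_profile hΨ)))
      (fun x => hρ.nonneg _) fun x => hρ.le_one _
  have hintc : IntegrableOn (fun _ : EuclideanSpace ℝ (Fin d) => ρ E) (largeCube d N) :=
    integrableOn_const (by rw [volume_largeCube]; exact ENNReal.ofReal_ne_top)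
  have hintI : ∫ x, dosIncrement ρ Ψ p E x
      = (∫ x in largeCube d N, ρ (E + profile Ψ p x)) - (2 * N : ℝ) ^ d * ρ E := by
    rw [← setIntegral_eq_integral_of_forall_compl_eq_zero hzero]
    refine (integral_sub hint hintc).trans ?_
    rw [setIntegral_const, Measure.real, volume_largeCube, ENNReal.toReal_ofReal (by positivity),
      smul_eq_mul]
  have hlim : Tendsto (fun α : ℝ =>
        (crossingNumber (schrodinger f hf) (mulOp V (hV.isBoundedFun hp hΨ)) E α).toReal
          / α ^ ((d : ℝ) / p)) atTop (𝓝 (∫ x, dosIncrement ρ Ψ p E x)) := by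
    have h1 := tendsto_crossingNumber_rpow hd hf hΨ hp hV0 hVb hV hρ hcont hR hκ
      (by linarith) hN hfar
    rw [← hintI] at h1
    -- Substitution `β = α ^ p⁻¹`, under which `β ^ d = α ^ (d / p)`.
    refine (h1.comp (tendsto_rpow_atTop (inv_pos.2 hp))).congr' ?_
    filter_upwards [eventually_gt_atTop 0] with α hα
    rw [Function.comp_apply, Real.rpow_inv_rpow hα.le hp.ne', ← Real.rpow_natCast,
      ← Real.rpow_mul hα.le, inv_mul_eq_div]
  refine ⟨crossingNumber_ne_top hf hΨ hp hV0 hVb hV hR, ?_, hlim, fun hne => ?_⟩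
  · refine IntegrableOn.integrable_of_forall_notMem_eq_zero (s := largeCube d N) ?_ hzero
    exact hint.sub hintc
  · rw [Asymptotics.isEquivalent_iff_tendsto_one]
    · have h1 := hlim.div_const (∫ x, dosIncrement ρ Ψ p E x)
      rw [div_self hne] at h1
      refine h1.congr fun α => ?_
      rw [Pi.div_apply, div_div]
    · filter_upwards [eventually_gt_atTop 0] with α hα
      exact mul_ne_zero (Real.rpow_pos_of_pos hα _).ne' hne
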